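/- **Theorem.** Let $c\ge 2$ be an integer and let $0<d<c-1$. There is a constant $C=C(c,d)>0$ such that the following holds for every $n\ge 2$, for every (possibly adaptive) user who issues queries $\texttt{BA-next-neighbor}(q(1)),\texttt{BA-next-neighbor}(q(2)),\dots$ with $q(t)\in[1,n]$ chosen as a function of the answers to the earlier queries (in particular for every fixed sequence of queries), and for every $t\ge1$. When the queries are answered by the on-the-fly Barabási–Albert generator described below, with parameters $n,c$, then with probability at least $1-n^{-d}$ all of the following hold for the $t$-th call: 1. the increase, during that call, of the space used (the number of keys and items stored in the data structures) is at most $C\log^2 n$; 2. the number of random bits used during that call is at most $C\log^4 n$; 3. the running time of that call is at most $C\log^5 n$. **The generator.** The state consists of arrays $u,\mathit{type},\mathit{front},\mathit{front}^{-1}$, of a balanced search tree $\texttt{child}(j)$ for each node $j$, created as $\{n+1\}$ at its first use, of a heap $\mathit{heap}_j$ for each node $j$, and of a flag $\mathit{first\_query}(j)$, initially true, for each $j$. Initially $u(1)=1$, $\mathit{type}(1)=\mathtt{dir}$, and everything else is $\mathsf{nil}$ or empty. Write $\varphi(a)=|\{i<a:\mathit{front}(i)=\mathsf{nil}\text{ or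 }\mathit{front}(i)<a\}|$ and $K=\{i:\mathit{front}(i)\ne\mathsf{nil},\ \mathit{front}^{-1}(i)=\mathsf{nil}\}$, where $\mathit{front}^{-1}(x)$ is, for $x\le n$, the node $i$ with $\mathit{front}(i)=x$, if there is one. $\mathrm{succ}(T,k)$ is the least element of $T$ larger than $k$. * $\texttt{parent}(j)$: if $u(j)=\mathsf{nil}$, draw $u(j)$ uniformly from $[1,j-1]$ and $\mathit{type}(j)$ uniformly from $\{\mathtt{dir},\mathtt{rec}\}$ and insert $j$ into $\texttt{child}(u(j))$. Return $(u(j),\mathit{type}(j))$. * $\texttt{toss}(\xi,t)$ returns a random rank in $\{0,\dots,t-1\}$ that is smaller than $y$ with probability $P'_y$, where $P'_0=0$, $P'_y=1-\frac{\xi-1}{\xi+y-1}$ for $0<y<t$, and $P'_t=1$: with $\alpha=n^c$ draw $M\in\{0,\dots,\alpha-1\}$ uniformly, find by binary search the largest $y\le t-1$ with $P'_y\le M/\alpha$, and return $y$ if $(M+1)/\alpha\le P'_{y+1}$. Otherwise, with $D=\prod_{y=1}^{t-1}(\xi+y-1)$, draw $M'\in\{0,\dots,D-1\}$ uniformly and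 return the largest $y\le t-1$ with $P'_y\le (MD+M')/(\alpha D)$, found by binary search. * $\texttt{next-child}(j)$: call $\texttt{parent}(j)$. If $\mathit{front}(j)\ne\mathsf{nil}$ and $\mathit{front}(j)\ge n$, return $n+1$. Let $k=\mathit{front}(j)$, or $k=j$ if $\mathit{front}(j)=\mathsf{nil}$, and let $a=k+1$ and $b=\mathrm{succ}(\texttt{child}(j),k)$. Repeat: let $s=|[a,b)\setminus K|$ and $h=\texttt{toss}(\varphi(a),s+1)$. If $h=s$, let $x=b$; otherwise let $x$ be the vertex of rank $h$ (counted from $0$) in $[a,b)\setminus K$; if then $u(x)\ne\mathsf{nil}$, set $a\leftarrow x+1$ and go on with the next round; else set $u(x)\leftarrow j$, draw $\mathit{type}(x)$ uniformly from $\{\mathtt{dir},\mathtt{rec}\}$, and insert $x$ into $\texttt{child}(j)$. Once $x$ is found in one of these two ways, set $\mathit{front}(j)\leftarrow x$ (and update $\mathit{front}^{-1}$ and $K$), call $\texttt{next-child}(x)$ if $x\le n$ and $\mathit{front}(x)=\mathsf{nil}$, and return $x$. * $\texttt{next-child-from}(j,k)$: if $k\ge n$ return $n+1$. Let $q=\mathrm{succ}(\texttt{child}(j),k)$.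 If $\mathit{front}(j)\neq\mathsf{nil}$ and $q\le\mathit{front}(j)$ return $q$; otherwise return $\texttt{next-child}(j)$. * $\texttt{next-child-tp}(j,k,\tau)$: starting from $x=k$, repeat $x\leftarrow\texttt{next-child-from}(j,x)$ until $x=n+1$ or $\mathit{type}(x)=\tau$, and return $x$. * $\texttt{BA-parent}(j)$: let $(i,f)=\texttt{parent}(j)$. Return $i$ if $f=\mathtt{dir}$, and $\texttt{BA-parent}(i)$ otherwise. * $\texttt{BA-next-neighbor}(j)$: at the first query for $j$ (recorded by setting $\mathit{first\_query}(j)$ to false), insert $n+1$ and $\texttt{next-child-tp}(j,j,\mathtt{dir})$ into $\mathit{heap}_j$ and return $\texttt{BA-parent}(j)$. At a later query extract the minimum $r$ of $\mathit{heap}_j$. If $r=n+1$, insert $n+1$ again and return $n+1$. Otherwise insert into $\mathit{heap}_j$ the node $\texttt{next-child-tp}(j,r,\mathtt{dir})$ if $\mathit{type}(r)=\mathtt{dir}$, and the node $\texttt{next-child-tp}(u(r),r,\mathtt{rec})$ if $\mathit{type}(r)=\mathtt{rec}$; in both cases insert also $\texttt{next-child-tp}(r,r,\mathtt{rec})$;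 return $r$. **Cost model.** All arrays are balanced (size-balanced) search trees that store only the non-$\mathsf{nil}$ entries; an access, insertion, deletion, successor query or rank query costs the number of levels of the tree plus one. $\varphi(a)$ is computed by two rank queries, in the search tree of the nodes $i$ with $\mathit{front}(i)\ne\mathsf{nil}$ and in one of the multiset of the values $\mathit{front}(i)$. $K$ is stored in a search tree; $|[a,b)\setminus K|$ is computed by two rank queries, and the vertex of rank $h$ in the complement of $K$ is found by descending the tree with one rank query per level. The heaps are leftist heaps, an operation being charged the number of steps of the merge it performs. A uniform integer in $\{0,\dots,m-1\}$ is drawn in one unit of time with $\lceil\log_2 m\rceil$ random bits. An arithmetic operation or comparison takes constant time, every binary search step being counted and the computation of $D$ costing $t$ units. Every procedure call and every round of a loop costs at least one unit. -/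

import Mathlib

/-! ## Balanced search trees: levels, order statistics, successor

All arrays and search trees are size-balanced search trees `Std.TreeMap` / `Std.TreeSet` with keys
in `ℕ`.  An operation that follows a root-to-leaf path of a tree is charged one step per level. -/

/-- The number of levels of a search tree. -/
def treeDepth {β : ℕ → Type} : Std.DTreeMap.Internal.Impl ℕ β → ℕ
  | .leaf => 0
  | .inner _ _ _ l r => max (treeDepth l) (treeDepth r) + 1

/-- The number of keys smaller than `k`, computed from the subtree sizes stored in the nodes. -/
def treeRank {β : ℕ → Type} (k : ℕ) : Std.DTreeMap.Internal.Impl ℕ β → ℕ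
  | .leaf => 0
  | .inner _ x _ l r => if k ≤ x then treeRank k l else l.size + 1 + treeRank k r

/-- The least key larger than `k`, or `d` if there is none. -/
def treeSucc {β : ℕ → Type} (k : ℕ) : Std.DTreeMap.Internal.Impl ℕ β → ℕ → ℕ
  | .leaf, d => d
  | .inner _ x _ l r, d => if k < x then treeSucc k l x else treeSucc k r d

/-- The number of keys `x` of the subtree for which at most `s` elements of `{1, …, x - 1}` are not
keys of the whole tree `T`; one rank query in `T` is made at each node of a root-to-leaf path. -/
def treeSelectAux {β : ℕ → Type} (T : Std.DTreeMap.Internal.Impl ℕ β) (s : ℕ) :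
    Std.DTreeMap.Internal.Impl ℕ β → ℕ
  | .leaf => 0
  | .inner _ x _ l r =>
      if (x - 1) - treeRank x T ≤ s then l.size + 1 + treeSelectAux T s r
      else treeSelectAux T s l

/-- The element of rank `s` (counted from `0`) among the positive integers that are not keys. -/
def treeSelectCompl {β : ℕ → Type} (T : Std.DTreeMap.Internal.Impl ℕ β) (s : ℕ) : ℕ :=
  s + 1 + treeSelectAux T s T

/-- The cost of one operation (search, insertion, deletion, rank, successor) on an array. -/
def mapCost {α : Type} (t : Std.TreeMap ℕ α) : ℕ := treeDepth t.inner.inner + 1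

/-- The cost of one operation on a search tree. -/
def setCost (t : Std.TreeSet ℕ) : ℕ := treeDepth t.inner.inner.inner + 1

/-! ## Heaps -/

/-- Leftist heaps of natural numbers; the first entry of a node is its rank. -/
inductive LHeap where
  | nil
  | node (rk : ℕ) (x : ℕ) (l r : LHeap)

namespace LHeap

def rank : LHeap → ℕ
  | nil => 0
  | node rk _ _ _ => rk

/-- The number of stored items. -/
def size : LHeap → ℕ
  | nil => 0
  | node _ _ l r => l.size + r.size + 1

/-- A node with item `x` and the two given subheaps, the one of larger rank to the left. -/
def mk (x : ℕ) (a b : LHeap) : LHeap :=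
  if b.rank ≤ a.rank then node (b.rank + 1) x a b else node (a.rank + 1) x b a

/-- The union of two heaps, with the number of steps of the computation. -/
def merge : LHeap → LHeap → LHeap × ℕ
  | nil, h => (h, 1)
  | node rk x l r, nil => (node rk x l r, 1)
  | node rk x l r, node rk' x' l' r' =>
      if x ≤ x' then
        let p := merge r (node rk' x' l' r')
        (mk x l p.1, p.2 + 1)
      else
        let p := merge (node rk x l r) r'
        (mk x' l' p.1, p.2 + 1)
termination_by h₁ h₂ => h₁.size + h₂.size
decreasing_by
  all_goals simp only [size]; omega

end LHeap

/-! ## The state of the generator -/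

/-- The flag of a pointer: direct or recursive. -/
inductive PtrFlag where
  | dir
  | recur
deriving DecidableEq

/-- The persistent state of the on-the-fly generator; `nil` entries of arrays are not stored. -/
structure GenState where
  /-- `u[j]` is the parent of `j` in the pointers tree. -/
  u : Std.TreeMap ℕ ℕ
  /-- `type[j]` is the flag of the pointer from `j` to `u[j]`. -/
  type : Std.TreeMap ℕ PtrFlag
  /-- `front[j]` is the largest node returned so far as a child of `j`.  Being a search tree with
  key set `{i | front i ≠ nil}`, it also serves as order statistics tree of that set. -/
  front : Std.TreeMap ℕ ℕ
  /-- `frontInv[x]`, for `x ≤ n`, is the node `j` with `front[j] = x`. -/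
  frontInv : Std.TreeMap ℕ ℕ
  /-- `child[j]` holds `n + 1` and the known children of `j`; created when first used. -/
  child : Std.TreeMap ℕ (Std.TreeSet ℕ)
  /-- The multiset `{front i | front i ≠ nil}`; the occurrence of `f = front i` that comes from `i`
  is stored as the key `f * (n + 2) + i`. -/
  right : Std.TreeSet ℕ
  /-- The set `{i | front i ≠ nil, frontInv i = nil}`. -/
  K : Std.TreeSet ℕ
  /-- The heaps of the nodes. -/
  heap : Std.TreeMap ℕ LHeap
  /-- The nodes `j` with `first_query(j) = false`. -/
  queried : Std.TreeSet ℕ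

/-- The constant initial state: only the self-loop of node `1` is known. -/
def GenState.init : GenState where
  u := (∅ : Std.TreeMap ℕ ℕ).insert 1 1
  type := (∅ : Std.TreeMap ℕ PtrFlag).insert 1 PtrFlag.dir
  front := ∅
  frontInv := ∅
  child := ∅
  right := ∅
  K := ∅
  heap := ∅
  queried := ∅

/-- The space used: the number of keys and items stored in all arrays, search trees and heaps. -/
def GenState.space (n : ℕ) (s : GenState) : ℕ :=
  s.u.size + s.type.size + s.front.size + s.frontInv.size
    + s.child.size + ∑ j ∈ Finset.Icc 1 n, (s.child[j]?.elim 0 fun t => t.size)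
    + s.right.size + s.K.size
    + s.heap.size + ∑ j ∈ Finset.Icc 1 n, (s.heap[j]?.elim 0 fun h => h.size)
    + s.queried.size

/-! ## Randomized programs with counters for time and random bits -/

/-- The state of a computation. -/
structure Mach where
  gen : GenState
  time : ℕ
  bits : ℕ

/-- Randomized programs that act on the state and on the two counters. -/
abbrev Prog (α : Type) : Type := StateT Mach PMF α

noncomputable section

/-- Spend `k` units of time. -/
def charge (k : ℕ) : Prog Unit := modify fun m => { m with time := m.time + k }

/-- The current state of the generator. -/
def getGen : Prog GenState := do return (← get).gen

/-- Change the state of the generator. -/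
def updGen (f : GenState → GenState) : Prog Unit := modify fun m => { m with gen := f m.gen }

/-- A uniformly distributed element of `{0, …, m - 1}`, for `m ≥ 1`, drawn with `⌈log₂ m⌉` random
bits in one unit of time. -/
def draw (m : ℕ) : Prog ℕ := fun μ =>
  (PMF.uniformOfFintype (Fin (m - 1 + 1))).map fun i =>
    ((i : ℕ), { μ with time := μ.time + 1, bits := μ.bits + Nat.clog 2 m })

/-- Read the entry with index `k` of an array. -/
def readArr {α : Type} (arr : GenState → Std.TreeMap ℕ α) (k : ℕ) : Prog (Option α) := do
  let t := arr (← getGen)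
  charge (mapCost t)
  return t[k]?

/-- Is `k` stored in a search tree? -/
def readSet (set : GenState → Std.TreeSet ℕ) (k : ℕ) : Prog Bool := do
  let t := set (← getGen)
  charge (setCost t)
  return t.contains k

def writeU (j p : ℕ) : Prog Unit := do
  charge (mapCost (← getGen).u)
  updGen fun s => { s with u := s.u.insert j p }

def writeType (j : ℕ) (f : PtrFlag) : Prog Unit := do
  charge (mapCost (← getGen).type)
  updGen fun s => { s with type := s.type.insert j f }

def writeFront (j x : ℕ) : Prog Unit := do
  charge (mapCost (← getGen).front)
  updGen fun s => { s with front := s.front.insert j x }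

def writeFrontInv (x j : ℕ) : Prog Unit := do
  charge (mapCost (← getGen).frontInv)
  updGen fun s => { s with frontInv := s.frontInv.insert x j }

def eraseFrontInv (x : ℕ) : Prog Unit := do
  charge (mapCost (← getGen).frontInv)
  updGen fun s => { s with frontInv := s.frontInv.erase x }

def writeChild (j : ℕ) (t : Std.TreeSet ℕ) : Prog Unit := do
  charge (mapCost (← getGen).child)
  updGen fun s => { s with child := s.child.insert j t }

def insertRight (k : ℕ) : Prog Unit := do
  charge (setCost (← getGen).right)
  updGen fun s => { s with right := s.right.insert k }

def eraseRight (k : ℕ) : Prog Unit := do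
  charge (setCost (← getGen).right)
  updGen fun s => { s with right := s.right.erase k }

def insertK (k : ℕ) : Prog Unit := do
  charge (setCost (← getGen).K)
  updGen fun s => { s with K := s.K.insert k }

def eraseK (k : ℕ) : Prog Unit := do
  charge (setCost (← getGen).K)
  updGen fun s => { s with K := s.K.erase k }

def writeHeap (j : ℕ) (h : LHeap) : Prog Unit := do
  charge (mapCost (← getGen).heap)
  updGen fun s => { s with heap := s.heap.insert j h }

def markQueried (j : ℕ) : Prog Unit := do
  charge (setCost (← getGen).queried)
  updGen fun s => { s with queried := s.queried.insert j }

/-! ## Operations on the data structures; `n` is the number of nodes -/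

/-- The tree `child(j)`, created as `{n + 1}` if it does not exist yet. -/
def childTree (n j : ℕ) : Prog (Std.TreeSet ℕ) := do
  match ← readArr GenState.child j with
  | some t => return t
  | none =>
      let t := (∅ : Std.TreeSet ℕ).insert (n + 1)
      writeChild j t
      return t

/-- `insert(child(j), x)` -/
def childInsert (n j x : ℕ) : Prog Unit := do
  let t ← childTree n j
  charge (setCost t)
  writeChild j (t.insert x)

/-- `succ(child(j), k)`, the least element of `child(j)` larger than `k`. -/
def childSucc (n j k : ℕ) : Prog ℕ := do
  let t ← childTree n j
  charge (setCost t)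
  return treeSucc k t.inner.inner.inner (n + 1)

/-- `φ(a) = |{i < a | front i = nil or front i < a}|`: from `a - 1` one subtracts the number of
`i < a` with `front i ≥ a`, which is the number of `i` with `front i ≥ a` minus the number of
`i ≥ a` with `front i ≠ nil` (for these `front i > i ≥ a`). -/
def phi (n a : ℕ) : Prog ℕ := do
  let s ← getGen
  charge (setCost s.right + mapCost s.front)
  let fronts := s.right.size - treeRank (a * (n + 2)) s.right.inner.inner.inner
  let nodes := s.front.size - treeRank a s.front.inner.inner
  return (a - 1) - (fronts - nodes)

/-- `|[a, b) ∖ K|` -/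
def countCompl (a b : ℕ) : Prog ℕ := do
  let T := (← getGen).K
  charge (2 * setCost T)
  return (b - a) - (treeRank b T.inner.inner.inner - treeRank a T.inner.inner.inner)

/-- The vertex of rank `h` in `[a, n + 1] ∖ K`; one rank query for `a`, and then one rank query at
each level of the search. -/
def selectCompl (a h : ℕ) : Prog ℕ := do
  let T := (← getGen).K
  charge (setCost T + setCost T * setCost T)
  return treeSelectCompl T.inner.inner.inner
    ((a - 1) - treeRank a T.inner.inner.inner + h)

/-- `front(j) ← x`, with the updates of `front⁻¹`, of the tree of the values of `front` and of `K`
that this assignment requires. -/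
def setFront (n j x : ℕ) : Prog Unit := do
  let old ← readArr GenState.front j
  writeFront j x
  match old with
  | none =>
      if (← readArr GenState.frontInv j).isNone then insertK j
  | some o =>
      eraseRight (o * (n + 2) + j)
      eraseFrontInv o
      if (← readArr GenState.front o).isSome then insertK o
  insertRight (x * (n + 2) + j)
  if x ≤ n then
    writeFrontInv x j
    eraseK x

/-- `heap-insert(heap_j, x)` -/
def heapInsert (j x : ℕ) : Prog Unit := do
  let h := (← readArr GenState.heap j).getD LHeap.nil
  let p := LHeap.merge (LHeap.node 1 x LHeap.nil LHeap.nil) h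
  charge p.2
  writeHeap j p.1

/-- `heap-extract-min(heap_j)` (never called on an empty heap). -/
def heapExtractMin (n j : ℕ) : Prog ℕ := do
  match ← readArr GenState.heap j with
  | some (LHeap.node _ x l r) =>
      let p := LHeap.merge l r
      charge p.2
      writeHeap j p.1
      return x
  | _ => return n + 1

/-! ## The random choice of a rank -/

/-- `P'_y`, the probability that the chosen rank in `{0, …, t - 1}` is smaller than `y`. -/
def cumProb (ξ t y : ℕ) : ℚ :=
  if y = 0 then 0 else if y = t then 1 else 1 - ((ξ : ℚ) - 1) / ((ξ : ℚ) + ((y : ℚ) - 1))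

/-- Binary search for the largest `y ∈ [lo, hi]` with `P'_y ≤ H`, with the number of iterations.
The fuel (first numerical argument) has to be at least `hi - lo`. -/
def tossSearch (ξ t : ℕ) (H : ℚ) : ℕ → ℕ → ℕ → ℕ × ℕ
  | 0, lo, _ => (lo, 1)
  | fuel + 1, lo, hi =>
      if hi ≤ lo then (lo, 1)
      else
        let mid := (lo + hi + 1) / 2
        let p := if cumProb ξ t mid ≤ H then tossSearch ξ t H fuel mid hi
          else tossSearch ξ t H fuel lo (mid - 1)
        (p.1, p.2 + 1)

/-- A random rank in `{0, …, t - 1}` that is smaller than `y` with probability exactly `P'_y`.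
The first `⌈log₂ nᶜ⌉` random bits select a cell `[M / α, (M + 1) / α)` of `[0, 1)`, `α = nᶜ`; if
the cell lies inside one interval `[P'_y, P'_{y+1})`, then `y` is returned.  Otherwise the number is
refined to a grid on which all the `P'_y` lie, the computation of the grid size being charged with
`t` units of time. -/
def toss (n c ξ t : ℕ) : Prog ℕ := do
  let α := n ^ c
  let M ← draw α
  let p := tossSearch ξ t ((M : ℚ) / (α : ℚ)) t 0 (t - 1)
  charge p.2
  if ((M : ℚ) + 1) / (α : ℚ) ≤ cumProb ξ t (p.1 + 1) then
    return p.1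
  else
    let D := ∏ y ∈ Finset.Ico 1 t, (ξ + y - 1)
    charge t
    let M' ← draw D
    let q := tossSearch ξ t (((M * D + M' : ℕ) : ℚ) / ((α * D : ℕ) : ℚ)) t 0 (t - 1)
    charge q.2
    return q.1

/-! ## The pointers tree generator

The loops and recursions below take a bound on their number of rounds as first argument.  Since the
node they work on moves strictly monotonically within `[1, n + 1]`, the initial value `n + 1` is
never exhausted. -/

/-- A uniformly distributed flag. -/
def drawFlag : Prog PtrFlag := do
  let b ← draw 2
  return if b = 0 then PtrFlag.dir else PtrFlag.recur

/-- `parent(j)`, for `j ∈ [1, n]`. -/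
def parentQuery (n j : ℕ) : Prog (ℕ × PtrFlag) := do
  match ← readArr GenState.u j with
  | some p =>
      let f := (← readArr GenState.type j).getD PtrFlag.dir
      return (p, f)
  | none =>
      let r ← draw (j - 1)
      writeU j (r + 1)
      let f ← drawFlag
      writeType j f
      childInsert n (r + 1) j
      return (r + 1, f)

/-- Commit to `x` as the next child of `j`: `front(j) ← x`, and `next-child(x)` is called (this is
the argument `nextRec`) if `x ≤ n` and `front(x) = nil`; then `x` is returned. -/
def commitChild (n : ℕ) (nextRec : ℕ → Prog ℕ) (j x : ℕ) : Prog ℕ := do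
  setFront n j x
  if x ≤ n then
    if (← readArr GenState.front x).isNone then
      let _ ← nextRec x
  return x

/-- The loop of `next-child(j)` over the interval `[a, b]`. -/
def nextChildLoop (n c : ℕ) (nextRec : ℕ → Prog ℕ) (j b : ℕ) : ℕ → ℕ → Prog ℕ
  | 0, _ => return b
  | fuel + 1, a => do
      charge 1
      let s ← countCompl a b
      let ξ ← phi n a
      let h ← toss n c ξ (s + 1)
      if h = s then
        commitChild n nextRec j b
      else
        let x ← selectCompl a h
        if (← readArr GenState.u x).isNone then
          writeU x j
          let f ← drawFlag
          writeType x f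
          childInsert n j x
          commitChild n nextRec j x
        else
          nextChildLoop n c nextRec j b fuel (x + 1)

/-- `next-child(j)`: the least child of `j` in the pointers tree that is larger than `front(j)`. -/
def nextChild (n c : ℕ) : ℕ → ℕ → Prog ℕ
  | 0, _ => return n + 1
  | fuel + 1, j => do
      charge 1
      let _ ← parentQuery n j
      let fr ← readArr GenState.front j
      if n ≤ fr.getD 0 then
        return n + 1
      else
        let k := fr.getD j
        let b ← childSucc n j k
        nextChildLoop n c (nextChild n c fuel) j b (n + 1) (k + 1)

/-- `next-child-from(j, k)`: the least child of `j` that is larger than `k`. -/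
def nextChildFrom (n c j k : ℕ) : Prog ℕ := do
  charge 1
  if n ≤ k then
    return n + 1
  else
    let q ← childSucc n j k
    match ← readArr GenState.front j with
    | some f => if q ≤ f then return q else nextChild n c (n + 1) j
    | none => nextChild n c (n + 1) j

/-- `next-child-tp(j, k, ty)`: the least child of `j` larger than `k` with flag `ty`. -/
def nextChildTp (n c j : ℕ) (ty : PtrFlag) : ℕ → ℕ → Prog ℕ
  | 0, _ => return n + 1
  | fuel + 1, k => do
      let x ← nextChildFrom n c j k
      if x = n + 1 then
        return x
      else if (← readArr GenState.type x) = some ty then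
        return x
      else
        nextChildTp n c j ty fuel x

/-! ## The on-the-fly generator for BA-graphs -/

/-- `BA-parent(j)` -/
def baParent (n : ℕ) : ℕ → ℕ → Prog ℕ
  | 0, j => return j
  | fuel + 1, j => do
      charge 1
      let p ← parentQuery n j
      match p.2 with
      | PtrFlag.dir => return p.1
      | PtrFlag.recur => baParent n fuel p.1

/-- `BA-next-neighbor(j)`, for graphs on `n` nodes and the constant `c` of `toss`. -/
def baNextNeighbor (n c j : ℕ) : Prog ℕ := do
  charge 1
  if (← readSet GenState.queried j) = false then
    markQueried j
    heapInsert j (n + 1)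
    heapInsert j (← nextChildTp n c j PtrFlag.dir (n + 1) j)
    baParent n (n + 1) j
  else
    let r ← heapExtractMin n j
    if r = n + 1 then
      heapInsert j (n + 1)
      return n + 1
    else
      if (← readArr GenState.type r) = some PtrFlag.dir then
        heapInsert j (← nextChildTp n c j PtrFlag.dir (n + 1) r)
        heapInsert j (← nextChildTp n c r PtrFlag.recur (n + 1) r)
      else
        let p ← parentQuery n r
        heapInsert j (← nextChildTp n c p.1 PtrFlag.recur (n + 1) r)
        heapInsert j (← nextChildTp n c r PtrFlag.recur (n + 1) r)
      return r

/-! ## Sequences of queries and the cost of one call -/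

/-- The joint law of the first `t` answers (latest first) and of the state after `t` calls.  The
user `q` chooses the node of each query as a function of the answers received so far; a fixed
sequence of queries `Q` is the case `q ans = Q ans.length`. -/
def runQueries (n c : ℕ) (q : List ℕ → ℕ) : ℕ → PMF (List ℕ × GenState)
  | 0 => PMF.pure ([], GenState.init)
  | t + 1 => (runQueries n c q t).bind fun p =>
      (baNextNeighbor n c (q p.1) ⟨p.2, 0, 0⟩).map fun r => (r.1 :: p.1, r.2.gen)

/-- The resources used by one call. -/
structure CallCost where
  spaceIncrease : ℤ
  randomBits : ℕ
  time : ℕ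

/-- The law of the resources used by the call of `BA-next-neighbor` that follows the first `t`
calls. -/
def callCost (n c : ℕ) (q : List ℕ → ℕ) (t : ℕ) : PMF CallCost :=
  (runQueries n c q t).bind fun p =>
    (baNextNeighbor n c (q p.1) ⟨p.2, 0, 0⟩).map fun r =>
      { spaceIncrease := (r.2.gen.space n : ℤ) - (p.2.space n : ℤ)
        randomBits := r.2.bits
        time := r.2.time }

end

/-! ## Search trees -/

/-! The cost of a call is governed by the shape of the tree of parents. A recursion of `nextChild`
of depth D exhibits a descending path of length D, a run of I steps of `nextChildTp` exhibits I
children of one node, and I recursive steps of `baParent` exhibit an ascending path of length I. So,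
for L of order log n, either all these counts stay below L or the known part of the tree satisfies
`HasLong`. In the first case a call passes through O(L²) levels of `nextChild`. If each level needs
at most R = O(log n) rounds and no toss enters its second stage, a round costs O(log² n) time
(selection in the complement of K makes one rank query per tree level) and O(log n) random bits, and
a level stores O(1) new items. This gives the exponents 5, 4 and 2.

`HasLong` is controlled by a potential that is valid against an adaptive user. `edgeWeight`
majorizes the conditional probability that i becomes the parent of x. Once the parent is known, it
is an indicator. Before that it has two terms. The term 1/|`openNodes`| on open nodes is a
martingale under the trials of `next-child`: a trial of j at x succeeds with probability 1/q, and a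
failure removes j from the q open nodes, with (q-1)/q · 1/(q-1) = 1/q (`trial_pot_le`). The term
1/(x-1) pays for `parent(x)`, which draws uniformly from all smaller nodes (`sum_pot_update_le`).
Products of weights over sets of edges are then supermartingales for every procedure, whatever is
asked. Initially each weight is at most 2/(x-1). A union bound over paths and stars with L edges
bounds the probability of `HasLong` by 2n·n⁴·2^{-L} (`longPot_init_le`).

Two facts about the rounds of `next-child` are needed. First, a toss has the law of the first
success in a sequence of trials with success probabilities 1/(ξ+i) (`toss_wp_rank`). This fits the
tree because the number of open nodes grows by exactly one at every vertex outside K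
(`Consistent.card_openNodes_succ`). That in turn requires that a node which is somebody's front has
a front itself (`FrontClosed`), which is what the recursive call of `next-child` provides. Second,
the expected inverse number of open nodes is halved from round to round (`seqE_inv_le`). As this
number never exceeds n, more than R rounds have probability at most (n+1)·2^{-R}.

The dominant failure is the second stage of a toss, of probability at most n·n^{-c}
(`toss_fallback_le`). Over polylogarithmically many tosses this is polylog(n)·n^{-(c-1)}, which is
below n^{-d} for large n because d < c-1. For each of the finitely many remaining n the resources
are bounded with certainty, and the constant is enlarged accordingly.

`Spec` carries the invariant, the failure probability and the supermartingale property through the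
program simultaneously. The heap invariants only serve to keep every heap at size at most n+2, so
that heap operations cost O(log n). -/

open Std.DTreeMap.Internal in
/-- The keys of a tree. -/
def treeKeys {β : ℕ → Type} : Impl ℕ β → Finset ℕ
  | .leaf => ∅
  | .inner _ x _ l r => insert x (treeKeys l ∪ treeKeys r)

section Tree

open Std.DTreeMap.Internal

variable {β : ℕ → Type}

theorem mem_treeKeys {t : Impl ℕ β} {k : ℕ} : k ∈ treeKeys t ↔ ∃ p ∈ t.toListModel, p.1 = k := by
  induction t with
  | leaf => simp [treeKeys]
  | inner sz x v l r ihl ihr =>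
    simp only [treeKeys, Finset.mem_insert, Finset.mem_union, ihl, ihr, Impl.toListModel_inner,
      List.mem_append, List.mem_cons]
    constructor
    · rintro (rfl | ⟨p, hp, rfl⟩ | ⟨p, hp, rfl⟩)
      · exact ⟨⟨k, v⟩, by simp⟩
      · exact ⟨p, by simp [hp]⟩
      · exact ⟨p, by simp [hp]⟩
    · rintro ⟨p, (hp | rfl | hp), rfl⟩
      · exact Or.inr (Or.inl ⟨p, hp, rfl⟩)
      · simp
      · exact Or.inr (Or.inr ⟨p, hp, rfl⟩)

theorem Std.DTreeMap.Internal.Impl.Ordered.lt_of_left {sz x v} {l r : Impl ℕ β}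
    (h : (Impl.inner sz x v l r).Ordered) {y : ℕ} (hy : y ∈ treeKeys l) : y < x := by
  obtain ⟨p, hp, rfl⟩ := mem_treeKeys.1 hy
  simpa [Nat.compare_eq_lt] using h.compare_left hp

theorem Std.DTreeMap.Internal.Impl.Ordered.lt_of_right {sz x v} {l r : Impl ℕ β}
    (h : (Impl.inner sz x v l r).Ordered) {y : ℕ} (hy : y ∈ treeKeys r) : x < y := by
  obtain ⟨p, hp, rfl⟩ := mem_treeKeys.1 hy
  simpa [Nat.compare_eq_lt] using h.compare_right hp

theorem contains_iff_mem_treeKeys {t : Impl ℕ β} (h : t.Ordered) {k : ℕ} :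
    t.contains k = true ↔ k ∈ treeKeys t := by
  induction t with
  | leaf => simp [treeKeys, Impl.contains]
  | inner sz x v l r ihl ihr =>
    rw [Impl.contains]
    simp only [treeKeys, Finset.mem_insert, Finset.mem_union]
    have h1 := ihl h.left
    have h2 := ihr h.right
    have h3 : k ∈ treeKeys l → k < x := h.lt_of_left
    have h4 : k ∈ treeKeys r → x < k := h.lt_of_right
    split <;> rename_i hc
    · rw [Nat.compare_eq_lt] at hc
      rw [h1]
      constructor
      · tauto
      · rintro (h | h | h)
        · omega
        · exact h
        · have := h4 h; omega
    · rw [Nat.compare_eq_gt] at hc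
      rw [h2]
      constructor
      · tauto
      · rintro (h | h | h)
        · omega
        · have := h3 h; omega
        · exact h
    · rw [Nat.compare_eq_eq] at hc
      simp [hc]

theorem size_eq_card_treeKeys {t : Impl ℕ β} (h : t.Ordered) (hb : t.Balanced) :
    t.size = (treeKeys t).card := by
  induction t with
  | leaf => simp [treeKeys, Impl.size]
  | inner sz x v l r ihl ihr =>
    rw [treeKeys, Finset.card_insert_of_notMem, Finset.card_union_of_disjoint, Impl.size, hb.eq,
      ihl h.left hb.left, ihr h.right hb.right]
    · omega
    · rw [Finset.disjoint_left]
      intro y h1 h2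
      have := h.lt_of_left h1
      have := h.lt_of_right h2
      omega
    · rw [Finset.mem_union]
      rintro (h1 | h1)
      · exact absurd (h.lt_of_left h1) (lt_irrefl _)
      · exact absurd (h.lt_of_right h1) (lt_irrefl _)

theorem treeRank_eq {t : Impl ℕ β} (h : t.Ordered) (hb : t.Balanced) (k : ℕ) :
    treeRank k t = ((treeKeys t).filter (· < k)).card := by
  induction t with
  | leaf => simp [treeKeys, treeRank]
  | inner sz x v l r ihl ihr =>
    rw [treeRank, ihl h.left hb.left, ihr h.right hb.right, size_eq_card_treeKeys h.left hb.left]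
    have hx : x ∉ treeKeys l ∪ treeKeys r := by
      rw [Finset.mem_union]
      rintro (h1 | h1)
      · exact absurd (h.lt_of_left h1) (lt_irrefl _)
      · exact absurd (h.lt_of_right h1) (lt_irrefl _)
    have hd : Disjoint (treeKeys l) (treeKeys r) := by
      rw [Finset.disjoint_left]
      intro y h1 h2
      have := h.lt_of_left h1
      have := h.lt_of_right h2
      omega
    simp only [treeKeys, Finset.filter_insert, Finset.filter_union]
    split <;> rename_i hk
    · rw [if_neg (by omega)]
      have : (treeKeys r).filter (· < k) = ∅ := by
        ext y
        simp only [Finset.mem_filter, Finset.notMem_empty, iff_false, not_and, not_lt]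
        intro hy
        have := h.lt_of_right hy
        omega
      rw [this, Finset.union_empty]
    · rw [if_pos (by omega), Finset.card_insert_of_notMem, Finset.card_union_of_disjoint]
      · have : (treeKeys l).filter (· < k) = treeKeys l := by
          ext y
          simp only [Finset.mem_filter, and_iff_left_iff_imp]
          intro hy
          have := h.lt_of_left hy
          omega
        rw [this]
        omega
      · exact Finset.disjoint_filter_filter hd
      · simp only [Finset.mem_union, Finset.mem_filter] at hx ⊢
        tauto

/-- The least key larger than `k` is found, or else the default value. -/
theorem treeSucc_spec {t : Impl ℕ β} (h : t.Ordered) (k d : ℕ) :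
    (treeSucc k t d ∈ treeKeys t ∧ k < treeSucc k t d ∧
      ∀ y ∈ treeKeys t, k < y → treeSucc k t d ≤ y) ∨
    (treeSucc k t d = d ∧ ∀ y ∈ treeKeys t, y ≤ k) := by
  induction t generalizing d with
  | leaf => simp [treeKeys, treeSucc]
  | inner sz x v l r ihl ihr =>
    have h3 : ∀ y ∈ treeKeys l, y < x := fun y => h.lt_of_left
    have h4 : ∀ y ∈ treeKeys r, x < y := fun y => h.lt_of_right
    rw [treeSucc]
    simp only [treeKeys, Finset.mem_insert, Finset.mem_union]
    split
    · rename_i hk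
      left
      rcases ihl h.left x with ⟨h5, h6, h7⟩ | ⟨h5, h6⟩
      · refine ⟨Or.inr (Or.inl h5), h6, ?_⟩
        rintro y (rfl | hy | hy) hky
        · exact (h3 _ h5).le
        · exact h7 y hy hky
        · exact ((h3 _ h5).trans (h4 _ hy)).le
      · rw [h5]
        refine ⟨Or.inl rfl, hk, ?_⟩
        rintro y (rfl | hy | hy) hky
        · exact le_rfl
        · have := h6 y hy; omega
        · exact (h4 _ hy).le
    · rename_i hk
      rcases ihr h.right d with ⟨h5, h6, h7⟩ | ⟨h5, h6⟩
      · left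
        refine ⟨Or.inr (Or.inr h5), h6, ?_⟩
        rintro y (rfl | hy | hy) hky
        · omega
        · have := h3 y hy; omega
        · exact h7 y hy hky
      · right
        refine ⟨h5, ?_⟩
        rintro y (rfl | hy | hy)
        · omega
        · have := h3 y hy; omega
        · exact h6 y hy

/-- Size balance with ratio 3 gives each subtree a weight (size plus one) of at most 3/4 of the
weight of the whole. Since (4/3)³ > 2, three times the binary logarithm of the weight bounds the
number of levels. -/
theorem two_pow_treeDepth_le {t : Impl ℕ β} (hb : t.Balanced) :
    2 ^ treeDepth t ≤ (t.size + 1) ^ 3 := by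
  induction t with
  | leaf => simp [treeDepth, Impl.size]
  | inner sz x v l r ihl ihr =>
    have h1 := hb.eq
    have h2 := hb.at_root
    have h3 := ihl hb.left
    have h4 := ihr hb.right
    simp only [Impl.BalancedAtRoot, delta] at h2
    rw [treeDepth, Impl.size]
    have key : ∀ a d : ℕ, 2 ^ d ≤ (a + 1) ^ 3 → 4 * (a + 1) ≤ 3 * (sz + 1) →
        2 ^ (d + 1) ≤ (sz + 1) ^ 3 := by
      intro a d hd ha
      have h5 : (4 * (a + 1)) ^ 3 ≤ (3 * (sz + 1)) ^ 3 := Nat.pow_le_pow_left ha 3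
      rw [mul_pow, mul_pow] at h5
      rw [pow_succ]
      omega
    rcases le_total (treeDepth l) (treeDepth r) with h | h
    · rw [max_eq_right h]
      exact key _ _ h4 (by omega)
    · rw [max_eq_left h]
      exact key _ _ h3 (by omega)

end Tree

/-- The number of elements of `{1, …, y - 1}` outside `K`. -/
def gapCount (K : Finset ℕ) (y : ℕ) : ℕ := ((Finset.Ico 1 y).filter (· ∉ K)).card

theorem gapCount_succ (K : Finset ℕ) {y : ℕ} (hy : 1 ≤ y) :
    gapCount K (y + 1) = gapCount K y + if y ∈ K then 0 else 1 := by
  rw [gapCount, gapCount, ← Finset.insert_Ico_right_eq_Ico_add_one hy, Finset.filter_insert]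
  by_cases h : y ∈ K
  · simp [h]
  · simp [h]

theorem gapCount_mono (K : Finset ℕ) : Monotone (gapCount K) := fun _ _ h =>
  Finset.card_le_card (Finset.filter_subset_filter _ (Finset.Ico_subset_Ico_right h))

theorem gapCount_add_card (K : Finset ℕ) (hK : ∀ x ∈ K, 1 ≤ x) (y : ℕ) :
    gapCount K y + (K.filter (· < y)).card = y - 1 := by
  have h := Finset.card_filter_add_card_filter_not (s := Finset.Ico 1 y) (· ∈ K)
  have h2 : (Finset.Ico 1 y).filter (· ∈ K) = K.filter (· < y) := by
    ext x
    simp only [Finset.mem_filter, Finset.mem_Ico]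
    constructor
    · tauto
    · intro h; exact ⟨⟨hK x h.1, h.2⟩, h.1⟩
  rw [h2, Nat.card_Ico] at h
  unfold gapCount
  omega

theorem gapCount_eq_sub (K : Finset ℕ) (hK : ∀ x ∈ K, 1 ≤ x) (y : ℕ) :
    gapCount K y = (y - 1) - (K.filter (· < y)).card := by
  have := gapCount_add_card K hK y
  omega

/-- There is an element outside `K` of every given rank. -/
theorem exists_gapCount_eq (K : Finset ℕ) (hK : ∀ x ∈ K, 1 ≤ x) (s : ℕ) :
    ∃ v, 1 ≤ v ∧ v ∉ K ∧ gapCount K v = s := by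
  have hex : ∃ v, s < gapCount K (v + 1) := by
    refine ⟨s + K.card + 1, ?_⟩
    have h1 := gapCount_add_card K hK (s + K.card + 1 + 1)
    have h2 : (K.filter (· < s + K.card + 1 + 1)).card ≤ K.card := Finset.card_filter_le _ _
    omega
  classical
  -- The count passes `s` for the first time between `v` and `v + 1`, so it jumps at `v`. Hence `v`
  -- lies outside `K` and has rank `s`.
  obtain ⟨v, hv, hmin⟩ : ∃ v, s < gapCount K (v + 1) ∧ ∀ w < v, ¬ s < gapCount K (w + 1) :=
    ⟨Nat.find hex, Nat.find_spec hex, fun w hw => Nat.find_min hex hw⟩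
  have hv1 : 1 ≤ v := by
    rcases Nat.eq_zero_or_pos v with rfl | h
    · simp [gapCount] at hv
    · exact h
  have h2 := hmin (v - 1) (by omega)
  rw [Nat.sub_add_cancel hv1] at h2
  have h3 := gapCount_succ K hv1
  refine ⟨v, hv1, ?_, ?_⟩
  · intro hvK
    rw [if_pos hvK] at h3
    omega
  · split at h3 <;> omega

open Std.DTreeMap.Internal in
theorem treeSelectAux_eq {β : ℕ → Type} {T : Impl ℕ β} (hT : T.Ordered) (hTb : T.Balanced)
    (hK : ∀ x ∈ treeKeys T, 1 ≤ x) (s : ℕ) {t : Impl ℕ β} (h : t.Ordered) (hb : t.Balanced) :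
    treeSelectAux T s t = ((treeKeys t).filter (fun x => gapCount (treeKeys T) x ≤ s)).card := by
  induction t with
  | leaf => simp [treeKeys, treeSelectAux]
  | inner sz x v l r ihl ihr =>
    rw [treeSelectAux, treeRank_eq hT hTb, ← gapCount_eq_sub _ hK, ihl h.left hb.left,
      ihr h.right hb.right, size_eq_card_treeKeys h.left hb.left]
    have hx : x ∉ treeKeys l ∪ treeKeys r := by
      rw [Finset.mem_union]
      rintro (h1 | h1)
      · exact absurd (h.lt_of_left h1) (lt_irrefl _)
      · exact absurd (h.lt_of_right h1) (lt_irrefl _)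
    have hd : Disjoint (treeKeys l) (treeKeys r) := by
      rw [Finset.disjoint_left]
      intro y h1 h2
      have := h.lt_of_left h1
      have := h.lt_of_right h2
      omega
    simp only [treeKeys, Finset.filter_insert, Finset.filter_union]
    split <;> rename_i hk
    · rw [Finset.card_insert_of_notMem, Finset.card_union_of_disjoint]
      · have : (treeKeys l).filter (fun x => gapCount (treeKeys T) x ≤ s) = treeKeys l := by
          ext y
          simp only [Finset.mem_filter, and_iff_left_iff_imp]
          intro hy
          exact (gapCount_mono _ (h.lt_of_left hy).le).trans hk
        rw [this]
        omega
      · exact Finset.disjoint_filter_filter hd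
      · simp only [Finset.mem_union, Finset.mem_filter] at hx ⊢
        tauto
    · have : (treeKeys r).filter (fun x => gapCount (treeKeys T) x ≤ s) = ∅ := by
        ext y
        simp only [Finset.mem_filter, Finset.notMem_empty, iff_false, not_and, not_le]
        intro hy
        exact (not_le.1 hk).trans_le (gapCount_mono _ (h.lt_of_right hy).le)
      rw [this, Finset.union_empty]

-- If `v` is the vertex of rank `s` outside the key set, a key has at most `s` gaps before it
-- exactly when it is smaller than `v`. The search therefore counts the keys below `v`, and `v` is
-- this number plus `s + 1`.
open Std.DTreeMap.Internal in
theorem treeSelectCompl_spec {β : ℕ → Type} {T : Impl ℕ β} (hT : T.Ordered) (hTb : T.Balanced)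
    (hK : ∀ x ∈ treeKeys T, 1 ≤ x) (s : ℕ) :
    1 ≤ treeSelectCompl T s ∧ treeSelectCompl T s ∉ treeKeys T ∧
      gapCount (treeKeys T) (treeSelectCompl T s) = s := by
  obtain ⟨v, hv1, hvK, hv⟩ := exists_gapCount_eq _ hK s
  have h1 := gapCount_succ (treeKeys T) hv1
  rw [if_neg hvK] at h1
  have : treeSelectCompl T s = v := by
    rw [treeSelectCompl, treeSelectAux_eq hT hTb hK s hT hTb]
    have h2 : (treeKeys T).filter (fun x => gapCount (treeKeys T) x ≤ s) =
        (treeKeys T).filter (· < v) := by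
      ext x
      simp only [Finset.mem_filter, and_congr_right_iff]
      intro hx
      constructor
      · intro h
        by_contra hc
        have hne : x ≠ v := fun he => hvK (he ▸ hx)
        have := gapCount_mono (treeKeys T) (show v + 1 ≤ x by omega)
        omega
      · intro h
        rw [← hv]
        exact gapCount_mono _ h.le
    rw [h2]
    have := gapCount_add_card _ hK v
    omega
  rw [this]
  exact ⟨hv1, hvK, hv⟩

/-! ## Bridges to the library structures -/

/-- The keys of a set. -/
def setKeys (t : Std.TreeSet ℕ) : Finset ℕ := treeKeys t.inner.inner.inner

/-- The keys of an array. -/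
def mapKeys {α : Type} (t : Std.TreeMap ℕ α) : Finset ℕ := treeKeys t.inner.inner

theorem mem_mapKeys {α : Type} {t : Std.TreeMap ℕ α} {k : ℕ} : k ∈ mapKeys t ↔ (t[k]?).isSome := by
  rw [Std.TreeMap.isSome_getElem?_iff_mem, Std.TreeMap.mem_iff_contains]
  exact (contains_iff_mem_treeKeys t.inner.wf.ordered).symm

theorem mem_setKeys {t : Std.TreeSet ℕ} {k : ℕ} : k ∈ setKeys t ↔ k ∈ t := by
  rw [Std.TreeSet.mem_iff_contains]
  exact (contains_iff_mem_treeKeys t.inner.inner.wf.ordered).symm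

theorem size_eq_card_mapKeys {α : Type} (t : Std.TreeMap ℕ α) : t.size = (mapKeys t).card :=
  size_eq_card_treeKeys t.inner.wf.ordered t.inner.wf.balanced

theorem size_eq_card_setKeys (t : Std.TreeSet ℕ) : t.size = (setKeys t).card :=
  size_eq_card_treeKeys t.inner.inner.wf.ordered t.inner.inner.wf.balanced

theorem treeRank_map {α : Type} (t : Std.TreeMap ℕ α) (k : ℕ) :
    treeRank k t.inner.inner = ((mapKeys t).filter (· < k)).card :=
  treeRank_eq t.inner.wf.ordered t.inner.wf.balanced k

theorem treeRank_set (t : Std.TreeSet ℕ) (k : ℕ) :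
    treeRank k t.inner.inner.inner = ((setKeys t).filter (· < k)).card :=
  treeRank_eq t.inner.inner.wf.ordered t.inner.inner.wf.balanced k

/-- A bound on the cost of one operation on trees with keys below `N ^ 2`. -/
def opCost (N : ℕ) : ℕ := 6 * Nat.log 2 N + 10

/-- Keys up to N² are allowed because the tree `right` stores pairs of nodes encoded as one number.
The constants of `opCost` come from 3 · (2 (log N + 1) + 1) + 1. -/
theorem treeDepth_le_of_card {β : ℕ → Type} {t : Std.DTreeMap.Internal.Impl ℕ β} (h : t.Ordered)
    (hb : t.Balanced) {N : ℕ} (hN : 1 ≤ N) (hk : ∀ k ∈ treeKeys t, k < N ^ 2) :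
    treeDepth t + 1 ≤ opCost N := by
  have h1 := two_pow_treeDepth_le hb
  have h2 : t.size ≤ N ^ 2 := by
    rw [size_eq_card_treeKeys h hb]
    simpa using Finset.card_le_card (fun k hk' => Finset.mem_range.2 (hk k hk') :
      treeKeys t ⊆ Finset.range (N ^ 2))
  have h3 : N < 2 ^ (Nat.log 2 N + 1) := Nat.lt_pow_succ_log_self (by norm_num) N
  have h4 : t.size + 1 ≤ 2 ^ (2 * (Nat.log 2 N + 1) + 1) := by
    have h6 : N ^ 2 ≤ (2 ^ (Nat.log 2 N + 1)) ^ 2 := Nat.pow_le_pow_left h3.le 2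
    rw [← pow_mul] at h6
    have h7 : 1 ≤ N ^ 2 := Nat.one_le_pow _ _ hN
    rw [pow_succ, mul_comm 2 (Nat.log 2 N + 1)]
    omega
  have h5 : 2 ^ treeDepth t ≤ 2 ^ ((2 * (Nat.log 2 N + 1) + 1) * 3) := by
    rw [pow_mul]
    exact h1.trans (Nat.pow_le_pow_left h4 3)
  have h6 := (Nat.pow_le_pow_iff_right (by norm_num : 1 < 2)).1 h5
  unfold opCost
  omega

theorem mapCost_le {α : Type} {t : Std.TreeMap ℕ α} {N : ℕ} (hN : 1 ≤ N)
    (hk : ∀ k, (t[k]?).isSome → k < N ^ 2) : mapCost t ≤ opCost N :=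
  treeDepth_le_of_card t.inner.wf.ordered t.inner.wf.balanced hN fun k h => hk k (mem_mapKeys.1 h)

theorem setCost_le {t : Std.TreeSet ℕ} {N : ℕ} (hN : 1 ≤ N)
    (hk : ∀ k ∈ t, k < N ^ 2) : setCost t ≤ opCost N :=
  treeDepth_le_of_card t.inner.inner.wf.ordered t.inner.inner.wf.balanced hN
    fun k h => hk k (mem_setKeys.1 h)

theorem getElem?_insert_nat {α : Type} (t : Std.TreeMap ℕ α) (k a : ℕ) (v : α) :
    (t.insert k v)[a]? = if k = a then some v else t[a]? := by
  rw [Std.TreeMap.getElem?_insert]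
  simp

theorem getElem?_erase_nat {α : Type} (t : Std.TreeMap ℕ α) (k a : ℕ) :
    (t.erase k)[a]? = if k = a then none else t[a]? := by
  rw [Std.TreeMap.getElem?_erase]
  simp

theorem mem_insert_nat (t : Std.TreeSet ℕ) (k a : ℕ) : a ∈ t.insert k ↔ k = a ∨ a ∈ t := by
  rw [Std.TreeSet.mem_insert]
  simp

theorem mem_erase_nat (t : Std.TreeSet ℕ) (k a : ℕ) : a ∈ t.erase k ↔ k ≠ a ∧ a ∈ t := by
  rw [Std.TreeSet.mem_erase]
  simp

/-! ## Leftist heaps -/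

namespace LHeap

@[simp] theorem rank_node (rk x : ℕ) (l r : LHeap) : (node rk x l r).rank = rk := rfl

/-- The multiset of stored items. -/
def items : LHeap → Multiset ℕ
  | nil => 0
  | node _ x l r => x ::ₘ (l.items + r.items)

/-- Stored ranks are right, the heap is leftist and ordered. -/
def WF : LHeap → Prop
  | nil => True
  | node rk x l r => rk = r.rank + 1 ∧ r.rank ≤ l.rank ∧ l.WF ∧ r.WF ∧
      ∀ y ∈ l.items + r.items, x ≤ y

theorem size_eq_card (h : LHeap) : h.size = h.items.card := by
  induction h with
  | nil => rfl
  | node rk x l r ihl ihr => simp [size, items, ihl, ihr]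

/-- In a leftist heap both subheaps of a node of rank k+1 have rank at least k, so sizes at least
double with the rank. -/
theorem two_pow_rank_le (h : LHeap) (hw : h.WF) : 2 ^ h.rank ≤ h.size + 1 := by
  induction h with
  | nil => simp [rank, size]
  | node rk x l r ihl ihr =>
    obtain ⟨h1, h2, h3, h4, -⟩ := hw
    have h5 := ihl h3
    have h6 := ihr h4
    have h7 : 2 ^ r.rank ≤ 2 ^ l.rank := Nat.pow_le_pow_right (by norm_num) h2
    simp only [rank_node, size, h1, pow_succ]
    omega

theorem items_mk (x : ℕ) (a b : LHeap) : (mk x a b).items = x ::ₘ (a.items + b.items) := by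
  unfold mk
  split
  · rfl
  · simp [items, add_comm]

theorem wf_mk {x : ℕ} {a b : LHeap} (ha : a.WF) (hb : b.WF) (hx : ∀ y ∈ a.items + b.items, x ≤ y) :
    (mk x a b).WF := by
  unfold mk
  split
  · exact ⟨rfl, by assumption, ha, hb, hx⟩
  · exact ⟨rfl, by omega, hb, ha, by rwa [add_comm]⟩

theorem items_merge (a b : LHeap) : (merge a b).1.items = a.items + b.items := by
  fun_induction merge a b with
  | case1 h => simp [items]
  | case2 => simp [items]
  | case3 rk x l r rk' x' l' r' h p ih =>
    simp only [p, items_mk, ih, items]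
    simp only [Multiset.cons_add, add_assoc]
  | case4 rk x l r rk' x' l' r' h p ih =>
    simp only [p, items_mk, ih, items]
    rw [Multiset.add_cons]
    congr 1
    rw [← add_assoc, ← add_assoc, add_comm l'.items]

theorem wf_merge (a b : LHeap) (ha : a.WF) (hb : b.WF) : (merge a b).1.WF := by
  fun_induction merge a b with
  | case1 h => exact hb
  | case2 => exact ha
  | case3 rk x l r rk' x' l' r' h p ih =>
    obtain ⟨h1, h2, h3, h4, h5⟩ := ha
    refine wf_mk h3 (ih h4 hb) ?_
    rw [items_merge]
    intro y hy
    obtain ⟨-, -, -, -, h6⟩ := hb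
    simp only [Multiset.mem_add, items, Multiset.mem_cons] at hy h5 h6
    rcases hy with hy | hy | hy | hy
    · exact h5 y (Or.inl hy)
    · exact h5 y (Or.inr hy)
    · omega
    · exact h.trans (h6 y hy)
  | case4 rk x l r rk' x' l' r' h p ih =>
    obtain ⟨h1, h2, h3, h4, h5⟩ := hb
    refine wf_mk h3 (ih ha h4) ?_
    rw [items_merge]
    intro y hy
    obtain ⟨-, -, -, -, h6⟩ := ha
    simp only [Multiset.mem_add, items, Multiset.mem_cons] at hy h5 h6
    rcases hy with hy | (hy | hy) | hy
    · exact h5 y (Or.inl hy)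
    · omega
    · have := h6 y hy; omega
    · exact h5 y (Or.inr hy)

/-- Every step of a merge descends one node on the right spine of one of the heaps, and the rank is
the length of that spine. -/
theorem merge_cost_le (a b : LHeap) (ha : a.WF) (hb : b.WF) :
    (merge a b).2 ≤ a.rank + b.rank + 1 := by
  fun_induction merge a b with
  | case1 h => simp
  | case2 => simp
  | case3 rk x l r rk' x' l' r' h p ih =>
    have := ih ha.2.2.2.1 hb
    have h1 := ha.1
    simp only [rank_node, p] at this ⊢
    omega
  | case4 rk x l r rk' x' l' r' h p ih =>
    have := ih ha hb.2.2.2.1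
    have h1 := hb.1
    simp only [rank_node, p] at this ⊢
    omega

theorem rank_le_of_size {h : LHeap} (hw : h.WF) {N : ℕ} (hs : h.size ≤ N) (hN : 1 ≤ N) :
    h.rank ≤ Nat.log 2 N + 2 := by
  have h1 := h.two_pow_rank_le hw
  have h3 : N < 2 ^ (Nat.log 2 N + 1) := Nat.lt_pow_succ_log_self (by norm_num) N
  have h4 : 2 ^ h.rank ≤ 2 ^ (Nat.log 2 N + 2) := by
    rw [pow_succ 2 (Nat.log 2 N + 1)]
    omega
  exact (Nat.pow_le_pow_iff_right (by norm_num : 1 < 2)).1 h4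

end LHeap

/-! ## Expectations of randomized programs -/

open scoped ENNReal

noncomputable section

/-- The expected value of `f` at the result of `P` started at `m`. -/
def wp {α : Type} (P : Prog α) (m : Mach) (f : α × Mach → ℝ≥0∞) : ℝ≥0∞ := ∑' r, P m r * f r

/-- `Q` holds for every possible result of `P` started at `m`. -/
def Always {α : Type} (P : Prog α) (m : Mach) (Q : α → Mach → Prop) : Prop :=
  ∀ a m', P m (a, m') ≠ 0 → Q a m'

section wp

variable {α β : Type}

theorem bind_run (P : Prog α) (R : α → Prog β) (m : Mach) :
    (P >>= R) m = (P m).bind fun r => R r.1 r.2 := rfl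

theorem pmf_bind_expect {α β : Type} (p : PMF α) (k : α → PMF β) (f : β → ℝ≥0∞) :
    ∑' b, (p.bind k) b * f b = ∑' a, p a * ∑' b, k a b * f b := by
  simp_rw [PMF.bind_apply, ← ENNReal.tsum_mul_right, ← ENNReal.tsum_mul_left]
  rw [ENNReal.tsum_comm]
  simp_rw [mul_assoc]

theorem wp_bind (P : Prog α) (R : α → Prog β) (m : Mach) (f : β × Mach → ℝ≥0∞) :
    wp (P >>= R) m f = wp P m fun r => wp (R r.1) r.2 f :=
  pmf_bind_expect (P m) (fun r => R r.1 r.2) f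

theorem pmf_pure_expect {α : Type} (a : α) (f : α → ℝ≥0∞) : ∑' b, PMF.pure a b * f b = f a := by
  classical
  rw [tsum_eq_single a]
  · simp
  · intro b hb
    simp [PMF.pure_apply, hb]

theorem wp_of_run {P : Prog α} {m : Mach} {a : α} {m' : Mach} (h : P m = PMF.pure (a, m'))
    (f : α × Mach → ℝ≥0∞) : wp P m f = f (a, m') := by
  unfold wp
  rw [h, pmf_pure_expect]

theorem bind_run_of_run {P : Prog α} {m : Mach} {a : α} {m' : Mach} (h : P m = PMF.pure (a, m'))
    (R : α → Prog β) : (P >>= R) m = R a m' := by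
  rw [bind_run, h, PMF.pure_bind]

theorem wp_mono {P : Prog α} {m : Mach} {f g : α × Mach → ℝ≥0∞}
    (h : ∀ a m', P m (a, m') ≠ 0 → f (a, m') ≤ g (a, m')) : wp P m f ≤ wp P m g := by
  refine ENNReal.tsum_le_tsum fun r => ?_
  by_cases hr : P m r = 0
  · simp [hr]
  · exact mul_le_mul_right (h r.1 r.2 hr) _

theorem wp_const (P : Prog α) (m : Mach) (b : ℝ≥0∞) : wp P m (fun _ => b) = b := by
  unfold wp
  rw [ENNReal.tsum_mul_right, (P m).tsum_coe, one_mul]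

theorem wp_le_of_always {P : Prog α} {m : Mach} {f : α × Mach → ℝ≥0∞} {b : ℝ≥0∞}
    (h : ∀ a m', P m (a, m') ≠ 0 → f (a, m') ≤ b) : wp P m f ≤ b :=
  (wp_mono h).trans_eq (wp_const P m b)

theorem wp_add (P : Prog α) (m : Mach) (f g : α × Mach → ℝ≥0∞) :
    wp P m (fun r => f r + g r) = wp P m f + wp P m g := by
  simp only [wp, mul_add, ENNReal.tsum_add]

theorem Always.bind {P : Prog α} {R : α → Prog β} {m : Mach} {Q1 : α → Mach → Prop}
    {Q : β → Mach → Prop} (h1 : Always P m Q1) (h2 : ∀ a m', Q1 a m' → Always (R a) m' Q) :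
    Always (P >>= R) m Q := by
  intro b m'' h
  rw [bind_run, ← PMF.mem_support_iff, PMF.mem_support_bind_iff] at h
  obtain ⟨⟨a, m'⟩, h3, h4⟩ := h
  exact h2 a m' (h1 a m' h3) b m'' h4

theorem Always.of_run {P : Prog α} {m : Mach} {a : α} {m' : Mach} (h : P m = PMF.pure (a, m'))
    {Q : α → Mach → Prop} (hQ : Q a m') : Always P m Q := by
  intro b m'' hb
  rw [h, ← PMF.mem_support_iff, PMF.mem_support_pure_iff] at hb
  cases hb
  exact hQ

theorem Always.mono {P : Prog α} {m : Mach} {Q Q' : α → Mach → Prop} (h : Always P m Q)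
    (hQ : ∀ a m', Q a m' → Q' a m') : Always P m Q' := fun a m' h' => hQ a m' (h a m' h')

end wp

/-- The indicator of a proposition. -/
def ind (p : Prop) : ℝ≥0∞ := by classical exact if p then 1 else 0

theorem ind_le_one (p : Prop) : ind p ≤ 1 := by unfold ind; split <;> simp

theorem ind_of_true {p : Prop} (h : p) : ind p = 1 := by simp [ind, h]

theorem ind_of_false {p : Prop} (h : ¬p) : ind p = 0 := by simp [ind, h]

theorem ind_mono {p q : Prop} (h : p → q) : ind p ≤ ind q := by
  by_cases hp : p
  · rw [ind_of_true hp, ind_of_true (h hp)]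
  · simp [ind_of_false hp]

theorem ind_or_le {p q r : Prop} (h : p → q ∨ r) : ind p ≤ ind q + ind r := by
  by_cases hp : p
  · rw [ind_of_true hp]
    rcases h hp with h | h
    · rw [ind_of_true h]; exact le_self_add
    · rw [ind_of_true h]; exact le_add_self
  · simp [ind_of_false hp]

/-! ## Primitive programs -/

section run

variable (m : Mach)

theorem charge_run (k : ℕ) :
    charge k m = PMF.pure ((), { m with time := m.time + k }) := rfl

theorem getGen_run : getGen m = PMF.pure (m.gen, m) := by
  change (PMF.pure (m, m)).bind _ = _
  rw [PMF.pure_bind]; rfl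

theorem updGen_run (f : GenState → GenState) :
    updGen f m = PMF.pure ((), { m with gen := f m.gen }) := rfl

theorem pure_run {α : Type} (a : α) : (pure a : Prog α) m = PMF.pure (a, m) := rfl

theorem readArr_run {α : Type} (arr : GenState → Std.TreeMap ℕ α) (k : ℕ) :
    readArr arr k m =
      PMF.pure ((arr m.gen)[k]?, { m with time := m.time + mapCost (arr m.gen) }) := by
  unfold readArr
  rw [bind_run_of_run (getGen_run m), bind_run_of_run (charge_run _ _), pure_run]

theorem readSet_run (set : GenState → Std.TreeSet ℕ) (k : ℕ) :
    readSet set k m =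
      PMF.pure ((set m.gen).contains k, { m with time := m.time + setCost (set m.gen) }) := by
  unfold readSet
  rw [bind_run_of_run (getGen_run m), bind_run_of_run (charge_run _ _), pure_run]

theorem draw_wp (k : ℕ) (hk : 1 ≤ k) (f : ℕ × Mach → ℝ≥0∞) :
    wp (draw k) m f = (k : ℝ≥0∞)⁻¹ * ∑ i ∈ Finset.range k,
      f (i, { m with time := m.time + 1, bits := m.bits + Nat.clog 2 k }) := by
  obtain ⟨k, rfl⟩ : ∃ j, k = j + 1 := ⟨k - 1, by omega⟩
  unfold wp draw
  rw [← PMF.bind_pure_comp, pmf_bind_expect]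
  simp only [Function.comp, pmf_pure_expect]
  erw [pmf_bind_expect]
  rw [tsum_fintype, Finset.sum_range, Finset.mul_sum]
  refine Finset.sum_congr rfl fun i _ => ?_
  erw [pmf_pure_expect]
  rw [PMF.uniformOfFintype_apply, Fintype.card_fin]
  rfl

theorem draw_always (k : ℕ) (hk : 1 ≤ k) : Always (draw k) m fun i m' =>
    i < k ∧ m' = { m with time := m.time + 1, bits := m.bits + Nat.clog 2 k } := by
  obtain ⟨k, rfl⟩ : ∃ j, k = j + 1 := ⟨k - 1, by omega⟩
  intro i m' h
  rw [← PMF.mem_support_iff] at h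
  unfold draw at h
  rw [PMF.mem_support_map_iff] at h
  obtain ⟨a, ha, h⟩ := h
  erw [PMF.mem_support_bind_iff] at ha
  obtain ⟨b, -, hb⟩ := ha
  erw [PMF.mem_support_pure_iff] at hb
  cases h
  subst hb
  exact ⟨b.2, rfl⟩

theorem writeU_run (j p : ℕ) : writeU j p m =
    PMF.pure ((), { m with time := m.time + mapCost m.gen.u,
                           gen := { m.gen with u := m.gen.u.insert j p } }) := by
  unfold writeU
  rw [bind_run_of_run (getGen_run m), bind_run_of_run (charge_run _ _), updGen_run]

theorem writeType_run (j : ℕ) (f : PtrFlag) : writeType j f m =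
    PMF.pure ((), { m with time := m.time + mapCost m.gen.type,
                           gen := { m.gen with type := m.gen.type.insert j f } }) := by
  unfold writeType
  rw [bind_run_of_run (getGen_run m), bind_run_of_run (charge_run _ _), updGen_run]

theorem writeFront_run (j x : ℕ) : writeFront j x m =
    PMF.pure ((), { m with time := m.time + mapCost m.gen.front,
                           gen := { m.gen with front := m.gen.front.insert j x } }) := by
  unfold writeFront
  rw [bind_run_of_run (getGen_run m), bind_run_of_run (charge_run _ _), updGen_run]

theorem writeFrontInv_run (x j : ℕ) : writeFrontInv x j m =
    PMF.pure ((), { m with time := m.time + mapCost m.gen.frontInv,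
                           gen := { m.gen with frontInv := m.gen.frontInv.insert x j } }) := by
  unfold writeFrontInv
  rw [bind_run_of_run (getGen_run m), bind_run_of_run (charge_run _ _), updGen_run]

theorem eraseFrontInv_run (x : ℕ) : eraseFrontInv x m =
    PMF.pure ((), { m with time := m.time + mapCost m.gen.frontInv,
                           gen := { m.gen with frontInv := m.gen.frontInv.erase x } }) := by
  unfold eraseFrontInv
  rw [bind_run_of_run (getGen_run m), bind_run_of_run (charge_run _ _), updGen_run]

theorem writeChild_run (j : ℕ) (t : Std.TreeSet ℕ) : writeChild j t m =
    PMF.pure ((), { m with time := m.time + mapCost m.gen.child,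
                           gen := { m.gen with child := m.gen.child.insert j t } }) := by
  unfold writeChild
  rw [bind_run_of_run (getGen_run m), bind_run_of_run (charge_run _ _), updGen_run]

theorem insertRight_run (k : ℕ) : insertRight k m =
    PMF.pure ((), { m with time := m.time + setCost m.gen.right,
                           gen := { m.gen with right := m.gen.right.insert k } }) := by
  unfold insertRight
  rw [bind_run_of_run (getGen_run m), bind_run_of_run (charge_run _ _), updGen_run]

theorem eraseRight_run (k : ℕ) : eraseRight k m =
    PMF.pure ((), { m with time := m.time + setCost m.gen.right,
                           gen := { m.gen with right := m.gen.right.erase k } }) := by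
  unfold eraseRight
  rw [bind_run_of_run (getGen_run m), bind_run_of_run (charge_run _ _), updGen_run]

theorem insertK_run (k : ℕ) : insertK k m =
    PMF.pure ((), { m with time := m.time + setCost m.gen.K,
                           gen := { m.gen with K := m.gen.K.insert k } }) := by
  unfold insertK
  rw [bind_run_of_run (getGen_run m), bind_run_of_run (charge_run _ _), updGen_run]

theorem eraseK_run (k : ℕ) : eraseK k m =
    PMF.pure ((), { m with time := m.time + setCost m.gen.K,
                           gen := { m.gen with K := m.gen.K.erase k } }) := by
  unfold eraseK
  rw [bind_run_of_run (getGen_run m), bind_run_of_run (charge_run _ _), updGen_run]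

theorem writeHeap_run (j : ℕ) (h : LHeap) : writeHeap j h m =
    PMF.pure ((), { m with time := m.time + mapCost m.gen.heap,
                           gen := { m.gen with heap := m.gen.heap.insert j h } }) := by
  unfold writeHeap
  rw [bind_run_of_run (getGen_run m), bind_run_of_run (charge_run _ _), updGen_run]

theorem markQueried_run (j : ℕ) : markQueried j m =
    PMF.pure ((), { m with time := m.time + setCost m.gen.queried,
                           gen := { m.gen with queried := m.gen.queried.insert j } }) := by
  unfold markQueried
  rw [bind_run_of_run (getGen_run m), bind_run_of_run (charge_run _ _), updGen_run]

end run

end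

/-! ## The law of a toss -/

open scoped ENNReal

theorem cumProb_zero (ξ t : ℕ) : cumProb ξ t 0 = 0 := by simp [cumProb]

theorem cumProb_self (ξ : ℕ) {t : ℕ} (ht : 1 ≤ t) : cumProb ξ t t = 1 := by
  rw [cumProb, if_neg (by omega), if_pos rfl]

theorem cumProb_of_lt {ξ t y : ℕ} (hy : 1 ≤ y) (hyt : y < t) :
    cumProb ξ t y = 1 - ((ξ : ℚ) - 1) / ((ξ : ℚ) + ((y : ℚ) - 1)) := by
  rw [cumProb, if_neg (by omega), if_neg (by omega)]

theorem cumProb_le_one {ξ : ℕ} (hξ : 1 ≤ ξ) (t y : ℕ) : cumProb ξ t y ≤ 1 := by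
  have hξ' : (1 : ℚ) ≤ ξ := by exact_mod_cast hξ
  unfold cumProb
  split_ifs with h1 h2
  · norm_num
  · exact le_rfl
  · have hy : (1 : ℚ) ≤ y := by exact_mod_cast (by omega : 1 ≤ y)
    have : (0 : ℚ) ≤ ((ξ : ℚ) - 1) / ((ξ : ℚ) + ((y : ℚ) - 1)) :=
      div_nonneg (by linarith) (by linarith)
    linarith

theorem cumProb_mono {ξ : ℕ} (hξ : 1 ≤ ξ) (t : ℕ) {y z : ℕ} (hyz : y ≤ z) (hz : z ≤ t) :
    cumProb ξ t y ≤ cumProb ξ t z := by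
  have hξ' : (1 : ℚ) ≤ ξ := by exact_mod_cast hξ
  rcases Nat.eq_zero_or_pos y with rfl | hy
  · rw [cumProb_zero]
    unfold cumProb
    split_ifs with h1 h2
    · exact le_rfl
    · norm_num
    · have hz1 : (1 : ℚ) ≤ z := by exact_mod_cast (by omega : 1 ≤ z)
      rw [sub_nonneg, div_le_one (by linarith)]
      linarith
  · rcases hz.eq_or_lt with rfl | hzt
    · rw [cumProb_self ξ (by omega)]
      exact cumProb_le_one hξ _ _
    · rw [cumProb_of_lt hy (by omega), cumProb_of_lt (by omega) hzt]
      have hy1 : (1 : ℚ) ≤ y := by exact_mod_cast hy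
      have hyz' : (y : ℚ) ≤ z := by exact_mod_cast hyz
      have : ((ξ : ℚ) - 1) / ((ξ : ℚ) + ((z : ℚ) - 1)) ≤ ((ξ : ℚ) - 1) / ((ξ : ℚ) + ((y : ℚ) - 1)) :=
        div_le_div_of_nonneg_left (by linarith) (by linarith) (by linarith)
      linarith

/-- The bisection is correct because the cumulative probabilities are monotone. Its invariant is
that the lower end satisfies P' ≤ H and that everything above the upper end violates it. -/
theorem tossSearch_spec {ξ t : ℕ} (hξ : 1 ≤ ξ) {H : ℚ} (fuel lo hi : ℕ) (hlh : lo ≤ hi)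
    (hht : hi ≤ t) (hf : hi - lo ≤ fuel) (h0 : cumProb ξ t lo ≤ H) :
    (tossSearch ξ t H fuel lo hi).1 ≤ hi ∧
    cumProb ξ t (tossSearch ξ t H fuel lo hi).1 ≤ H ∧
    (∀ z, (tossSearch ξ t H fuel lo hi).1 < z → z ≤ hi → H < cumProb ξ t z) ∧
    (tossSearch ξ t H fuel lo hi).2 ≤ Nat.log 2 (hi - lo) + 2 := by
  induction fuel generalizing lo hi with
  | zero =>
    have : hi = lo := by omega
    subst this
    rw [tossSearch]
    exact ⟨le_rfl, h0, fun z h1 h2 => by omega, by simp⟩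
  | succ fuel ih =>
    have hone : ∀ lo hi, lo ≤ hi → hi - lo ≤ fuel → hi - lo = 0 →
        (tossSearch ξ t H fuel lo hi).2 = 1 := by
      intro lo hi h1 h2 h3
      cases fuel with
      | zero => rw [tossSearch]
      | succ k => rw [tossSearch, if_pos (by omega)]
    -- Both halves have length at most half of the old one, so the logarithm drops by one in each
    -- iteration.
    have hlog : ∀ g, g ≤ (hi - lo) / 2 → 2 ≤ hi - lo → Nat.log 2 g + 1 ≤ Nat.log 2 (hi - lo) := by
      intro g hg h7
      have h8 := Nat.log_div_base 2 (hi - lo)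
      have h9 : Nat.log 2 g ≤ Nat.log 2 ((hi - lo) / 2) := Nat.log_mono_right hg
      have h10 : 0 < Nat.log 2 (hi - lo) := Nat.log_pos (by norm_num) h7
      omega
    by_cases h1 : hi ≤ lo
    · have : hi = lo := by omega
      subst this
      simp only [tossSearch, if_pos h1]
      exact ⟨le_rfl, h0, fun z h1 h2 => by omega, by simp⟩
    by_cases h2 : cumProb ξ t ((lo + hi + 1) / 2) ≤ H
    · simp only [tossSearch, if_neg h1, if_pos h2]
      obtain ⟨h3, h4, h5, h6⟩ := ih ((lo + hi + 1) / 2) hi (by omega) hht (by omega) h2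
      refine ⟨h3, h4, h5, ?_⟩
      rcases Nat.lt_or_ge (hi - lo) 2 with h7 | h7
      · have := hone ((lo + hi + 1) / 2) hi (by omega) (by omega) (by omega)
        omega
      · have := hlog (hi - (lo + hi + 1) / 2) (by omega) h7
        omega
    · simp only [tossSearch, if_neg h1, if_neg h2]
      obtain ⟨h3, h4, h5, h6⟩ := ih lo ((lo + hi + 1) / 2 - 1) (by omega) (by omega) (by omega) h0
      refine ⟨by omega, h4, ?_, ?_⟩
      · intro z hz hzh
        rcases Nat.lt_or_ge z ((lo + hi + 1) / 2) with h7 | h7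
        · exact h5 z hz (by omega)
        · exact (not_le.1 h2).trans_le (cumProb_mono hξ t h7 (by omega))
      · rcases Nat.lt_or_ge (hi - lo) 2 with h7 | h7
        · have := hone lo ((lo + hi + 1) / 2 - 1) (by omega) (by omega) (by omega)
          omega
        · have := hlog ((lo + hi + 1) / 2 - 1 - lo) (by omega) h7
          omega

/-- The rank at level `H`: the largest `y ≤ t - 1` with `P'_y ≤ H`. -/
def rankAt (ξ t : ℕ) (H : ℚ) : ℕ := (tossSearch ξ t H t 0 (t - 1)).1

theorem rankAt_spec {ξ t : ℕ} (hξ : 1 ≤ ξ) {H : ℚ} (hH : 0 ≤ H) :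
    rankAt ξ t H ≤ t - 1 ∧ cumProb ξ t (rankAt ξ t H) ≤ H ∧
      (∀ z, rankAt ξ t H < z → z ≤ t - 1 → H < cumProb ξ t z) ∧
      (tossSearch ξ t H t 0 (t - 1)).2 ≤ Nat.log 2 (t - 1) + 2 :=
  tossSearch_spec hξ t 0 (t - 1) (by omega) (by omega) (by omega) (by rwa [cumProb_zero])

/-- By monotonicity, H lies in only one of the intervals [P'_y, P'_{y+1}). In the proofs below the
rank is identified only through this fact. -/
theorem rankAt_unique {ξ t : ℕ} (hξ : 1 ≤ ξ) (ht : 1 ≤ t) {H : ℚ} (hH : 0 ≤ H) {y : ℕ}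
    (hy : y ≤ t - 1) (h1 : cumProb ξ t y ≤ H) (h2 : H < cumProb ξ t (y + 1)) :
    rankAt ξ t H = y := by
  obtain ⟨h3, h4, h5, -⟩ := rankAt_spec (t := t) hξ hH
  rcases lt_trichotomy (rankAt ξ t H) y with h | h | h
  · exact absurd (h5 y h hy) (not_lt.2 h1)
  · exact h
  · exact absurd (h2.trans_le (cumProb_mono hξ t h (by omega))) (not_lt.2 h4)

/-! ### The rank of a toss as the first success in a sequence of trials -/

noncomputable section

/-- The expectation of `f` at the first success of a sequence of independent trials, the trial with
index `i` having success probability `1 / (ξ + i)`; `r` trials with indices from `i` on remain, and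
the index after the last one is used if all fail. -/
def seqE (ξ : ℕ) (f : ℕ → ℝ≥0∞) : ℕ → ℕ → ℝ≥0∞
  | 0, i => f i
  | r + 1, i => ((ξ + i : ℕ) : ℝ≥0∞)⁻¹ * f i +
      ((ξ + i - 1 : ℕ) : ℝ≥0∞) * ((ξ + i : ℕ) : ℝ≥0∞)⁻¹ * seqE ξ f r (i + 1)

/-- Here `b y` = N (1 - P'_y) is the number of grid points whose rank is at least y. Among them the
fraction 1/(ξ+y) has rank exactly y, which is one step of `seqE`; the induction runs downwards from
the last rank, which receives all remaining points. -/
theorem sum_Ico_rankAt {ξ t N : ℕ} (hξ : 1 ≤ ξ) (ht : 1 ≤ t) (hN : 1 ≤ N) (b : ℕ → ℕ)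
    (hb0 : b 0 = N) (hb : ∀ y, 1 ≤ y → y < t → b y * (ξ + y - 1) = N * (ξ - 1))
    (f : ℕ → ℝ≥0∞) (r y : ℕ) (hr : r + y = t - 1) :
    ∑ U ∈ Finset.Ico (N - b y) N, f (rankAt ξ t ((U : ℚ) / (N : ℚ))) =
      (b y : ℝ≥0∞) * seqE ξ f r y := by
  have hNq : (0 : ℚ) < N := by exact_mod_cast hN
  have hξ' : (1 : ℚ) ≤ ξ := by exact_mod_cast hξ
  have hble : ∀ y, y < t → b y ≤ N := by
    intro y hy
    rcases Nat.eq_zero_or_pos y with rfl | h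
    · exact hb0.le
    · have h1 := hb y h hy
      by_contra hc
      have h2 : (N + 1) * (ξ + y - 1) ≤ b y * (ξ + y - 1) := Nat.mul_le_mul_right _ (by omega)
      have h3 : N * (ξ - 1) ≤ N * (ξ + y - 1) := Nat.mul_le_mul_left _ (by omega)
      rw [add_mul] at h2
      omega
  have hcum : ∀ y, y < t → cumProb ξ t y = ((N - b y : ℕ) : ℚ) / N := by
    intro y hy
    rw [Nat.cast_sub (hble y hy), sub_div, div_self hNq.ne']
    rcases Nat.eq_zero_or_pos y with rfl | h
    · rw [cumProb_zero, hb0, div_self hNq.ne', sub_self]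
    · rw [cumProb_of_lt h hy]
      have h1 := hb y h hy
      have hy1 : (1 : ℚ) ≤ y := by exact_mod_cast h
      have h2 : (b y : ℚ) * ((ξ : ℚ) + ((y : ℚ) - 1)) = N * ((ξ : ℚ) - 1) := by
        have : ((b y * (ξ + y - 1) : ℕ) : ℚ) = ((N * (ξ - 1) : ℕ) : ℚ) := by rw [h1]
        push_cast [Nat.cast_sub hξ, Nat.cast_sub (show 1 ≤ ξ + y by omega)] at this
        rw [← this]; ring
      congr 1
      rw [div_eq_div_iff (by linarith) hNq.ne']
      linarith
  induction r generalizing y with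
  | zero =>
    have hy : y = t - 1 := by omega
    rw [seqE, Finset.sum_congr rfl (g := fun _ => f y)]
    · rw [Finset.sum_const, Nat.card_Ico, nsmul_eq_mul]
      congr 2
      have := hble y (by omega)
      omega
    · intro U hU
      rw [Finset.mem_Ico] at hU
      congr 1
      refine rankAt_unique hξ ht (by positivity) (by omega) ?_ ?_
      · rw [hcum y (by omega)]
        have : ((N - b y : ℕ) : ℚ) ≤ U := by exact_mod_cast hU.1
        gcongr
      · rw [hy, Nat.sub_add_cancel ht, cumProb_self ξ ht, div_lt_one hNq]
        exact_mod_cast hU.2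
  | succ r ih =>
    have hyt : y + 1 < t := by omega
    have h1 := ih (y + 1) (by omega)
    -- The survival probability of trial y is (ξ+y-1)/(ξ+y). The case y = 0 is separate because `b
    -- 0` is not given by the formula for positive indices.
    have hrec : b (y + 1) * (ξ + y) = b y * (ξ + y - 1) := by
      have h2 := hb (y + 1) (by omega) hyt
      rw [show ξ + (y + 1) - 1 = ξ + y by omega] at h2
      rcases Nat.eq_zero_or_pos y with rfl | h
      · rw [h2, hb0]; simp
      · rw [h2, hb y h (by omega)]
    have hle : b (y + 1) ≤ b y := by
      by_contra hc
      have h2 : (b y + 1) * (ξ + y) ≤ b (y + 1) * (ξ + y) := Nat.mul_le_mul_right _ (by omega)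
      have h3 : b y * (ξ + y - 1) ≤ b y * (ξ + y) := Nat.mul_le_mul_left _ (by omega)
      rw [add_mul] at h2
      omega
    have hdiff : (b y - b (y + 1)) * (ξ + y) = b y := by
      rw [Nat.sub_mul, hrec]
      obtain ⟨k, hk⟩ : ∃ k, ξ + y = k + 1 := ⟨ξ + y - 1, by omega⟩
      rw [hk, Nat.add_sub_cancel, mul_add]
      omega
    have hby := hble y (by omega)
    have hby1 := hble (y + 1) hyt
    rw [← Finset.sum_Ico_consecutive _ (show N - b y ≤ N - b (y + 1) by omega)
      (show N - b (y + 1) ≤ N by omega), h1, seqE, mul_add]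
    have hne0 : ((ξ + y : ℕ) : ℝ≥0∞) ≠ 0 := by exact_mod_cast (by omega : ξ + y ≠ 0)
    have hnet : ((ξ + y : ℕ) : ℝ≥0∞) ≠ ∞ := ENNReal.natCast_ne_top _
    congr 1
    · rw [Finset.sum_congr rfl (g := fun _ => f y)]
      · rw [Finset.sum_const, Nat.card_Ico, nsmul_eq_mul, ← mul_assoc]
        congr 1
        rw [show N - b (y + 1) - (N - b y) = b y - b (y + 1) by omega]
        nth_rw 2 [← hdiff]
        rw [Nat.cast_mul, mul_assoc, ENNReal.mul_inv_cancel hne0 hnet, mul_one]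
      · intro U hU
        rw [Finset.mem_Ico] at hU
        congr 1
        refine rankAt_unique hξ ht (by positivity) (by omega) ?_ ?_
        · rw [hcum y (by omega)]
          have : ((N - b y : ℕ) : ℚ) ≤ U := by exact_mod_cast hU.1
          gcongr
        · rw [hcum (y + 1) hyt]
          have : (U : ℚ) < ((N - b (y + 1) : ℕ) : ℚ) := by exact_mod_cast hU.2
          gcongr
    · rw [← mul_assoc, ← mul_assoc]
      congr 1
      rw [← Nat.cast_mul, ← hrec, Nat.cast_mul, mul_assoc, ENNReal.mul_inv_cancel hne0 hnet,
        mul_one]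

theorem sum_range_mul_eq {M : Type*} [AddCommMonoid M] (a D : ℕ) (g : ℕ → M) :
    ∑ U ∈ Finset.range (a * D), g U =
      ∑ i ∈ Finset.range a, ∑ k ∈ Finset.range D, g (i * D + k) := by
  induction a with
  | zero => simp
  | succ a ih =>
    rw [Finset.sum_range_succ, ← ih, add_mul, one_mul, Finset.sum_range_add]

/-- The grid size of the second stage of a toss. -/
def tossGrid (ξ t : ℕ) : ℕ := ∏ y ∈ Finset.Ico 1 t, (ξ + y - 1)

theorem one_le_tossGrid {ξ : ℕ} (hξ : 1 ≤ ξ) (t : ℕ) : 1 ≤ tossGrid ξ t :=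
  Finset.one_le_prod' fun y hy => by
    rw [Finset.mem_Ico] at hy
    omega

/-- The product defining `tossGrid` contains every denominator ξ+y-1, so all the P'_y are grid
points and no rounding occurs. -/
theorem sum_rankAt_grid {ξ t : ℕ} (hξ : 1 ≤ ξ) (ht : 1 ≤ t) {α : ℕ} (hα : 1 ≤ α)
    (f : ℕ → ℝ≥0∞) :
    ∑ U ∈ Finset.range (α * tossGrid ξ t),
        f (rankAt ξ t ((U : ℚ) / ((α * tossGrid ξ t : ℕ) : ℚ))) =
      ((α * tossGrid ξ t : ℕ) : ℝ≥0∞) * seqE ξ f (t - 1) 0 := by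
  set N := α * tossGrid ξ t with hNdef
  have hN : 1 ≤ N := Nat.mul_pos hα (one_le_tossGrid hξ t)
  have h := sum_Ico_rankAt hξ ht hN
    (fun y => if y = 0 then N else N * (ξ - 1) / (ξ + y - 1)) (by simp) ?_ f (t - 1) 0 (by simp)
  · simpa using h
  · intro y hy hyt
    have hd : (ξ + y - 1) ∣ N * (ξ - 1) := by
      refine Dvd.dvd.mul_right (Dvd.dvd.mul_left ?_ α) _
      exact Finset.dvd_prod_of_mem (fun y => ξ + y - 1) (Finset.mem_Ico.2 ⟨hy, hyt⟩)
    rw [if_neg (by omega), Nat.div_mul_cancel hd]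

/-- `M` selects a cell that lies inside one of the intervals. -/
def TossGood (n c ξ t M : ℕ) : Prop :=
  ((M : ℚ) + 1) / ((n ^ c : ℕ) : ℚ) ≤ cumProb ξ t (rankAt ξ t ((M : ℚ) / ((n ^ c : ℕ) : ℚ)) + 1)

open Classical in
/-- A toss as an explicit sequence of draws. -/
theorem toss_wp (n c ξ t : ℕ) (hn : 1 ≤ n) (hξ : 1 ≤ ξ) (m : Mach) (f : ℕ × Mach → ℝ≥0∞) :
    wp (toss n c ξ t) m f = ((n ^ c : ℕ) : ℝ≥0∞)⁻¹ * ∑ M ∈ Finset.range (n ^ c),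
      let p := tossSearch ξ t ((M : ℚ) / ((n ^ c : ℕ) : ℚ)) t 0 (t - 1)
      if TossGood n c ξ t M then
        f (p.1, { m with time := m.time + 1 + p.2, bits := m.bits + Nat.clog 2 (n ^ c) })
      else ((tossGrid ξ t : ℕ) : ℝ≥0∞)⁻¹ * ∑ M' ∈ Finset.range (tossGrid ξ t),
        let q := tossSearch ξ t (((M * tossGrid ξ t + M' : ℕ) : ℚ) /
          ((n ^ c * tossGrid ξ t : ℕ) : ℚ)) t 0 (t - 1)
        f (q.1, { m with time := m.time + 1 + p.2 + t + 1 + q.2,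
                         bits := m.bits + Nat.clog 2 (n ^ c) + Nat.clog 2 (tossGrid ξ t) }) := by
  unfold toss
  rw [wp_bind, draw_wp _ _ (Nat.one_le_pow _ _ hn)]
  congr 1
  refine Finset.sum_congr rfl fun M _ => ?_
  simp only
  rw [wp_bind, wp_of_run (charge_run _ _)]
  by_cases h : TossGood n c ξ t M
  · rw [if_pos h]
    simp only [TossGood, rankAt] at h
    rw [if_pos h, wp_of_run (pure_run _ _)]
  · rw [if_neg h]
    simp only [TossGood, rankAt] at h
    rw [if_neg h, wp_bind, wp_of_run (charge_run _ _), wp_bind]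
    rw [← tossGrid, draw_wp _ _ (one_le_tossGrid hξ t)]
    congr 1
    refine Finset.sum_congr rfl fun M' _ => ?_
    simp only
    rw [wp_bind, wp_of_run (charge_run _ _), wp_of_run (pure_run _ _)]

/-- The law of the rank returned by a toss. -/
theorem toss_wp_rank (n c ξ t : ℕ) (hn : 1 ≤ n) (hξ : 1 ≤ ξ) (ht : 1 ≤ t) (m : Mach)
    (f : ℕ → ℝ≥0∞) : wp (toss n c ξ t) m (fun r => f r.1) = seqE ξ f (t - 1) 0 := by
  classical
  rw [toss_wp n c ξ t hn hξ m]
  set D := tossGrid ξ t with hD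
  have hα : 1 ≤ n ^ c := Nat.one_le_pow _ _ hn
  have hD1 : 1 ≤ D := one_le_tossGrid hξ t
  have hD0 : ((D : ℕ) : ℝ≥0∞) ≠ 0 := by exact_mod_cast (by omega : D ≠ 0)
  have hα0 : ((n ^ c : ℕ) : ℝ≥0∞) ≠ 0 := by exact_mod_cast (by omega : n ^ c ≠ 0)
  have hDq : (0 : ℚ) < (D : ℚ) := by exact_mod_cast hD1
  have hαq : (0 : ℚ) < ((n ^ c : ℕ) : ℚ) := by exact_mod_cast hα
  -- A good cell lies inside one interval, so refining it would not change the rank. A toss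
  -- therefore has the same law as if the fine grid had been used every time.
  have key : ∀ M ∈ Finset.range (n ^ c),
      (if TossGood n c ξ t M then f (rankAt ξ t ((M : ℚ) / ((n ^ c : ℕ) : ℚ)))
      else ((D : ℕ) : ℝ≥0∞)⁻¹ * ∑ M' ∈ Finset.range D,
        f (rankAt ξ t (((M * D + M' : ℕ) : ℚ) / ((n ^ c * D : ℕ) : ℚ)))) =
      ((D : ℕ) : ℝ≥0∞)⁻¹ * ∑ M' ∈ Finset.range D,
        f (rankAt ξ t (((M * D + M' : ℕ) : ℚ) / ((n ^ c * D : ℕ) : ℚ))) := by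
    intro M _
    split_ifs with h
    · rw [Finset.sum_congr rfl (g := fun _ => f (rankAt ξ t ((M : ℚ) / ((n ^ c : ℕ) : ℚ))))]
      · rw [Finset.sum_const, Finset.card_range, nsmul_eq_mul, ← mul_assoc,
          ENNReal.inv_mul_cancel hD0 (ENNReal.natCast_ne_top _), one_mul]
      · intro M' hM'
        rw [Finset.mem_range] at hM'
        obtain ⟨h1, h2, h3, -⟩ := rankAt_spec (t := t) hξ
          (H := (M : ℚ) / ((n ^ c : ℕ) : ℚ)) (by positivity)
        congr 1
        refine rankAt_unique hξ ht (by positivity) h1 (h2.trans ?_) (lt_of_lt_of_le ?_ h)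
        · rw [div_le_div_iff₀ hαq (by positivity)]
          have h4 := mul_nonneg (Nat.cast_nonneg (α := ℚ) M') hαq.le
          push_cast at h4 ⊢
          linarith
        · rw [div_lt_div_iff₀ (by positivity) hαq]
          have h4 : (M' : ℚ) < D := by exact_mod_cast hM'
          have h5 := mul_lt_mul_of_pos_left h4 hαq
          push_cast at h5 ⊢
          linarith
    · rfl
  have h2 := Finset.sum_congr rfl key
  simp only [rankAt] at h2
  rw [h2, ← Finset.mul_sum, ← sum_range_mul_eq (n ^ c) D
    (fun U => f (tossSearch ξ t ((U : ℚ) / ((n ^ c * D : ℕ) : ℚ)) t 0 (t - 1)).1)]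
  have h3 := sum_rankAt_grid hξ ht hα f
  simp only [rankAt] at h3
  rw [h3, ← mul_assoc, ← mul_assoc, Nat.cast_mul, ← ENNReal.mul_inv (Or.inl hα0)
    (Or.inl (ENNReal.natCast_ne_top _)), ENNReal.inv_mul_cancel, one_mul]
  · exact mul_ne_zero hα0 hD0
  · exact ENNReal.mul_ne_top (ENNReal.natCast_ne_top _) (ENNReal.natCast_ne_top _)

/-- These are worst-case bounds, including the second stage. They are too weak for large `n`, but
they give certainty for a single `n` and record that the state is unchanged. -/
theorem toss_always (n c ξ t : ℕ) (hn : 1 ≤ n) (hξ : 1 ≤ ξ) (ht : 1 ≤ t) (m : Mach) :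
    Always (toss n c ξ t) m fun h m' => h ≤ t - 1 ∧ m'.gen = m.gen ∧
      m'.time ≤ m.time + (2 * Nat.log 2 t + 6 + t) ∧
      m'.bits ≤ m.bits + (Nat.clog 2 (n ^ c) + Nat.clog 2 (tossGrid ξ t)) := by
  have hlog : Nat.log 2 (t - 1) ≤ Nat.log 2 t := Nat.log_mono_right (by omega)
  unfold toss
  refine (draw_always m _ (Nat.one_le_pow _ _ hn)).bind ?_
  rintro M _ ⟨-, rfl⟩
  obtain ⟨h1, -, -, h2⟩ := rankAt_spec (t := t) hξ
    (H := (M : ℚ) / ((n ^ c : ℕ) : ℚ)) (by positivity)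
  intro a m' h
  rw [bind_run_of_run (charge_run _ _)] at h
  revert a m'
  change Always _ _ _
  split_ifs
  · refine Always.of_run (pure_run _ _) ⟨h1, rfl, ?_, ?_⟩ <;> dsimp only <;> omega
  · intro a m' h
    rw [bind_run_of_run (charge_run _ _)] at h
    revert a m'
    change Always _ _ _
    refine (draw_always _ _ (one_le_tossGrid hξ t)).bind ?_
    rintro M' _ ⟨-, rfl⟩
    obtain ⟨h3, -, -, h4⟩ := rankAt_spec (t := t) hξ
      (H := ((M * tossGrid ξ t + M' : ℕ) : ℚ) / ((n ^ c * tossGrid ξ t : ℕ) : ℚ)) (by positivity)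
    intro a m' h
    rw [bind_run_of_run (charge_run _ _)] at h
    revert a m'
    change Always _ _ _
    refine Always.of_run (pure_run _ _) ⟨h3, rfl, ?_, ?_⟩
    · dsimp only
      have : (tossSearch ξ t (((M * tossGrid ξ t + M' : ℕ) : ℚ) /
        ((n ^ c * tossGrid ξ t : ℕ) : ℚ)) t 0 (t - 1)).2 ≤ Nat.log 2 (t - 1) + 2 := h4
      unfold tossGrid at this
      omega
    · dsimp only
      unfold tossGrid
      omega

/-- The second stage of a toss is rare. -/
theorem toss_fallback_le (n c ξ t : ℕ) (hn : 1 ≤ n) (hξ : 1 ≤ ξ) (ht : 1 ≤ t) (m : Mach) :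
    wp (toss n c ξ t) m (fun r => ind ¬(r.2.time ≤ m.time + (Nat.log 2 t + 3) ∧
      r.2.bits ≤ m.bits + Nat.clog 2 (n ^ c))) ≤ ((t - 1 : ℕ) : ℝ≥0∞) * ((n ^ c : ℕ) : ℝ≥0∞)⁻¹ := by
  classical
  have hα : 1 ≤ n ^ c := Nat.one_le_pow _ _ hn
  have hαq : (0 : ℚ) < ((n ^ c : ℕ) : ℚ) := by exact_mod_cast hα
  have hlog : Nat.log 2 (t - 1) ≤ Nat.log 2 t := Nat.log_mono_right (by omega)
  rw [toss_wp n c ξ t hn hξ m, mul_comm]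
  refine mul_le_mul_left ?_ _
  have hD0 : ((tossGrid ξ t : ℕ) : ℝ≥0∞) ≠ 0 := by
    have := one_le_tossGrid hξ t
    exact_mod_cast (by omega : tossGrid ξ t ≠ 0)
  calc _ ≤ ∑ M ∈ Finset.range (n ^ c), if ¬ TossGood n c ξ t M then (1 : ℝ≥0∞) else 0 := by
        refine Finset.sum_le_sum fun M _ => ?_
        obtain ⟨-, -, -, h2⟩ := rankAt_spec (t := t) hξ
          (H := (M : ℚ) / ((n ^ c : ℕ) : ℚ)) (by positivity)
        by_cases h : TossGood n c ξ t M
        · simp only [h, if_true, not_true, if_false]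
          rw [ind_of_false]
          rw [not_not]
          constructor
          · omega
          · exact le_rfl
        · simp only [h, if_false, not_false_iff, if_true]
          calc _ ≤ ((tossGrid ξ t : ℕ) : ℝ≥0∞)⁻¹ * ∑ M' ∈ Finset.range (tossGrid ξ t), 1 := by
                gcongr
                exact ind_le_one _
            _ = 1 := by
                simp [ENNReal.inv_mul_cancel hD0 (ENNReal.natCast_ne_top _)]
    _ = (((Finset.range (n ^ c)).filter (fun M => ¬ TossGood n c ξ t M)).card : ℝ≥0∞) := by
        rw [Finset.sum_ite]; simp
    _ ≤ ((t - 1 : ℕ) : ℝ≥0∞) := by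
        rw [Nat.cast_le]
        calc _ ≤ (Finset.range (t - 1)).card := by
              -- A bad cell contains some P'_{y+1} in its interior, where y is the rank at its left
              -- end. This excludes the last rank, since P'_t = 1 is the end of the whole interval.
              have hlt : ∀ M : ℕ, M < n ^ c → ¬ TossGood n c ξ t M →
                  rankAt ξ t ((M : ℚ) / ((n ^ c : ℕ) : ℚ)) < t - 1 := by
                intro M hM1 hM2
                obtain ⟨h1, -, h3, -⟩ := rankAt_spec (t := t) hξ
                  (H := (M : ℚ) / ((n ^ c : ℕ) : ℚ)) (by positivity)
                by_contra hc
                apply hM2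
                unfold TossGood
                rw [show rankAt ξ t ((M : ℚ) / ((n ^ c : ℕ) : ℚ)) + 1 = t by omega,
                  cumProb_self ξ ht, div_le_one hαq]
                exact_mod_cast hM1
              -- If two cells had the same rank, the later left end would still be below P'_{y+1},
              -- which lies inside the earlier cell. So bad cells have different ranks, and there
              -- are at most t-1 of them.
              have hinj : ∀ M M' : ℕ, M < n ^ c → M < M' → ¬ TossGood n c ξ t M →
                  rankAt ξ t ((M : ℚ) / ((n ^ c : ℕ) : ℚ)) ≠
                    rankAt ξ t ((M' : ℚ) / ((n ^ c : ℕ) : ℚ)) := by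
                intro M M' hMn hMM hM heq
                obtain ⟨-, -, h3, -⟩ := rankAt_spec (t := t) hξ
                  (H := (M' : ℚ) / ((n ^ c : ℕ) : ℚ)) (by positivity)
                rw [← heq] at h3
                have h5 := h3 _ (Nat.lt_succ_self _) (hlt M hMn hM)
                unfold TossGood at hM
                rw [not_le] at hM
                have h6 := h5.trans hM
                rw [div_lt_div_iff_of_pos_right hαq] at h6
                have : M' < M + 1 := by exact_mod_cast h6
                omega
              refine Finset.card_le_card_of_injOn
                (fun M => rankAt ξ t ((M : ℚ) / ((n ^ c : ℕ) : ℚ))) ?_ ?_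
              · intro M hM
                rw [Finset.mem_coe, Finset.mem_filter, Finset.mem_range] at hM
                exact Finset.mem_coe.2 (Finset.mem_range.2 (hlt M hM.1 hM.2))
              · intro M hM M' hM' heq
                rw [Finset.mem_coe, Finset.mem_filter, Finset.mem_range] at hM hM'
                rcases lt_trichotomy M M' with h | h | h
                · exact absurd heq (hinj M M' hM.1 h hM.2)
                · exact h
                · exact absurd heq.symm (hinj M' M hM'.1 h hM'.2)
          _ = t - 1 := Finset.card_range _

end

/-! ## Invariants of the state -/

open scoped ENNReal

/-- Consistency of the data structures (apart from the heaps). -/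
structure Consistent (n : ℕ) (s : GenState) : Prop where
  u_one : s.u[1]? = some 1
  u_range : ∀ j p : ℕ, s.u[j]? = some p → 1 ≤ p ∧ j ≤ n ∧ (p < j ∨ (j = 1 ∧ p = 1))
  type_one : s.type[1]? = some PtrFlag.dir
  type_range : ∀ (j : ℕ) (f : PtrFlag), s.type[j]? = some f → (s.u[j]?).isSome
  front_spec : ∀ j x : ℕ, s.front[j]? = some x →
    j < x ∧ x ≤ n + 1 ∧ (s.u[j]?).isSome ∧ (x ≤ n → s.u[x]? = some j)
  inv_spec : ∀ x j : ℕ, s.frontInv[x]? = some j ↔ s.front[j]? = some x ∧ x ≤ n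
  child_some : ∀ (j : ℕ) (t : Std.TreeSet ℕ), s.child[j]? = some t → 1 ≤ j ∧ j ≤ n ∧
    ∀ x, x ∈ t ↔ x = n + 1 ∨ (j < x ∧ s.u[x]? = some j)
  child_none : ∀ j : ℕ, s.child[j]? = none → ∀ x, j < x → s.u[x]? ≠ some j
  right_spec : ∀ k : ℕ, k ∈ s.right ↔ ∃ i f : ℕ, s.front[i]? = some f ∧ k = f * (n + 2) + i
  K_spec : ∀ i : ℕ, i ∈ s.K ↔ (s.front[i]?).isSome ∧ s.frontInv[i]? = none

/-- Every value of `front` other than `e` and `n + 1` has itself a `front` entry. -/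
def FrontClosed (s : GenState) (e : ℕ) : Prop :=
  ∀ x, (s.frontInv[x]?).isSome → (s.front[x]?).isSome ∨ x = e

/-- `s'` extends the information of `s`; heaps and query marks are unchanged. -/
structure Extends (s s' : GenState) : Prop where
  u : ∀ j p : ℕ, s.u[j]? = some p → s'.u[j]? = some p ∧ s'.type[j]? = s.type[j]?
  front : ∀ j x : ℕ, s.front[j]? = some x → ∃ x' : ℕ, s'.front[j]? = some x' ∧ x ≤ x'
  heap : s'.heap = s.heap
  queried : s'.queried = s.queried

theorem Extends.refl (s : GenState) : Extends s s :=
  ⟨fun _ _ h => ⟨h, rfl⟩, fun _ x h => ⟨x, h, le_rfl⟩, rfl, rfl⟩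

theorem Extends.trans {s s' s'' : GenState} (h : Extends s s') (h' : Extends s' s'') : Extends s s'' where
  u j p hj := by
    obtain ⟨h1, h2⟩ := h.u j p hj
    obtain ⟨h3, h4⟩ := h'.u j p h1
    exact ⟨h3, h4.trans h2⟩
  front j x hj := by
    obtain ⟨x', h1, h2⟩ := h.front j x hj
    obtain ⟨x'', h3, h4⟩ := h'.front j x' h1
    exact ⟨x'', h3, h2.trans h4⟩
  heap := h'.heap.trans h.heap
  queried := h'.queried.trans h.queried

/-- The resources used between `m` and `m'` are bounded by `T`, `B` and `S`. -/
structure Cost (n : ℕ) (m m' : Mach) (T B S : ℕ) : Prop where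
  time : m'.time ≤ m.time + T
  bits : m'.bits ≤ m.bits + B
  space : m'.gen.space n ≤ m.gen.space n + S

theorem Cost.trans {n : ℕ} {m m' m'' : Mach} {T B S T' B' S' : ℕ} (h : Cost n m m' T B S)
    (h' : Cost n m' m'' T' B' S') : Cost n m m'' (T + T') (B + B') (S + S') := by
  obtain ⟨h1, h2, h3⟩ := h
  obtain ⟨h4, h5, h6⟩ := h'
  constructor <;> omega

theorem Cost.mono {n : ℕ} {m m' : Mach} {T B S T' B' S' : ℕ} (h : Cost n m m' T B S)
    (hT : T ≤ T') (hB : B ≤ B') (hS : S ≤ S') : Cost n m m' T' B' S' := by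
  obtain ⟨h1, h2, h3⟩ := h
  constructor <;> omega

theorem Cost.refl (n : ℕ) (m : Mach) : Cost n m m 0 0 0 := ⟨le_rfl, le_rfl, le_rfl⟩

namespace Consistent

variable {n : ℕ} {s : GenState}

theorem one_le_of_u (h : Consistent n s) {j p : ℕ} (hj : s.u[j]? = some p) : 1 ≤ j := by
  have := h.u_range j p hj
  omega

theorem front_le (h : Consistent n s) {j x : ℕ} (hj : s.front[j]? = some x) : 1 ≤ j ∧ j ≤ n := by
  obtain ⟨p, hp⟩ := Option.isSome_iff_exists.1 (h.front_spec j x hj).2.2.1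
  exact ⟨h.one_le_of_u hp, (h.u_range _ _ hp).2.1⟩

theorem lt_sq {k : ℕ} (hk : k ≤ n + 1) : k < (n + 2) ^ 2 := by nlinarith

theorem cost_u (h : Consistent n s) : mapCost s.u ≤ opCost (n + 2) :=
  mapCost_le (by omega) fun k hk => by
    obtain ⟨p, hp⟩ := Option.isSome_iff_exists.1 hk
    exact lt_sq ((h.u_range _ _ hp).2.1.trans (by omega))

theorem cost_type (h : Consistent n s) : mapCost s.type ≤ opCost (n + 2) :=
  mapCost_le (by omega) fun k hk => by
    obtain ⟨f, hf⟩ := Option.isSome_iff_exists.1 hk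
    obtain ⟨p, hp⟩ := Option.isSome_iff_exists.1 (h.type_range _ _ hf)
    exact lt_sq ((h.u_range _ _ hp).2.1.trans (by omega))

theorem cost_front (h : Consistent n s) : mapCost s.front ≤ opCost (n + 2) :=
  mapCost_le (by omega) fun k hk => by
    obtain ⟨f, hf⟩ := Option.isSome_iff_exists.1 hk
    exact lt_sq ((h.front_le hf).2.trans (by omega))

theorem cost_frontInv (h : Consistent n s) : mapCost s.frontInv ≤ opCost (n + 2) :=
  mapCost_le (by omega) fun k hk => by
    obtain ⟨f, hf⟩ := Option.isSome_iff_exists.1 hk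
    exact lt_sq (((h.inv_spec _ _).1 hf).2.trans (by omega))

theorem cost_right (h : Consistent n s) : setCost s.right ≤ opCost (n + 2) :=
  setCost_le (by omega) fun k hk => by
    obtain ⟨i, f, hf, rfl⟩ := (h.right_spec k).1 hk
    have h1 := (h.front_le hf).2
    have h2 := (h.front_spec _ _ hf).2.1
    nlinarith

theorem cost_K (h : Consistent n s) : setCost s.K ≤ opCost (n + 2) :=
  setCost_le (by omega) fun k hk => by
    obtain ⟨f, hf⟩ := Option.isSome_iff_exists.1 ((h.K_spec k).1 hk).1
    exact lt_sq ((h.front_le hf).2.trans (by omega))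

theorem one_le_of_K (h : Consistent n s) {k : ℕ} (hk : k ∈ setKeys s.K) : 1 ≤ k := by
  obtain ⟨f, hf⟩ := Option.isSome_iff_exists.1 ((h.K_spec k).1 (mem_setKeys.1 hk)).1
  exact (h.front_le hf).1

end Consistent

theorem opCost_pos (N : ℕ) : 10 ≤ opCost N := by unfold opCost; omega

theorem Consistent.cost_childTree {n : ℕ} {t : Std.TreeSet ℕ} (h : ∀ x ∈ t, x ≤ n + 1) :
    setCost t ≤ opCost (n + 2) :=
  setCost_le (by omega) fun k hk => Consistent.lt_sq (h k hk)

/-! ## Space -/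

theorem sum_elim_insert {β : Type} (t : Std.TreeMap ℕ β) (w : β → ℕ) {n j : ℕ} (h1 : 1 ≤ j)
    (h2 : j ≤ n) (v : β) :
    (∑ i ∈ Finset.Icc 1 n, ((t.insert j v)[i]?.elim 0 w)) + t[j]?.elim 0 w =
      (∑ i ∈ Finset.Icc 1 n, (t[i]?.elim 0 w)) + w v := by
  have hj : j ∈ Finset.Icc 1 n := Finset.mem_Icc.2 ⟨h1, h2⟩
  rw [← Finset.add_sum_erase _ _ hj, ← Finset.add_sum_erase (Finset.Icc 1 n) (fun i => t[i]?.elim 0 w) hj]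
  have : ∑ i ∈ (Finset.Icc 1 n).erase j, ((t.insert j v)[i]?.elim 0 w) =
      ∑ i ∈ (Finset.Icc 1 n).erase j, (t[i]?.elim 0 w) := by
    refine Finset.sum_congr rfl fun i hi => ?_
    rw [getElem?_insert_nat, if_neg (Finset.ne_of_mem_erase hi).symm]
  rw [this, getElem?_insert_nat, if_pos rfl]
  simp only [Option.elim_some]
  omega

theorem space_child_insert {n j : ℕ} (s : GenState) (h1 : 1 ≤ j) (h2 : j ≤ n)
    (t : Std.TreeSet ℕ) (ht : t.size ≤ (s.child[j]?.elim 0 fun t => t.size) + 1) :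
    GenState.space n { s with child := s.child.insert j t } ≤ s.space n + 2 := by
  have h3 := sum_elim_insert s.child (fun t => t.size) h1 h2 t
  have h4 := Std.TreeMap.size_insert_le (t := s.child) (k := j) (v := t)
  unfold GenState.space
  dsimp only at h3 ⊢
  omega

theorem space_heap_insert {n j : ℕ} (s : GenState) (h1 : 1 ≤ j) (h2 : j ≤ n)
    (t : LHeap) (ht : t.size ≤ (s.heap[j]?.elim 0 fun t => t.size) + 1) :
    GenState.space n { s with heap := s.heap.insert j t } ≤ s.space n + 2 := by
  have h3 := sum_elim_insert s.heap (fun t => t.size) h1 h2 t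
  have h4 := Std.TreeMap.size_insert_le (t := s.heap) (k := j) (v := t)
  unfold GenState.space
  dsimp only at h3 ⊢
  omega

/-! ## Children trees -/

/-- The current value of `child(j)`. -/
def childOf (n : ℕ) (s : GenState) (j : ℕ) : Std.TreeSet ℕ :=
  (s.child[j]?).getD ((∅ : Std.TreeSet ℕ).insert (n + 1))

theorem childTree_run {n j : ℕ} (m : Mach) (h1 : 1 ≤ j) (h2 : j ≤ n)
    (hc : ∀ k, (m.gen.child[k]?).isSome → k ≤ n) :
    ∃ T ch, childTree n j m = PMF.pure (childOf n m.gen j,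
        { gen := { m.gen with child := ch }, time := T, bits := m.bits }) ∧
      ch[j]? = some (childOf n m.gen j) ∧
      (∀ i, i ≠ j → ch[i]? = m.gen.child[i]?) ∧
      T ≤ m.time + 2 * opCost (n + 2) ∧
      GenState.space n { m.gen with child := ch } ≤ m.gen.space n + 2 := by
  have hcost : mapCost m.gen.child ≤ opCost (n + 2) :=
    mapCost_le (by omega) fun k hk => Consistent.lt_sq ((hc k hk).trans (by omega))
  unfold childTree childOf
  rw [bind_run_of_run (readArr_run m _ _)]
  rcases hj : m.gen.child[j]? with _ | t
  · simp only [Option.getD_none]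
    rw [bind_run_of_run (writeChild_run _ _ _), pure_run]
    refine ⟨_, _, rfl, ?_, ?_, ?_, ?_⟩
    · simp
    · intro i hi
      rw [getElem?_insert_nat, if_neg (Ne.symm hi)]
    · dsimp only; omega
    · refine space_child_insert m.gen h1 h2 _ ?_
      rw [hj]
      simpa using Std.TreeSet.size_insert_le (t := (∅ : Std.TreeSet ℕ)) (k := n + 1)
  · simp only [Option.getD_some]
    rw [pure_run]
    exact ⟨_, m.gen.child, rfl, hj, fun i _ => rfl, by omega, Nat.le_add_right _ _⟩

/-- The default `{n + 1}` for a tree not yet created is correct because such a node has no known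
children. -/
theorem Consistent.mem_childOf {n : ℕ} {s : GenState} (h : Consistent n s) {j : ℕ} (x : ℕ) :
    x ∈ childOf n s j ↔ x = n + 1 ∨ (j < x ∧ s.u[x]? = some j) := by
  unfold childOf
  rcases hj : s.child[j]? with _ | t
  · rw [Option.getD_none, mem_insert_nat]
    have h1 := h.child_none j hj x
    simp only [Std.TreeSet.not_mem_emptyc, or_false]
    constructor
    · intro h; exact Or.inl h.symm
    · rintro (h | ⟨h2, h3⟩)
      · exact h.symm
      · exact absurd h3 (h1 h2)
  · exact (h.child_some j t hj).2.2 x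

theorem Consistent.of_child {n : ℕ} {s : GenState} (h : Consistent n s) {j : ℕ} (h1 : 1 ≤ j)
    (h2 : j ≤ n) {ch : Std.TreeMap ℕ (Std.TreeSet ℕ)} (hj : ch[j]? = some (childOf n s j))
    (hi : ∀ i, i ≠ j → ch[i]? = s.child[i]?) : Consistent n { s with child := ch } := by
  refine ⟨h.u_one, h.u_range, h.type_one, h.type_range, h.front_spec, h.inv_spec, ?_, ?_,
    h.right_spec, h.K_spec⟩
  · intro i t ht
    dsimp only at ht ⊢
    by_cases hij : i = j
    · subst hij
      rw [hj] at ht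
      cases ht
      exact ⟨h1, h2, h.mem_childOf⟩
    · rw [hi i hij] at ht
      exact h.child_some i t ht
  · intro i ht
    dsimp only at ht ⊢
    by_cases hij : i = j
    · subst hij
      rw [hj] at ht
      cases ht
    · rw [hi i hij] at ht
      exact h.child_none i ht

theorem Consistent.child_le {n : ℕ} {s : GenState} (h : Consistent n s) (k : ℕ) (hk : (s.child[k]?).isSome) :
    k ≤ n := by
  obtain ⟨t, ht⟩ := Option.isSome_iff_exists.1 hk
  exact (h.child_some k t ht).2.1

theorem childSucc_run {n j k : ℕ} {m : Mach} (h : Consistent n m.gen) (h1 : 1 ≤ j) (h2 : j ≤ n)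
    (hk : k ≤ n) :
    ∃ b T ch, childSucc n j k m =
        PMF.pure (b, { gen := { m.gen with child := ch }, time := T, bits := m.bits }) ∧
      Consistent n { m.gen with child := ch } ∧
      k < b ∧ b ≤ n + 1 ∧ (b ≤ n → m.gen.u[b]? = some j) ∧
      T ≤ m.time + 3 * opCost (n + 2) ∧
      GenState.space n { m.gen with child := ch } ≤ m.gen.space n + 2 := by
  obtain ⟨T, ch, hm, hj, hi, hT, hS⟩ := childTree_run m h1 h2 h.child_le
  unfold childSucc
  rw [bind_run_of_run hm, bind_run_of_run (charge_run _ _), pure_run]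
  have hmem := h.mem_childOf (j := j)
  have hle : ∀ x ∈ childOf n m.gen j, x ≤ n + 1 := by
    intro x hx
    rcases (hmem x).1 hx with h | ⟨-, h3⟩
    · omega
    · have := h.u_range _ _ h3; omega
  have hcost := Consistent.cost_childTree hle
  refine ⟨_, _, _, rfl, h.of_child h1 h2 hj hi, ?_⟩
  have hsp := treeSucc_spec (childOf n m.gen j).inner.inner.wf.ordered k (n + 1)
  change (_ ∈ setKeys (childOf n m.gen j) ∧ _ ∧ ∀ y ∈ setKeys (childOf n m.gen j), _) ∨
    (_ ∧ ∀ y ∈ setKeys (childOf n m.gen j), _) at hsp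
  simp only [mem_setKeys] at hsp
  rcases hsp with ⟨h3, h4, -⟩ | ⟨-, h4⟩
  · refine ⟨h4, hle _ h3, ?_, ?_, hS⟩
    · intro hb
      rcases (hmem _).1 h3 with h5 | ⟨-, h5⟩
      · omega
      · exact h5
    · dsimp only
      omega
  · have := h4 (n + 1) ((hmem _).2 (Or.inl rfl))
    omega

/-! ## Fixing a parent -/

noncomputable section

/-- `x` becomes a child of `p`, with a random flag. -/
def assign (n x p : ℕ) : Prog PtrFlag := do
  writeU x p
  let f ← drawFlag
  writeType x f
  childInsert n p x
  return f

theorem drawFlag_always (m : Mach) : Always drawFlag m fun _ m' =>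
    m' = { m with time := m.time + 1, bits := m.bits + 1 } := by
  unfold drawFlag
  refine (draw_always m 2 (by norm_num)).bind ?_
  rintro i m' ⟨-, rfl⟩
  refine Always.of_run (pure_run _ _) ?_
  have : Nat.clog 2 2 = 1 := by norm_num [Nat.clog]
  rw [this]

/-- The relation between the states before and after `assign n x p`. -/
structure Assigned (n x p : ℕ) (s : GenState) (f : PtrFlag) (s' : GenState) : Prop where
  inv : Consistent n s'
  u : s'.u = s.u.insert x p
  type : s'.type = s.type.insert x f
  front : s'.front = s.front
  frontInv : s'.frontInv = s.frontInv
  K : s'.K = s.K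
  heap : s'.heap = s.heap
  queried : s'.queried = s.queried

theorem Assigned.ext {n x p : ℕ} {s s' : GenState} {f : PtrFlag} (h : Assigned n x p s f s')
    (hx : s.u[x]? = none) : Extends s s' where
  u j q hj := by
    have : x ≠ j := by rintro rfl; rw [hx] at hj; cases hj
    rw [h.u, h.type, getElem?_insert_nat, getElem?_insert_nat, if_neg this, if_neg this]
    exact ⟨hj, rfl⟩
  front j y hj := ⟨y, by rw [h.front]; exact hj, le_rfl⟩
  heap := h.heap
  queried := h.queried

theorem assign_always {n x p : ℕ} {m : Mach} (h : Consistent n m.gen) (hx : m.gen.u[x]? = none)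
    (hxn : x ≤ n) (hp : 1 ≤ p) (hpx : p < x) :
    Always (assign n x p) m fun f m' => Assigned n x p m.gen f m'.gen ∧
      Cost n m m' (7 * opCost (n + 2)) 1 6 := by
  unfold assign
  intro f m' hr
  rw [bind_run_of_run (writeU_run _ _ _)] at hr
  revert hr
  revert f m'
  change Always _ _ _
  refine (drawFlag_always _).bind ?_
  rintro f _ rfl
  intro f' m' hr
  rw [bind_run_of_run (writeType_run _ _ _)] at hr
  dsimp only at hr
  revert hr
  revert f' m'
  change Always _ _ _
  unfold childInsert
  obtain ⟨T, ch, hm, hj, hi, hT, hS⟩ := childTree_run (n := n) (j := p)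
    { gen := { m.gen with u := m.gen.u.insert x p, type := m.gen.type.insert x f },
      time := m.time + mapCost m.gen.u + 1 + mapCost m.gen.type,
      bits := m.bits + 1 } hp (by omega) h.child_le
  have hu1 := h.cost_u
  have hu2 := h.cost_type
  have hmem := h.mem_childOf (j := p)
  have hco : childOf n { m.gen with u := m.gen.u.insert x p, type := m.gen.type.insert x f } p =
    childOf n m.gen p := rfl
  dsimp only at hm hj hi hT hS
  rw [hco] at hm hj
  have hle : ∀ x ∈ childOf n m.gen p, x ≤ n + 1 := by
    intro x hx
    rcases (hmem x).1 hx with h | ⟨-, h3⟩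
    · omega
    · have := h.u_range _ _ h3; omega
  have hcost := Consistent.cost_childTree hle
  have hcost2 : mapCost ch ≤ opCost (n + 2) := mapCost_le (by omega) fun k hk => by
    by_cases hkp : k = p
    · exact Consistent.lt_sq (by omega)
    · rw [hi k hkp] at hk
      exact Consistent.lt_sq ((h.child_le k hk).trans (by omega))
  intro f' m' hr
  rw [bind_run, bind_run, hm, PMF.pure_bind] at hr
  dsimp only at hr
  rw [bind_run_of_run (charge_run _ _), writeChild_run, PMF.pure_bind, pure_run,
    ← PMF.mem_support_iff, PMF.mem_support_pure_iff] at hr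
  cases hr
  dsimp only
  refine ⟨⟨?_, rfl, rfl, rfl, rfl, rfl, rfl, rfl⟩, ?_, ?_, ?_⟩
  · have hx1 : x ≠ 1 := by rintro rfl; rw [h.u_one] at hx; cases hx
    constructor <;> dsimp only
    · rw [getElem?_insert_nat, if_neg hx1, h.u_one]
    · intro j q hjq
      rw [getElem?_insert_nat] at hjq
      split at hjq
      · cases hjq; omega
      · exact h.u_range j q hjq
    · rw [getElem?_insert_nat, if_neg hx1, h.type_one]
    · intro j q hjq
      rw [getElem?_insert_nat] at hjq ⊢
      split
      · rfl
      · rename_i hne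
        rw [if_neg hne] at hjq
        exact h.type_range j q hjq
    · intro j y hjy
      obtain ⟨h1, h2, h3, h4⟩ := h.front_spec j y hjy
      refine ⟨h1, h2, ?_, ?_⟩
      · rw [getElem?_insert_nat]
        split
        · rfl
        · exact h3
      · intro hy
        have h5 := h4 hy
        rw [getElem?_insert_nat, if_neg, h5]
        rintro rfl
        rw [hx] at h5
        cases h5
    · exact h.inv_spec
    · intro j t ht
      rw [getElem?_insert_nat] at ht
      split at ht
      · rename_i hpj
        subst hpj
        cases ht
        refine ⟨hp, by omega, fun y => ?_⟩
        rw [mem_insert_nat, hmem, getElem?_insert_nat]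
        by_cases hxy : x = y
        · subst hxy
          simp [hpx]
        · simp [hxy]
      · rename_i hpj
        rw [hi j (Ne.symm hpj)] at ht
        obtain ⟨h1, h2, h3⟩ := h.child_some j t ht
        refine ⟨h1, h2, fun y => ?_⟩
        rw [h3, getElem?_insert_nat]
        by_cases hxy : x = y
        · subst hxy
          simp [hx, hpj]
        · simp [hxy]
    · intro j ht y hy
      rw [getElem?_insert_nat] at ht
      split at ht
      · cases ht
      · rename_i hpj
        rw [hi j (Ne.symm hpj)] at ht
        rw [getElem?_insert_nat]
        split
        · intro h; cases h; exact hpj rfl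
        · exact h.child_none j ht y hy
    · exact h.right_spec
    · exact h.K_spec
  · have := opCost_pos (n + 2)
    dsimp only
    omega
  · exact le_rfl
  · have h1 := space_child_insert (n := n)
      { m.gen with u := m.gen.u.insert x p, type := m.gen.type.insert x f, child := ch } hp
      (by omega) ((childOf n m.gen p).insert x) (by
        dsimp only
        rw [hj]
        exact Std.TreeSet.size_insert_le)
    have h2 := Std.TreeMap.size_insert_le (t := m.gen.u) (k := x) (v := p)
    have h3 := Std.TreeMap.size_insert_le (t := m.gen.type) (k := x) (v := f)
    have h4 : GenState.space n { m.gen with u := m.gen.u.insert x p, type := m.gen.type.insert x f } ≤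
        m.gen.space n + 2 := by
      unfold GenState.space
      dsimp only
      omega
    dsimp only at h1 h4 ⊢
    omega

end

open scoped ENNReal

/-! ## Potential parents -/

/-- The value of `front`, with `0` in place of `nil`. -/
def frontVal (s : GenState) (i : ℕ) : ℕ := (s.front[i]?).getD 0

/-- The nodes below `x` whose front has not reached `x`. -/
def openNodes (G : ℕ → ℕ) (x : ℕ) : Finset ℕ := (Finset.Ico 1 x).filter fun i => G i < x

theorem frontVal_eq_iff {s : GenState} {i x : ℕ} (hx : 1 ≤ x) :
    frontVal s i = x ↔ s.front[i]? = some x := by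
  unfold frontVal
  rcases s.front[i]? with _ | y
  · simp; omega
  · simp

/-- Among the nodes with front at least `a`, those that are themselves at least `a` are exactly all
nodes i ≥ a with a front, since front(i) > i. The difference of the two counts is thus the number of
nodes below `a` that are not open at `a`. -/
theorem phi_run {n a : ℕ} {m : Mach} (h : Consistent n m.gen) :
    ∃ T, phi n a m =
        PMF.pure ((openNodes (frontVal m.gen) a).card, { m with time := T }) ∧
      T ≤ m.time + 2 * opCost (n + 2) := by
  unfold phi
  rw [bind_run_of_run (getGen_run m), bind_run_of_run (charge_run _ _), pure_run]
  have hr := h.cost_right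
  have hf := h.cost_front
  refine ⟨_, ?_, show m.time + (setCost m.gen.right + mapCost m.gen.front) ≤ _ by omega⟩
  congr 2
  set F := mapKeys m.gen.front with hF
  have hmemF : ∀ i, i ∈ F ↔ (m.gen.front[i]?).isSome := fun i => mem_mapKeys
  have hval : ∀ i ∈ F, m.gen.front[i]? = some (frontVal m.gen i) := by
    intro i hi
    obtain ⟨f, hf⟩ := Option.isSome_iff_exists.1 ((hmemF i).1 hi)
    rw [hf, frontVal, hf, Option.getD_some]
  have hrange : ∀ i ∈ F, 1 ≤ i ∧ i ≤ n ∧ i < frontVal m.gen i := fun i hi =>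
    ⟨(h.front_le (hval i hi)).1, (h.front_le (hval i hi)).2, (h.front_spec _ _ (hval i hi)).1⟩
  have hkeys : setKeys m.gen.right = F.image fun i => frontVal m.gen i * (n + 2) + i := by
    ext k
    rw [mem_setKeys, h.right_spec, Finset.mem_image]
    constructor
    · rintro ⟨i, f, hi, rfl⟩
      refine ⟨i, (hmemF i).2 (by rw [hi]; rfl), ?_⟩
      rw [frontVal, hi, Option.getD_some]
    · rintro ⟨i, hi, rfl⟩
      exact ⟨i, _, hval i hi, rfl⟩
  have hinj : Set.InjOn (fun i => frontVal m.gen i * (n + 2) + i) F := by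
    intro i hi i' hi' he
    have h1 := hrange i hi
    have h2 := hrange i' hi'
    have h3 : (frontVal m.gen i * (n + 2) + i) % (n + 2) =
        (frontVal m.gen i' * (n + 2) + i') % (n + 2) := by
      dsimp only at he; rw [he]
    rwa [mul_comm, Nat.mul_add_mod, mul_comm, Nat.mul_add_mod, Nat.mod_eq_of_lt (by omega),
      Nat.mod_eq_of_lt (by omega)] at h3
  have hlt : ∀ i ∈ F, (frontVal m.gen i * (n + 2) + i < a * (n + 2) ↔ frontVal m.gen i < a) := by
    intro i hi
    have h1 := hrange i hi
    constructor
    · intro h2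
      by_contra h3
      have := Nat.mul_le_mul_right (n + 2) (not_lt.1 h3)
      omega
    · intro h2
      have := Nat.mul_le_mul_right (n + 2) (show frontVal m.gen i + 1 ≤ a from h2)
      rw [add_mul] at this
      omega
  have hR : m.gen.right.size - treeRank (a * (n + 2)) m.gen.right.inner.inner.inner =
      (F.filter fun i => a ≤ frontVal m.gen i).card := by
    rw [treeRank_set, size_eq_card_setKeys, hkeys, Finset.filter_image, Finset.card_image_of_injOn hinj,
      Finset.card_image_of_injOn (hinj.mono (Finset.coe_subset.2 (Finset.filter_subset _ _)))]
    have h1 := Finset.card_filter_add_card_filter_not (s := F) (fun i => frontVal m.gen i < a)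
    have h2 : F.filter (fun i => frontVal m.gen i * (n + 2) + i < a * (n + 2)) =
        F.filter fun i => frontVal m.gen i < a := Finset.filter_congr hlt
    rw [h2]
    simp only [not_lt] at h1
    omega
  have hN : m.gen.front.size - treeRank a m.gen.front.inner.inner =
      (F.filter fun i => a ≤ i).card := by
    rw [treeRank_map, size_eq_card_mapKeys, ← hF]
    have h1 := Finset.card_filter_add_card_filter_not (s := F) (fun i => i < a)
    simp only [not_lt] at h1
    omega
  rw [hR, hN]
  have h1 := Finset.card_filter_add_card_filter_not
    (s := F.filter fun i => a ≤ frontVal m.gen i) (fun i => a ≤ i)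
  have h2 : (F.filter fun i => a ≤ frontVal m.gen i).filter (fun i => a ≤ i) =
      F.filter fun i => a ≤ i := by
    ext i
    simp only [Finset.mem_filter]
    constructor
    · rintro ⟨⟨h1, -⟩, h2⟩; exact ⟨h1, h2⟩
    · rintro ⟨h1, h2⟩
      have := hrange i h1
      exact ⟨⟨h1, by omega⟩, h2⟩
  have h3 : (F.filter fun i => a ≤ frontVal m.gen i).filter (fun i => ¬ a ≤ i) =
      (Finset.Ico 1 a).filter fun i => ¬ frontVal m.gen i < a := by
    ext i
    simp only [Finset.mem_filter, Finset.mem_Ico, not_le, not_lt]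
    constructor
    · rintro ⟨⟨h1, h2⟩, h3⟩
      exact ⟨⟨(hrange i h1).1, h3⟩, h2⟩
    · rintro ⟨⟨h1, h2⟩, h3⟩
      refine ⟨⟨(hmemF i).2 ?_, h3⟩, h2⟩
      by_contra hc
      rw [Option.not_isSome_iff_eq_none] at hc
      simp [frontVal, hc] at h3
      omega
  have h4 := Finset.card_filter_add_card_filter_not (s := Finset.Ico 1 a)
    (fun i => frontVal m.gen i < a)
  rw [h2, h3] at h1
  rw [Nat.card_Ico] at h4
  unfold openNodes
  omega

theorem countCompl_run {n a b : ℕ} {m : Mach} (h : Consistent n m.gen) (ha : 1 ≤ a) (hab : a ≤ b) :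
    ∃ T, countCompl a b m =
        PMF.pure (gapCount (setKeys m.gen.K) b - gapCount (setKeys m.gen.K) a,
          { m with time := T }) ∧
      T ≤ m.time + 2 * opCost (n + 2) := by
  unfold countCompl
  rw [bind_run_of_run (getGen_run m), bind_run_of_run (charge_run _ _), pure_run]
  have hr := h.cost_K
  refine ⟨_, ?_, show m.time + (2 * setCost m.gen.K) ≤ _ by omega⟩
  congr 2
  rw [treeRank_set, treeRank_set]
  have h1 := gapCount_add_card (setKeys m.gen.K) (fun x hx => h.one_le_of_K hx) a
  have h2 := gapCount_add_card (setKeys m.gen.K) (fun x hx => h.one_le_of_K hx) b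
  have h3 := gapCount_mono (setKeys m.gen.K) hab
  have h4 : ((setKeys m.gen.K).filter (· < a)).card ≤ ((setKeys m.gen.K).filter (· < b)).card :=
    Finset.card_le_card (Finset.monotone_filter_right _ fun x _ hx => hx.trans_le hab)
  omega

/-- The vertex of rank `h` in the complement of `K`, counted from `a`. -/
def selectNode (s : GenState) (a h : ℕ) : ℕ :=
  treeSelectCompl s.K.inner.inner.inner (gapCount (setKeys s.K) a + h)

theorem Consistent.selectNode_spec {n : ℕ} {s : GenState} (hI : Consistent n s) (a h : ℕ) :
    1 ≤ selectNode s a h ∧ selectNode s a h ∉ setKeys s.K ∧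
      gapCount (setKeys s.K) (selectNode s a h) = gapCount (setKeys s.K) a + h :=
  treeSelectCompl_spec s.K.inner.inner.wf.ordered s.K.inner.inner.wf.balanced
    (fun _ hx => hI.one_le_of_K hx) _

theorem selectCompl_run {n a h : ℕ} {m : Mach} (hI : Consistent n m.gen) :
    ∃ T, selectCompl a h m = PMF.pure (selectNode m.gen a h, { m with time := T }) ∧
      T ≤ m.time + (opCost (n + 2) + opCost (n + 2) * opCost (n + 2)) := by
  unfold selectCompl
  rw [bind_run_of_run (getGen_run m), bind_run_of_run (charge_run _ _), pure_run]
  have hr := hI.cost_K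
  have hK := fun x hx => hI.one_le_of_K (k := x) hx
  rw [treeRank_set, ← gapCount_eq_sub _ hK]
  refine ⟨_, rfl, ?_⟩
  have := Nat.mul_le_mul hr hr
  omega

/-! ## Moving a front -/

/-- The relation between the states before and after `setFront n j x`. -/
structure FrontMoved (n j x : ℕ) (s s' : GenState) : Prop where
  inv : Consistent n s'
  u : s'.u = s.u
  type : s'.type = s.type
  front : s'.front = s.front.insert j x
  heap : s'.heap = s.heap
  queried : s'.queried = s.queried
  closed : FrontClosed s j → FrontClosed s' x

theorem FrontMoved.ext {n j x : ℕ} {s s' : GenState} (h : FrontMoved n j x s s')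
    (hx : frontVal s j < x) : Extends s s' where
  u i q hi := by
    rw [h.u, h.type]
    exact ⟨hi, rfl⟩
  front i y hi := by
    rw [h.front, getElem?_insert_nat]
    split
    · rename_i he
      subst he
      rw [frontVal, hi] at hx
      exact ⟨x, rfl, hx.le⟩
    · exact ⟨y, hi, le_rfl⟩
  heap := h.heap
  queried := h.queried

/-- A front value is a child of its node, and a child has one parent. This makes front⁻¹ well
defined. -/
theorem front_unique {n : ℕ} {s : GenState} (h : Consistent n s) {i j x : ℕ}
    (hi : s.front[i]? = some x) (hxn : x ≤ n) (hux : s.u[x]? = some j) : i = j := by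
  have h1 := (h.front_spec i x hi).2.2.2 hxn
  rw [hux] at h1
  cases h1
  rfl

theorem key_inj {n i j f g : ℕ} (hi : i ≤ n) (hj : j ≤ n)
    (h : f * (n + 2) + i = g * (n + 2) + j) : f = g ∧ i = j := by
  have h3 : (f * (n + 2) + i) % (n + 2) = (g * (n + 2) + j) % (n + 2) := by rw [h]
  rw [mul_comm, Nat.mul_add_mod, mul_comm, Nat.mul_add_mod, Nat.mod_eq_of_lt (by omega),
      Nat.mod_eq_of_lt (by omega)] at h3
  subst h3
  exact ⟨Nat.eq_of_mul_eq_mul_right (by omega) (Nat.add_right_cancel h), rfl⟩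

/-- What `setFront` needs. -/
structure CanMove (n j x : ℕ) (s : GenState) : Prop where
  inv : Consistent n s
  lt : j < x
  le : x ≤ n + 1
  front_lt : ∀ o : ℕ, s.front[j]? = some o → o < x
  u_isSome : (s.u[j]?).isSome
  u_eq : x ≤ n → s.u[x]? = some j

/-- When the front of `j` moves from o to `x`, the node o loses its preimage and enters K if it has
a front, `x` acquires a preimage and leaves K, and `j` enters K if this is its first front and it is
nobody's front. -/
theorem CanMove.frontMoved {n j x : ℕ} {s : GenState} (hc : CanMove n j x s)
    {K : Std.TreeSet ℕ} {right : Std.TreeSet ℕ} {frontInv : Std.TreeMap ℕ ℕ}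
    (hK : ∀ i, i ∈ K ↔ i ≠ x ∧ (i ∈ s.K ∨ (s.front[j]? = none ∧ i = j ∧ s.frontInv[j]? = none) ∨
      (s.front[j]? = some i ∧ (s.front[i]?).isSome)))
    (hr : ∀ k, k ∈ right ↔ k = x * (n + 2) + j ∨
      ((∀ o, s.front[j]? = some o → k ≠ o * (n + 2) + j) ∧ k ∈ s.right))
    (hf : ∀ i, frontInv[i]? = if i = x ∧ x ≤ n then some j
      else if s.front[j]? = some i then none else s.frontInv[i]?) :
    FrontMoved n j x s
      { s with front := s.front.insert j x, K := K, right := right, frontInv := frontInv } := by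
  obtain ⟨h, hjx, hxn, hold, huj, hux⟩ := hc
  obtain ⟨pj, hpj⟩ := Option.isSome_iff_exists.1 huj
  have hjn := (h.u_range _ _ hpj).2.1
  have hfi : ∀ i y : ℕ, s.front[i]? = some y → i ≤ n := fun i y hi => (h.front_le hi).2
  refine ⟨⟨h.u_one, h.u_range, h.type_one, h.type_range, ?_, ?_, h.child_some, h.child_none,
    ?_, ?_⟩, rfl, rfl, rfl, rfl, rfl, ?_⟩
  · intro i y hi
    rw [getElem?_insert_nat] at hi
    split at hi
    · cases hi
      subst_vars
      exact ⟨hjx, hxn, huj, hux⟩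
    · exact h.front_spec i y hi
  · intro y i
    rw [hf, getElem?_insert_nat]
    have h1 := h.inv_spec y i
    by_cases hy : y = x ∧ x ≤ n
    · rw [if_pos hy]
      obtain ⟨rfl, hyn⟩ := hy
      by_cases hij : j = i
      · simp [hij, hyn]
      · simp only [hij, if_false, Option.some.injEq, false_iff, not_and]
        intro h2
        exact absurd (front_unique h h2 hyn (hux hyn)).symm hij
    · rw [if_neg hy]
      by_cases ho : s.front[j]? = some y
      · rw [if_pos ho]
        have h3 := hold y ho
        simp only [reduceCtorEq, false_iff, not_and]
        split
        · intro h4; cases h4; omega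
        · rename_i hij
          intro h4 hyn
          exact hij (front_unique h h4 hyn ((h.front_spec _ _ ho).2.2.2 hyn)).symm
      · rw [if_neg ho, h1]
        split
        · rename_i hij
          subst hij
          simp only [ho, false_and, Option.some.injEq, false_iff, not_and]
          rintro rfl hyn
          exact hy ⟨rfl, hyn⟩
        · exact Iff.rfl
  · intro k
    rw [hr, h.right_spec]
    constructor
    · rintro (rfl | ⟨h1, i, f, h2, rfl⟩)
      · exact ⟨j, x, by rw [getElem?_insert_nat, if_pos rfl], rfl⟩
      · refine ⟨i, f, ?_, rfl⟩
        rw [getElem?_insert_nat, if_neg, h2]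
        rintro rfl
        exact h1 f h2 rfl
    · rintro ⟨i, f, h2, rfl⟩
      rw [getElem?_insert_nat] at h2
      split at h2
      · cases h2
        subst_vars
        exact Or.inl rfl
      · rename_i hij
        refine Or.inr ⟨fun o ho he => hij ?_, i, f, h2, rfl⟩
        exact (key_inj (hfi _ _ h2) hjn he).2.symm
  · intro i
    rw [hK, h.K_spec, getElem?_insert_nat, hf]
    by_cases hix : i = x
    · subst hix
      by_cases hin : i ≤ n
      · simp [hin]
      -- Only the sentinel `n + 1` remains. It never has a front and so never belongs to K.
      · have h1 : s.front[i]? = none := by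
          by_contra hc
          obtain ⟨y, hy⟩ := Option.ne_none_iff_exists'.1 hc
          exact hin (hfi _ _ hy)
        have : j ≠ i := by omega
        simp [h1, this]
    · by_cases hij : j = i
      · subst hij
        rcases hfj : s.front[j]? with _ | o
        · simp [hix]
        · have h1 := (h.front_spec _ _ hfj).1
          have : o ≠ j := by omega
          simp [hix, this]
      · have hij' : i ≠ j := Ne.symm hij
        by_cases ho : s.front[j]? = some i
        · simp [ho, hix, hij, hij']
          tauto
        · simp [ho, hix, hij, hij']
  · intro hcl y hy
    dsimp only at hy ⊢
    rw [hf] at hy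
    rw [getElem?_insert_nat]
    by_cases hyx : y = x
    · exact Or.inr hyx
    · left
      simp only [hyx, false_and, if_false] at hy
      split at hy
      · simp at hy
      -- The former exception `j` has just received a front. The only new exception is `x`.
      · rcases hcl y hy with h1 | rfl
        · split
          · rfl
          · exact h1
        · simp

theorem opt_isNone_iff {α : Type} (o : Option α) : o.isNone = true ↔ o = none := by
  cases o <;> simp

theorem setFront_run {n j x : ℕ} {m : Mach} (h : CanMove n j x m.gen) :
    ∃ m', setFront n j x m = PMF.pure ((), m') ∧ FrontMoved n j x m.gen m'.gen ∧
      Cost n m m' (9 * opCost (n + 2)) 0 4 := by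
  -- the second part of the procedure, after the treatment of the old front
  have tail : ∀ (m1 : Mach) (K right : Std.TreeSet ℕ) (frontInv : Std.TreeMap ℕ ℕ),
      m1.gen = { m.gen with front := m.gen.front.insert j x, K := K, right := right,
                            frontInv := frontInv } →
      (∀ i, i ∈ K ↔ (i ∈ m.gen.K ∨ (m.gen.front[j]? = none ∧ i = j ∧ m.gen.frontInv[j]? = none) ∨
        (m.gen.front[j]? = some i ∧ (m.gen.front[i]?).isSome))) →
      (∀ k, k ∈ right ↔
        ((∀ o, m.gen.front[j]? = some o → k ≠ o * (n + 2) + j) ∧ k ∈ m.gen.right)) →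
      (∀ i, frontInv[i]? = if m.gen.front[j]? = some i then none else m.gen.frontInv[i]?) →
      Cost n m m1 (6 * opCost (n + 2)) 0 2 →
      ∃ m', (do
          insertRight (x * (n + 2) + j)
          if x ≤ n then
            writeFrontInv x j
            eraseK x : Prog Unit) m1 = PMF.pure ((), m') ∧ FrontMoved n j x m.gen m'.gen ∧
        Cost n m m' (9 * opCost (n + 2)) 0 4 := by
    intro m1 K right frontInv hm1 hK hr hf hcost
    obtain ⟨hI, hjx, hxn, hold, huj, hux⟩ := id h
    obtain ⟨g, T, B⟩ := m1
    dsimp only at hm1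
    subst hm1
    obtain ⟨pj, hpj⟩ := Option.isSome_iff_exists.1 huj
    have hjn := (hI.u_range _ _ hpj).2.1
    have hcr : setCost right ≤ opCost (n + 2) := setCost_le (by omega) fun k hk => by
      obtain ⟨i, f, hf, rfl⟩ := (hI.right_spec k).1 ((hr k).1 hk).2
      have h1 := (hI.front_le hf).2
      have h2 := (hI.front_spec _ _ hf).2.1
      nlinarith
    have hcf : mapCost frontInv ≤ opCost (n + 2) := mapCost_le (by omega) fun k hk => by
      rw [hf] at hk
      split at hk
      · cases hk
      · obtain ⟨f, hf⟩ := Option.isSome_iff_exists.1 hk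
        exact Consistent.lt_sq (((hI.inv_spec _ _).1 hf).2.trans (by omega))
    have hcK : setCost K ≤ opCost (n + 2) := setCost_le (by omega) fun k hk => by
      rcases (hK k).1 hk with h1 | ⟨-, rfl, -⟩ | ⟨-, h1⟩
      · obtain ⟨f, hf⟩ := Option.isSome_iff_exists.1 ((hI.K_spec k).1 h1).1
        exact Consistent.lt_sq ((hI.front_le hf).2.trans (by omega))
      · exact Consistent.lt_sq (by omega)
      · obtain ⟨f, hf⟩ := Option.isSome_iff_exists.1 h1
        exact Consistent.lt_sq ((hI.front_le hf).2.trans (by omega))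
    have hs1 := Std.TreeSet.size_insert_le (t := right) (k := x * (n + 2) + j)
    have hs2 := Std.TreeMap.size_insert_le (t := frontInv) (k := x) (v := j)
    have hs3 := Std.TreeSet.size_erase_le (t := K) (k := x)
    obtain ⟨ht, hb, hs⟩ := hcost
    dsimp only at ht hb hs
    unfold GenState.space at hs
    dsimp only at hs
    rw [bind_run_of_run (insertRight_run _ _)]
    by_cases hx : x ≤ n
    · rw [if_pos hx, bind_run_of_run (writeFrontInv_run _ _ _), eraseK_run]
      refine ⟨_, rfl, h.frontMoved ?_ ?_ ?_, ?_, ?_, ?_⟩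
      · intro i
        rw [mem_erase_nat, hK, ne_comm]
      · intro k
        rw [mem_insert_nat, hr, eq_comm]
      · intro i
        rw [getElem?_insert_nat, hf]
        simp only [hx, and_true, eq_comm]
      · dsimp only; omega
      · exact hb
      · unfold GenState.space
        dsimp only
        omega
    · rw [if_neg hx, pure_run]
      refine ⟨_, rfl, h.frontMoved ?_ ?_ ?_, ?_, ?_, ?_⟩
      · intro i
        rw [hK]
        constructor
        · intro h1
          refine ⟨?_, h1⟩
          rintro rfl
          rcases h1 with h1 | ⟨-, rfl, -⟩ | ⟨-, h1⟩
          · obtain ⟨f, hf⟩ := Option.isSome_iff_exists.1 ((hI.K_spec _).1 h1).1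
            exact hx (hI.front_le hf).2
          · exact hx hjn
          · obtain ⟨f, hf⟩ := Option.isSome_iff_exists.1 h1
            exact hx (hI.front_le hf).2
        · exact fun h1 => h1.2
      · intro k
        rw [mem_insert_nat, hr, eq_comm]
      · intro i
        rw [hf]
        simp [hx]
      · dsimp only; omega
      · exact hb
      · unfold GenState.space
        dsimp only
        omega
  have hI := h.inv
  have hcu := hI.cost_front
  have hci := hI.cost_frontInv
  have hcr := hI.cost_right
  have hcK := hI.cost_K
  have hcf : mapCost (m.gen.front.insert j x) ≤ opCost (n + 2) :=
    mapCost_le (by omega) fun k hk => by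
      obtain ⟨pj, hpj⟩ := Option.isSome_iff_exists.1 h.u_isSome
      have hjn := (hI.u_range _ _ hpj).2.1
      rw [getElem?_insert_nat] at hk
      split at hk
      · exact Consistent.lt_sq (by omega)
      · obtain ⟨f, hf⟩ := Option.isSome_iff_exists.1 hk
        exact Consistent.lt_sq ((hI.front_le hf).2.trans (by omega))
  have hs1 := Std.TreeMap.size_insert_le (t := m.gen.front) (k := j) (v := x)
  unfold setFront
  rw [bind_run_of_run (readArr_run _ _ _), bind_run_of_run (writeFront_run _ _ _)]
  dsimp only
  rcases hj : m.gen.front[j]? with _ | o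
  · dsimp only
    rw [bind_run_of_run (readArr_run _ _ _)]
    dsimp only
    by_cases hfi : m.gen.frontInv[j]? = none
    · rw [if_pos ((opt_isNone_iff _).2 hfi), bind_run_of_run (insertK_run _ _)]
      refine tail _ (m.gen.K.insert j) m.gen.right m.gen.frontInv rfl ?_ ?_ ?_ ⟨?_, ?_, ?_⟩
      · intro i
        rw [mem_insert_nat]
        simp only [hj, hfi, true_and, and_true, reduceCtorEq, false_and, or_false]
        rw [or_comm, @eq_comm _ j i]
      · simp [hj]
      · simp [hj]
      · dsimp only; omega
      · exact le_rfl
      · have := Std.TreeSet.size_insert_le (t := m.gen.K) (k := j)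
        unfold GenState.space
        dsimp only
        omega
    · rw [if_neg (fun hc => hfi ((opt_isNone_iff _).1 hc))]
      refine tail _ m.gen.K m.gen.right m.gen.frontInv rfl ?_ ?_ ?_ ⟨?_, ?_, ?_⟩
      · simp [hj, hfi]
      · simp [hj]
      · simp [hj]
      · dsimp only; omega
      · exact le_rfl
      · unfold GenState.space
        dsimp only
        omega
  · have hoj := (hI.front_spec _ _ hj).1
    have hojn : j ≠ o := by omega
    have hs2 := Std.TreeSet.size_erase_le (t := m.gen.right) (k := o * (n + 2) + j)
    have hs3 := Std.TreeMap.size_erase_le (t := m.gen.frontInv) (k := o)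
    dsimp only
    rw [bind_run_of_run (eraseRight_run _ _), bind_run_of_run (eraseFrontInv_run _ _),
      bind_run_of_run (readArr_run _ _ _)]
    dsimp only
    rw [getElem?_insert_nat, if_neg hojn]
    by_cases hfi : (m.gen.front[o]?).isSome
    · rw [if_pos hfi, bind_run_of_run (insertK_run _ _)]
      refine tail _ (m.gen.K.insert o) (m.gen.right.erase (o * (n + 2) + j))
        (m.gen.frontInv.erase o) rfl ?_ ?_ ?_ ⟨?_, ?_, ?_⟩
      · intro i
        rw [mem_insert_nat, hj]
        simp only [reduceCtorEq, false_and, false_or, Option.some.injEq]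
        constructor
        · rintro (rfl | h1)
          · exact Or.inr ⟨rfl, hfi⟩
          · exact Or.inl h1
        · rintro (h1 | ⟨h1, -⟩)
          · exact Or.inr h1
          · exact Or.inl h1
      · intro k
        rw [mem_erase_nat, hj]
        constructor
        · rintro ⟨h1, h2⟩
          exact ⟨by rintro _ ⟨⟩; exact h1.symm, h2⟩
        · rintro ⟨h1, h2⟩
          exact ⟨(h1 o rfl).symm, h2⟩
      · intro i
        rw [getElem?_erase_nat, hj]
        simp
      · dsimp only; omega
      · exact le_rfl
      · have := Std.TreeSet.size_insert_le (t := m.gen.K) (k := o)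
        unfold GenState.space
        dsimp only
        omega
    · rw [if_neg hfi]
      refine tail _ m.gen.K (m.gen.right.erase (o * (n + 2) + j))
        (m.gen.frontInv.erase o) rfl ?_ ?_ ?_ ⟨?_, ?_, ?_⟩
      · intro i
        rw [hj]
        simp only [reduceCtorEq, false_and, false_or, Option.some.injEq]
        constructor
        · exact Or.inl
        · rintro (h1 | ⟨rfl, h1⟩)
          · exact h1
          · exact absurd h1 hfi
      · intro k
        rw [mem_erase_nat, hj]
        constructor
        · rintro ⟨h1, h2⟩
          exact ⟨by rintro _ ⟨⟩; exact h1.symm, h2⟩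
        · rintro ⟨h1, h2⟩
          exact ⟨(h1 o rfl).symm, h2⟩
      · intro i
        rw [getElem?_erase_nat, hj]
        simp
      · dsimp only; omega
      · exact le_rfl
      · unfold GenState.space
        dsimp only
        omega

open scoped ENNReal

noncomputable section

/-! ## Edge potentials -/

/-- An upper bound for the probability that `i` becomes the parent of `x`. -/
def edgeWeight (U : ℕ → Option ℕ) (G : ℕ → ℕ) (x i : ℕ) : ℝ≥0∞ :=
  match U x with
  | some p => if p = i then 1 else 0
  | none => (if i ∈ openNodes G x then ((openNodes G x).card : ℝ≥0∞)⁻¹ else 0) +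
      ((x - 1 : ℕ) : ℝ≥0∞)⁻¹

/-- The potential of the set of edges `(x, g x)`, `x ∈ X`. -/
def pot (X : Finset ℕ) (g : ℕ → ℕ) (U : ℕ → Option ℕ) (G : ℕ → ℕ) : ℝ≥0∞ :=
  ∏ x ∈ X, edgeWeight U G x (g x)

/-- The parent function of a state. -/
def parentFn (s : GenState) (x : ℕ) : Option ℕ := s.u[x]?

/-- The potential of a set of edges in a state. -/
def genPot (X : Finset ℕ) (g : ℕ → ℕ) (s : GenState) : ℝ≥0∞ := pot X g (parentFn s) (frontVal s)

theorem edgeWeight_some {U : ℕ → Option ℕ} {x p : ℕ} (h : U x = some p) (G : ℕ → ℕ) (i : ℕ) :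
    edgeWeight U G x i = if p = i then 1 else 0 := by
  unfold edgeWeight; rw [h]

theorem edgeWeight_none {U : ℕ → Option ℕ} {x : ℕ} (h : U x = none) (G : ℕ → ℕ) (i : ℕ) :
    edgeWeight U G x i =
      (if i ∈ openNodes G x then ((openNodes G x).card : ℝ≥0∞)⁻¹ else 0) +
        ((x - 1 : ℕ) : ℝ≥0∞)⁻¹ := by
  unfold edgeWeight; rw [h]

theorem mem_openNodes {G : ℕ → ℕ} {x i : ℕ} :
    i ∈ openNodes G x ↔ (1 ≤ i ∧ i < x) ∧ G i < x := by
  simp [openNodes]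

theorem openNodes_congr {G G' : ℕ → ℕ} {x : ℕ} (h : ∀ i, G i < x ↔ G' i < x) :
    openNodes G x = openNodes G' x :=
  Finset.filter_congr fun i _ => h i

theorem edgeWeight_congr {U U' : ℕ → Option ℕ} {G G' : ℕ → ℕ} {x : ℕ} (hU : U x = U' x)
    (h : U x = none → openNodes G x = openNodes G' x) (i : ℕ) :
    edgeWeight U G x i = edgeWeight U' G' x i := by
  rcases hx : U x with _ | p
  · rw [edgeWeight_none hx, edgeWeight_none (hU ▸ hx), h hx]
  · rw [edgeWeight_some hx, edgeWeight_some (hU ▸ hx)]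

theorem pot_congr {X : Finset ℕ} {g : ℕ → ℕ} {U U' : ℕ → Option ℕ} {G G' : ℕ → ℕ}
    (hU : ∀ x ∈ X, U x = U' x) (h : ∀ x ∈ X, U x = none → openNodes G x = openNodes G' x) :
    pot X g U G = pot X g U' G' :=
  Finset.prod_congr rfl fun x hx => edgeWeight_congr (hU x hx) (h x hx) _

open Function (update)

/-- Only whether the front lies below `x` matters. Moving a front from v-1 to v therefore affects
the open nodes at v alone, and a potential changes in at most one factor. -/
theorem openNodes_update_congr {G : ℕ → ℕ} {j v w x : ℕ} (h : v < x ↔ w < x) :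
    openNodes (update G j v) x = openNodes (update G j w) x := by
  refine openNodes_congr fun i => ?_
  by_cases hi : i = j
  · subst hi; simpa using h
  · simp [hi]

/-- Averaging over a uniform parent does not increase the potential. -/
theorem sum_pot_update_le (X : Finset ℕ) (g : ℕ → ℕ) (U : ℕ → Option ℕ) (G : ℕ → ℕ) {j : ℕ}
    (hj : 2 ≤ j) (hUj : U j = none) :
    ((j - 1 : ℕ) : ℝ≥0∞)⁻¹ * ∑ r ∈ Finset.range (j - 1), pot X g (update U j (some (r + 1))) G ≤
      pot X g U G := by
  have h0 : ((j - 1 : ℕ) : ℝ≥0∞) ≠ 0 := by exact_mod_cast (by omega : j - 1 ≠ 0)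
  by_cases hX : j ∈ X
  · have hrest : ∀ p, pot (X.erase j) g (update U j p) G = pot (X.erase j) g U G := fun p =>
      pot_congr (fun x hx => Function.update_of_ne (Finset.ne_of_mem_erase hx) _ _)
        (fun _ _ _ => rfl)
    have hsplit : ∀ U', pot X g U' G = edgeWeight U' G j (g j) * pot (X.erase j) g U' G :=
      fun U' => (Finset.mul_prod_erase _ _ hX).symm
    simp only [hsplit, hrest]
    rw [← Finset.sum_mul, ← mul_assoc]
    refine mul_le_mul_left ?_ _
    rw [edgeWeight_none hUj]
    -- The open-node term is dropped. The uniform draw hits a prescribed parent with probability at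
    -- most 1/(j-1), which is the second term of the weight.
    refine le_trans ?_ le_add_self
    calc _ ≤ ((j - 1 : ℕ) : ℝ≥0∞)⁻¹ * 1 := by
          refine mul_le_mul_right ?_ _
          simp only [edgeWeight_some (Function.update_self j _ U)]
          calc _ ≤ ∑ r ∈ Finset.range (j - 1), if r = g j - 1 then (1 : ℝ≥0∞) else 0 := by
                refine Finset.sum_le_sum fun r _ => ?_
                split_ifs with h1 h2
                · exact le_rfl
                · omega
                · simp
                · simp
            _ ≤ 1 := by
                rw [Finset.sum_ite_eq']
                split_ifs <;> simp
      _ = _ := mul_one _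
  · have : ∀ p, pot X g (update U j p) G = pot X g U G := fun p =>
      pot_congr (fun x hx => Function.update_of_ne (by rintro rfl; exact hX hx) _ _)
        (fun _ _ _ => rfl)
    simp only [this]
    rw [Finset.sum_const, Finset.card_range, nsmul_eq_mul, ← mul_assoc,
      ENNReal.inv_mul_cancel h0 (ENNReal.natCast_ne_top _), one_mul]

/-- One trial: either `v` becomes a child of `j`, or the front of `j` passes `v`. -/
theorem trial_pot_le (X : Finset ℕ) (g : ℕ → ℕ) (U : ℕ → Option ℕ) (G : ℕ → ℕ) {j v q : ℕ}
    (hj : 1 ≤ j) (hjv : j < v) (hq : q = (openNodes (update G j (v - 1)) v).card) :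
    (q : ℝ≥0∞)⁻¹ * pot X g (if U v = none then update U v (some j) else U) (update G j v) +
      ((q - 1 : ℕ) : ℝ≥0∞) * (q : ℝ≥0∞)⁻¹ * pot X g U (update G j v) ≤
      pot X g U (update G j (v - 1)) := by
  have hjmem : j ∈ openNodes (update G j (v - 1)) v := by
    rw [mem_openNodes, Function.update_self]; omega
  have hq1 : 1 ≤ q := by rw [hq]; exact Finset.card_pos.2 ⟨j, hjmem⟩
  have hq0 : (q : ℝ≥0∞) ≠ 0 := by exact_mod_cast (by omega : q ≠ 0)
  have hqt : (q : ℝ≥0∞) ≠ ∞ := ENNReal.natCast_ne_top _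
  have hsum : (q : ℝ≥0∞)⁻¹ + ((q - 1 : ℕ) : ℝ≥0∞) * (q : ℝ≥0∞)⁻¹ = 1 := by
    calc _ = ((1 : ℝ≥0∞) + ((q - 1 : ℕ) : ℝ≥0∞)) * (q : ℝ≥0∞)⁻¹ := by rw [add_mul, one_mul]
      _ = (q : ℝ≥0∞) * (q : ℝ≥0∞)⁻¹ := by
          congr 1
          exact_mod_cast (by omega : 1 + (q - 1) = q)
      _ = 1 := ENNReal.mul_inv_cancel hq0 hqt
  have hother : ∀ x, x ≠ v → openNodes (update G j v) x = openNodes (update G j (v - 1)) x :=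
    fun x hx => openNodes_update_congr (by omega)
  by_cases hX : v ∈ X ∧ U v = none
  · obtain ⟨hX, hUv⟩ := hX
    rw [if_pos hUv]
    have hsplit : ∀ U' G', pot X g U' G' = edgeWeight U' G' v (g v) * pot (X.erase v) g U' G' :=
      fun U' G' => (Finset.mul_prod_erase _ _ hX).symm
    have hrest1 : pot (X.erase v) g (update U v (some j)) (update G j v) =
        pot (X.erase v) g U (update G j (v - 1)) :=
      pot_congr (fun x hx => Function.update_of_ne (Finset.ne_of_mem_erase hx) _ _)
        (fun x hx _ => hother x (Finset.ne_of_mem_erase hx))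
    have hrest2 : pot (X.erase v) g U (update G j v) = pot (X.erase v) g U (update G j (v - 1)) :=
      pot_congr (fun x hx => rfl) (fun x hx _ => hother x (Finset.ne_of_mem_erase hx))
    simp only [hsplit, hrest1, hrest2]
    rw [← mul_assoc, ← mul_assoc, ← add_mul]
    refine mul_le_mul_left ?_ _
    rw [edgeWeight_some (Function.update_self v _ U), edgeWeight_none hUv, edgeWeight_none hUv]
    have herase : openNodes (update G j v) v = (openNodes (update G j (v - 1)) v).erase j := by
      ext i
      rw [Finset.mem_erase, mem_openNodes, mem_openNodes]
      by_cases hi : i = j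
      · subst hi; simp
      · simp [hi]
    rw [herase, Finset.card_erase_of_mem hjmem, ← hq, mul_add, ← add_assoc]
    -- First the term of the open nodes. If the prescribed parent is `j`, only success contributes,
    -- with 1/q; if it is another open node, only failure contributes, with (q-1)/q · 1/(q-1);
    -- otherwise nothing does. Then the term 1/(v-1), which survives with probability (q-1)/q.
    refine add_le_add ?_ ?_
    · by_cases hg : j = g v
      · rw [if_pos hg, if_neg (by simp [hg]), if_pos (hg ▸ hjmem)]
        simp
      · rw [if_neg hg, mul_zero, zero_add]
        by_cases hm : g v ∈ openNodes (update G j (v - 1)) v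
        · rw [if_pos (Finset.mem_erase.2 ⟨Ne.symm hg, hm⟩), if_pos hm]
          have h2 : 2 ≤ q := by
            rw [hq]
            have : ({j, g v} : Finset ℕ).card ≤ (openNodes (update G j (v - 1)) v).card :=
              Finset.card_le_card (by
                intro z hz
                rw [Finset.mem_insert, Finset.mem_singleton] at hz
                rcases hz with rfl | rfl
                · exact hjmem
                · exact hm)
            rwa [Finset.card_pair hg] at this
          rw [mul_right_comm, ENNReal.mul_inv_cancel _ (ENNReal.natCast_ne_top _), one_mul]
          exact_mod_cast (by omega : q - 1 ≠ 0)
        · rw [if_neg (fun h => hm (Finset.mem_of_mem_erase h)), mul_zero]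
          exact zero_le
    · calc _ ≤ 1 * ((v - 1 : ℕ) : ℝ≥0∞)⁻¹ := by
            refine mul_le_mul_left ?_ _
            rw [← hsum]
            exact le_add_self
        _ = _ := one_mul _
  -- If `v` is not in `X` or its parent is already known, no factor depends on the trial.
  · have h1 : pot X g (if U v = none then update U v (some j) else U) (update G j v) =
        pot X g U (update G j (v - 1)) := by
      refine pot_congr (fun x hx => ?_) (fun x hx hn => hother x ?_)
      · split_ifs with hU
        · exact Function.update_of_ne (by rintro rfl; exact hX ⟨hx, hU⟩) _ _
        · rfl
      · rintro rfl
        split_ifs at hn with hU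
        · exact hX ⟨hx, hU⟩
        · exact hU hn
    have h2 : pot X g U (update G j v) = pot X g U (update G j (v - 1)) := by
      refine pot_congr (fun x hx => rfl) (fun x hx hn => hother x ?_)
      rintro rfl
      exact hX ⟨hx, hn⟩
    rw [h1, h2, ← add_mul, hsum, one_mul]

/-- Outside `K` the number of potential parents increases by one from node to node. -/
theorem Consistent.card_openNodes_succ {n : ℕ} {s : GenState} (h : Consistent n s) {e y : ℕ}
    (he : FrontClosed s e) (hey : e < y) (hyn : y ≤ n) :
    (openNodes (frontVal s) (y + 1)).card =
      (openNodes (frontVal s) y).card + if y ∈ setKeys s.K then 0 else 1 := by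
  have hval : ∀ i, i = y ∨ frontVal s i = y → frontVal s i < y + 1 →
      (s.front[y]? = none ∧ i = y) ∨ s.front[i]? = some y := by
    intro i hi hlt
    rcases hi with rfl | hi
    · left
      refine ⟨?_, rfl⟩
      by_contra hc
      obtain ⟨f, hf⟩ := Option.ne_none_iff_exists'.1 hc
      have := (h.front_spec i f hf).1
      simp only [frontVal, hf, Option.getD_some] at hlt
      omega
    · exact Or.inr ((frontVal_eq_iff (by omega)).1 hi)
  have hnone : s.front[y]? = none → frontVal s y = 0 := fun hn => by simp [frontVal, hn]
  have hsub : openNodes (frontVal s) y ⊆ openNodes (frontVal s) (y + 1) := by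
    intro i hi
    rw [mem_openNodes] at hi ⊢
    omega
  -- the new potential parents
  have hnew : ∀ i, i ∈ openNodes (frontVal s) (y + 1) ∧ i ∉ openNodes (frontVal s) y ↔
      (s.front[y]? = none ∧ i = y) ∨ s.front[i]? = some y := by
    intro i
    rw [mem_openNodes, mem_openNodes]
    constructor
    · rintro ⟨⟨h1, h2⟩, h3⟩
      exact hval i (by omega) h2
    · rintro (⟨h1, rfl⟩ | h1)
      · have := hnone h1
        omega
      · have h2 := h.front_spec i y h1
        have h3 := h.front_le h1
        have h4 : frontVal s i = y := (frontVal_eq_iff (by omega)).2 h1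
        omega
  have hK : y ∈ setKeys s.K ↔ (s.front[y]?).isSome ∧ s.frontInv[y]? = none := by
    rw [mem_setKeys, h.K_spec]
  simp only [hK]
  rcases hfi : s.frontInv[y]? with _ | i
  · rcases hfy : s.front[y]? with _ | f
    · -- `y` itself is new
      rw [if_neg (by simp), ← Finset.card_insert_of_notMem (s := openNodes (frontVal s) y) (a := y)]
      · congr 1
        ext i
        rw [Finset.mem_insert]
        constructor
        · intro hi
          by_cases hi' : i ∈ openNodes (frontVal s) y
          · exact Or.inr hi'
          · rcases (hnew i).1 ⟨hi, hi'⟩ with h1 | h1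
            · exact Or.inl h1.2
            · have := (h.inv_spec y i).2 ⟨h1, hyn⟩
              rw [hfi] at this
              cases this
        · rintro (rfl | hi)
          · exact ((hnew i).2 (Or.inl ⟨hfy, rfl⟩)).1
          · exact hsub hi
      · rw [mem_openNodes]; omega
    · rw [if_pos ⟨rfl, rfl⟩, add_zero]
      congr 1
      refine Finset.Subset.antisymm ?_ hsub
      intro i hi
      by_contra hi'
      rcases (hnew i).1 ⟨hi, hi'⟩ with h1 | h1
      · rw [hfy] at h1; cases h1.1
      · have := (h.inv_spec y i).2 ⟨h1, (h.front_le hfy).2⟩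
        rw [hfi] at this
        cases this
  · obtain ⟨h1, hyn⟩ := (h.inv_spec y i).1 hfi
    rw [if_neg (by simp)]
    -- Here `y` is the front of `i`, which becomes open at `y + 1`. If `y` had no front, it would
    -- become open as well and the count would rise by two; `FrontClosed` excludes this, the
    -- exceptional node being below `y`.
    have hfy : (s.front[y]?).isSome := by
      rcases he y (by rw [hfi]; rfl) with h2 | h2
      · exact h2
      · omega
    rw [← Finset.card_insert_of_notMem (s := openNodes (frontVal s) y) (a := i)]
    · congr 1
      ext i'
      rw [Finset.mem_insert]
      constructor
      · intro hi
        by_cases hi' : i' ∈ openNodes (frontVal s) y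
        · exact Or.inr hi'
        · rcases (hnew i').1 ⟨hi, hi'⟩ with h2 | h2
          · rw [h2.1] at hfy; cases hfy
          · have := (h.inv_spec y i').2 ⟨h2, hyn⟩
            rw [hfi] at this
            cases this
            exact Or.inl rfl
      · rintro (rfl | hi)
        · exact ((hnew i').2 (Or.inr h1)).1
        · exact hsub hi
    · exact ((hnew i).2 (Or.inr h1)).2

/-- This is why `toss` may work with ranks in the complement of K: the vertex of rank i counted from
`a` has exactly ξ+i open nodes, the denominator of its trial. -/
theorem Consistent.card_openNodes_eq {n : ℕ} {s : GenState} (h : Consistent n s) {e a y : ℕ}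
    (he : FrontClosed s e) (hea : e < a) (hay : a ≤ y) (hyn : y ≤ n + 1) :
    (openNodes (frontVal s) y).card = (openNodes (frontVal s) a).card +
      (gapCount (setKeys s.K) y - gapCount (setKeys s.K) a) := by
  induction y, hay using Nat.le_induction with
  | base => simp
  | succ y hay ih =>
    rw [h.card_openNodes_succ he (by omega) (by omega), ih (by omega),
      gapCount_succ _ (by omega : 1 ≤ y)]
    have := gapCount_mono (setKeys s.K) hay
    split_ifs <;> omega

/-- The vertices skipped by the loop have known parents, so moving a front past them leaves every
potential unchanged. -/
theorem Consistent.u_ne_none_of_K {n : ℕ} {s : GenState} (h : Consistent n s) {y : ℕ}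
    (hy : y ∈ setKeys s.K) : parentFn s y ≠ none := by
  obtain ⟨f, hf⟩ := Option.isSome_iff_exists.1 ((h.K_spec y).1 (mem_setKeys.1 hy)).1
  intro hn
  have := (h.front_spec y f hf).2.2.1
  unfold parentFn at hn
  rw [hn] at this
  cases this

/-- The potential does not increase in a round of the loop of `next-child`. -/
theorem Consistent.seqE_le_pot {n : ℕ} {s : GenState} (h : Consistent n s) {j a b : ℕ}
    (hj : 1 ≤ j) (hcl : FrontClosed s j) (hja : j < a) (hab : a ≤ b) (hbn : b ≤ n + 1)
    (hb : b ≤ n → s.u[b]? = some j) (hfr : frontVal s j < a) {X : Finset ℕ}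
    (hX : ∀ x ∈ X, x ≤ n) (g : ℕ → ℕ) (f : ℕ → ℝ≥0∞)
    (hf : ∀ x, a ≤ x → x < b → x ∉ setKeys s.K →
      f (gapCount (setKeys s.K) x - gapCount (setKeys s.K) a) ≤
        pot X g (if parentFn s x = none then update (parentFn s) x (some j) else parentFn s)
          (update (frontVal s) j x))
    (hfb : f (gapCount (setKeys s.K) b - gapCount (setKeys s.K) a) ≤
      pot X g (parentFn s) (update (frontVal s) j b)) :
    seqE (openNodes (frontVal s) a).card f
        (gapCount (setKeys s.K) b - gapCount (setKeys s.K) a) 0 ≤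
      pot X g (parentFn s) (update (frontVal s) j (a - 1)) := by
  have hknown : ∀ y, 1 ≤ y → (y ∈ X → parentFn s y ≠ none) →
      pot X g (parentFn s) (update (frontVal s) j y) =
        pot X g (parentFn s) (update (frontVal s) j (y - 1)) := by
    intro y hy hu
    refine pot_congr (fun _ _ => rfl) fun x hx hn => openNodes_update_congr ?_
    have : x ≠ y := by rintro rfl; exact hu hx hn
    omega
  -- Backward induction over the vertices from `b` to `a`, the front of `j` standing virtually at `y
  -- - 1`. A vertex of K is passed freely; any other vertex is one trial.
  have key : ∀ y, y ≤ b → a ≤ y →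
      seqE (openNodes (frontVal s) a).card f
        (gapCount (setKeys s.K) b - gapCount (setKeys s.K) y)
        (gapCount (setKeys s.K) y - gapCount (setKeys s.K) a) ≤
      pot X g (parentFn s) (update (frontVal s) j (y - 1)) := by
    intro y hyb
    induction hyb using Nat.decreasingInduction with
    | self =>
      intro _
      rw [Nat.sub_self]
      -- Passing `b` is free as well: its parent is known if `b ≤ n`, and `n + 1` is not in `X`.
      refine hfb.trans_eq (hknown b (by omega) fun hbX hn => ?_)
      have := hb (hX b hbX)
      unfold parentFn at hn
      rw [hn] at this
      cases this
    | of_succ y hyb ih =>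
      intro hay
      have h1 := ih (by omega)
      have h2 := gapCount_succ (setKeys s.K) (y := y) (by omega)
      rw [Nat.add_sub_cancel] at h1
      by_cases hyK : y ∈ setKeys s.K
      · rw [if_pos hyK, add_zero] at h2
        rw [h2] at h1
        exact h1.trans_eq (hknown y (by omega) fun _ => h.u_ne_none_of_K hyK)
      · rw [if_neg hyK] at h2
        have h3 := gapCount_mono (setKeys s.K) hyb
        have h4 := gapCount_mono (setKeys s.K) hay
        rw [h2] at h1 h3
        -- The virtual front and the true front of `j` are both below `y`, so the open nodes at `y`
        -- are those of the actual state.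
        have hq : openNodes (update (frontVal s) j (y - 1)) y = openNodes (frontVal s) y := by
          refine openNodes_congr fun i => ?_
          by_cases hi : i = j
          · subst hi
            rw [Function.update_self]
            omega
          · rw [Function.update_of_ne hi]
        have h5 := trial_pot_le X g (parentFn s) (frontVal s) (v := y) hj (by omega)
          (q := (openNodes (frontVal s) a).card +
            (gapCount (setKeys s.K) y - gapCount (setKeys s.K) a))
          (by rw [hq, h.card_openNodes_eq hcl hja hay (by omega)])
        rw [show gapCount (setKeys s.K) b - gapCount (setKeys s.K) y =
          (gapCount (setKeys s.K) b - (gapCount (setKeys s.K) y + 1)) + 1 by omega, seqE]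
        refine le_trans (add_le_add (mul_le_mul_right (hf y hay hyb hyK) _)
          (mul_le_mul_right ?_ _)) h5
        rwa [show gapCount (setKeys s.K) y + 1 - gapCount (setKeys s.K) a =
          gapCount (setKeys s.K) y - gapCount (setKeys s.K) a + 1 by omega] at h1
  simpa using key a hab le_rfl

/-- The expected inverse of the number of potential parents is halved in each round. -/
theorem seqE_inv_le {ξ s : ℕ} (hξ : 1 ≤ ξ) {r i : ℕ} (hri : r + i = s) :
    seqE ξ (fun h => if h < s then ((ξ + h + 1 : ℕ) : ℝ≥0∞)⁻¹ else 0) r i ≤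
      2⁻¹ * ((ξ + i : ℕ) : ℝ≥0∞)⁻¹ := by
  induction r generalizing i with
  | zero => simp [seqE, show i = s by omega]
  | succ r ih =>
    have h1 := ih (i := i + 1) (by omega)
    rw [seqE, if_pos (by omega)]
    obtain ⟨q, hq⟩ : ∃ q, ξ + i = q + 1 := ⟨ξ + i - 1, by omega⟩
    have e1 : ξ + (i + 1) = q + 2 := by omega
    rw [hq, Nat.add_sub_cancel]
    rw [e1] at h1
    -- With q+1 = ξ+i this is an identity: 1/((q+1)(q+2)) + q/(q+1) · 1/(2(q+2)) = 1/(2(q+1)).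
    refine le_trans (add_le_add le_rfl (mul_le_mul_right h1 _)) (le_of_eq ?_)
    have t1 : ((q + 1 : ℕ) : ℝ≥0∞)⁻¹ = ENNReal.ofReal ((q + 1 : ℝ)⁻¹) := by
      rw [ENNReal.ofReal_inv_of_pos (by positivity)]
      congr 1
      rw [← ENNReal.ofReal_natCast]; push_cast; rfl
    have t2 : ((q + 1 + 1 : ℕ) : ℝ≥0∞)⁻¹ = ENNReal.ofReal ((q + 2 : ℝ)⁻¹) := by
      rw [ENNReal.ofReal_inv_of_pos (by positivity)]
      congr 1
      rw [← ENNReal.ofReal_natCast]; push_cast; ring_nf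
    have t3 : (2 : ℝ≥0∞)⁻¹ = ENNReal.ofReal (2⁻¹) := by
      rw [ENNReal.ofReal_inv_of_pos (by positivity)]; simp
    rw [show q + 2 = q + 1 + 1 from rfl, t2, t1, t3, ← ENNReal.ofReal_natCast q,
      ← ENNReal.ofReal_mul (by positivity), ← ENNReal.ofReal_mul (by positivity),
      ← ENNReal.ofReal_mul (by positivity), ← ENNReal.ofReal_mul (by positivity),
      ← ENNReal.ofReal_mul (by positivity), ← ENNReal.ofReal_add (by positivity) (by positivity)]
    congr 1
    field_simp
    ring

theorem Assigned.genPot_eq {n x p : ℕ} {s s' : GenState} {f : PtrFlag} (h : Assigned n x p s f s')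
    (X : Finset ℕ) (g : ℕ → ℕ) :
    genPot X g s' = pot X g (update (parentFn s) x (some p)) (frontVal s) := by
  have h1 : parentFn s' = update (parentFn s) x (some p) := by
    funext i
    unfold parentFn
    rw [h.u, getElem?_insert_nat, Function.update_apply]
    simp only [eq_comm]
  have h2 : frontVal s' = frontVal s := by
    funext i
    unfold frontVal
    rw [h.front]
  rw [genPot, h1, h2]

theorem FrontMoved.genPot_eq {n j x : ℕ} {s s' : GenState} (h : FrontMoved n j x s s')
    (X : Finset ℕ) (g : ℕ → ℕ) :
    genPot X g s' = pot X g (parentFn s) (update (frontVal s) j x) := by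
  have h1 : parentFn s' = parentFn s := by
    funext i
    unfold parentFn
    rw [h.u]
  have h2 : frontVal s' = update (frontVal s) j x := by
    funext i
    unfold frontVal
    rw [h.front, getElem?_insert_nat, Function.update_apply]
    by_cases hi : i = j
    · simp [hi]
    · simp [hi, Ne.symm hi]
  rw [genPot, h1, h2]

end

open scoped ENNReal
open Function (update)

noncomputable section

/-! ## Specifications of randomized programs -/

/-- `P`, started at `m`, always ends in `Q`, violates the resource bound `C` with probability at
most `ε`, and the expected potential of its result is at most `V`. -/
structure Spec (n : ℕ) {α : Type} (P : Prog α) (m : Mach) (ε : ℝ≥0∞)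
    (V : Finset ℕ → (ℕ → ℕ) → ℝ≥0∞) (Q C : α → Mach → Prop) : Prop where
  supp : Always P m Q
  cost : wp P m (fun r => ind ¬C r.1 r.2) ≤ ε
  mart : ∀ (X : Finset ℕ) (g : ℕ → ℕ), (∀ x ∈ X, x ≤ n) →
    wp P m (fun r => genPot X g r.2.gen) ≤ V X g

namespace Spec

variable {n : ℕ} {α β : Type} {P : Prog α} {R : α → Prog β} {m : Mach} {ε ε' : ℝ≥0∞}
  {V V' : Finset ℕ → (ℕ → ℕ) → ℝ≥0∞}

theorem mono {Q Q' C C' : α → Mach → Prop} (h : Spec n P m ε V Q C) (hε : ε ≤ ε')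
    (hV : ∀ X g, V X g ≤ V' X g) (hQ : ∀ a m', Q a m' → Q' a m')
    (hC : ∀ a m', Q a m' → C a m' → C' a m') : Spec n P m ε' V' Q' C' where
  supp := h.supp.mono hQ
  cost := by
    refine le_trans (wp_mono fun a m' hp => ind_mono fun h1 h2 => ?_) (h.cost.trans hε)
    exact h1 (hC a m' (h.supp a m' hp) h2)
  mart X g hX := (h.mart X g hX).trans (hV X g)

/-- Failure probabilities add by a union bound, and the supermartingale property composes because
the second program is controlled from every state that the first can reach. `C2` may refer to the
intermediate state, so that costs can be added up. -/
theorem bind {Q1 C1 : α → Mach → Prop} {Q C : β → Mach → Prop} {C2 : α → Mach → β → Mach → Prop}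
    (h1 : Spec n P m ε V Q1 C1)
    (h2 : ∀ a m', Q1 a m' → Spec n (R a) m' ε' (fun X g => genPot X g m'.gen) Q (C2 a m'))
    (hC : ∀ a m' b m'', Q1 a m' → C1 a m' → Q b m'' → C2 a m' b m'' → C b m'') :
    Spec n (P >>= R) m (ε + ε') V Q C where
  supp := h1.supp.bind fun a m' hq => (h2 a m' hq).supp
  cost := by
    rw [wp_bind]
    refine le_trans (wp_mono (g := fun r => ind (¬C1 r.1 r.2) + ε') fun a m' hp => ?_) ?_
    · have hq := h1.supp a m' hp
      by_cases hc : C1 a m'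
      · refine le_trans ?_ le_add_self
        refine le_trans (wp_mono fun b m'' hb => ind_mono fun h3 h4 => ?_) (h2 a m' hq).cost
        exact h3 (hC a m' b m'' hq hc ((h2 a m' hq).supp b m'' hb) h4)
      · dsimp only
        rw [ind_of_true hc]
        exact (wp_le_of_always fun _ _ _ => ind_le_one _).trans le_self_add
    · rw [wp_add, wp_const]
      exact add_le_add h1.cost le_rfl
  mart X g hX := by
    rw [wp_bind]
    refine le_trans (wp_mono fun a m' hp => ?_) (h1.mart X g hX)
    exact (h2 a m' (h1.supp a m' hp)).mart X g hX

/-- The variant for a first program about which only its possible outcomes matter: the bounds for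
the continuation hold uniformly, so they survive averaging. -/
theorem bind_always {Q1 : α → Mach → Prop} {Q C : β → Mach → Prop} (h1 : Always P m Q1)
    (h2 : ∀ a m', Q1 a m' → Spec n (R a) m' ε V Q C) : Spec n (P >>= R) m ε V Q C where
  supp := h1.bind fun a m' hq => (h2 a m' hq).supp
  cost := by
    rw [wp_bind]
    exact wp_le_of_always fun a m' hp => (h2 a m' (h1 a m' hp)).cost
  mart X g hX := by
    rw [wp_bind]
    exact wp_le_of_always fun a m' hp => (h2 a m' (h1 a m' hp)).mart X g hX

theorem of_run {P' : Prog α} {m' : Mach} {Q C : α → Mach → Prop} (h : P m = P' m')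
    (h2 : Spec n P' m' ε V Q C) : Spec n P m ε V Q C where
  supp := by
    intro a m'' hp
    rw [h] at hp
    exact h2.supp a m'' hp
  cost := by
    have := h2.cost
    unfold wp at this ⊢
    rwa [h]
  mart X g hX := by
    have := h2.mart X g hX
    unfold wp at this ⊢
    rwa [h]

theorem pure {a : α} {Q C : α → Mach → Prop} (hQ : Q a m) (hC : C a m)
    (hV : ∀ X g, (∀ x ∈ X, x ≤ n) → genPot X g m.gen ≤ V X g) :
    Spec n (Pure.pure a : Prog α) m ε V Q C where
  supp := Always.of_run (pure_run _ _) hQ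
  cost := by
    rw [wp_of_run (pure_run _ _), ind_of_false (not_not.2 hC)]
    exact zero_le
  mart X g hX := by
    rw [wp_of_run (pure_run _ _)]
    exact hV X g hX

end Spec

/-! ## The query for a parent -/

/-- The state is consistent and extends `s`. -/
structure Steady (n : ℕ) (s s' : GenState) : Prop where
  inv : Consistent n s'
  ext : Extends s s'
  closed : FrontClosed s' 0

theorem clog_le_opCost {k n : ℕ} (hk : k ≤ n) : Nat.clog 2 k + 9 ≤ opCost (n + 2) := by
  have h1 : Nat.clog 2 k ≤ Nat.log 2 (n + 2) + 1 := by
    refine Nat.clog_le_of_le_pow (hk.trans ?_)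
    have := Nat.lt_pow_succ_log_self (b := 2) (by norm_num) (n + 2)
    omega
  unfold opCost
  omega

theorem FrontClosed.congr {s s' : GenState} {e : ℕ} (h : FrontClosed s e)
    (hf : s'.front = s.front) (hi : s'.frontInv = s.frontInv) : FrontClosed s' e := by
  unfold FrontClosed at h ⊢
  rwa [hf, hi]

/-- The outcome of `parentQuery n j`. -/
structure ParentFound (n j : ℕ) (m : Mach) (r : ℕ × PtrFlag) (m' : Mach) : Prop where
  inv : Consistent n m'.gen
  ext : Extends m.gen m'.gen
  u : m'.gen.u[j]? = some r.1
  front : m'.gen.front = m.gen.front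
  frontInv : m'.gen.frontInv = m.gen.frontInv
  two_le : r.2 = PtrFlag.recur → 2 ≤ j
  cost : Cost n m m' (9 * opCost (n + 2)) (opCost (n + 2)) 6

/-- For an unknown parent the potential is controlled by `sum_pot_update_le`; if the parent is
known, the potential does not change. -/
theorem parentQuery_spec {n j : ℕ} {m : Mach} (h : Consistent n m.gen) (h1 : 1 ≤ j) (h2 : j ≤ n) :
    Spec n (parentQuery n j) m 0 (fun X g => genPot X g m.gen) (ParentFound n j m)
      (fun _ _ => True) := by
  have hcu := h.cost_u
  have hct := h.cost_type
  have hO := opCost_pos (n + 2)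
  rcases hj : m.gen.u[j]? with _ | p
  · have hj1 : j ≠ 1 := by rintro rfl; rw [h.u_one] at hj; cases hj
    refine Spec.of_run (P' := do
      let r ← draw (j - 1)
      let f ← assign n j (r + 1)
      return (r + 1, f)) (m' := { m with time := m.time + mapCost m.gen.u }) ?_ ?_
    · unfold parentQuery assign
      rw [bind_run_of_run (readArr_run _ _ _), hj]
      simp only [bind_assoc, pure_bind]
    set m1 : Mach := { m with time := m.time + mapCost m.gen.u } with hm1
    have hkey : ∀ r, r < j - 1 → Always (assign n j (r + 1) >>= fun f => pure (r + 1, f))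
        { m1 with time := m1.time + 1, bits := m1.bits + Nat.clog 2 (j - 1) }
        fun q m' => ParentFound n j m q m' ∧ Assigned n j (r + 1) m.gen q.2 m'.gen := by
      intro r hr
      refine (assign_always (m := { m1 with time := m1.time + 1, bits := m1.bits + Nat.clog 2 (j - 1) })
        h hj h2 (by omega) (by omega)).bind ?_
      rintro f m' ⟨h3, h4⟩
      refine Always.of_run (pure_run _ _) ⟨⟨h3.inv, h3.ext hj, ?_, h3.front, h3.frontInv, ?_, ?_⟩, h3⟩
      · rw [h3.u, getElem?_insert_nat, if_pos rfl]
      · intro _; omega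
      · obtain ⟨h5, h6, h7⟩ := h4
        have := clog_le_opCost (show j - 1 ≤ n by omega)
        dsimp only [m1] at h5 h6 h7
        constructor <;> omega
    refine ⟨?_, ?_, ?_⟩
    · refine (draw_always m1 _ (by omega)).bind ?_
      rintro r _ ⟨hr, rfl⟩
      exact (hkey r hr).mono fun _ _ hq => hq.1
    · exact wp_le_of_always fun a m' _ => by rw [ind_of_false (by simp)]
    · intro X g _
      rw [wp_bind, draw_wp _ _ (by omega)]
      refine le_trans (mul_le_mul_right (Finset.sum_le_sum fun r hr => ?_) _)
        (sum_pot_update_le X g (parentFn m.gen) (frontVal m.gen) (j := j) (by omega) hj)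
      exact wp_le_of_always fun q m' hq =>
        ((hkey r (Finset.mem_range.1 hr) q m' hq).2.genPot_eq X g).le
  · refine Spec.of_run (P' := pure (p, (m.gen.type[j]?).getD PtrFlag.dir))
      (m' := { m with time := m.time + mapCost m.gen.u + mapCost m.gen.type }) ?_ ?_
    · unfold parentQuery
      rw [bind_run_of_run (readArr_run _ _ _), hj]
      dsimp only
      rw [bind_run_of_run (readArr_run _ _ _)]
    · refine Spec.pure ⟨h, Extends.refl _, hj, rfl, rfl, ?_, ⟨?_, ?_, ?_⟩⟩ trivial
        (fun _ _ _ => le_rfl)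
      · intro hf
        -- The self-loop of node 1 is direct, so a recursive pointer starts at a node at least 2.
        by_contra hc
        rw [show j = 1 by omega, h.type_one] at hf
        cases hf
      · dsimp only; omega
      · dsimp only; omega
      · dsimp only; omega

/-! ## The recursion of `next-child` -/

/-- There is a path of length `D` that descends from `j` in the tree of parents. -/
def DownPath (U : ℕ → Option ℕ) : ℕ → ℕ → Prop
  | 0, _ => True
  | D + 1, j => ∃ x, 2 ≤ x ∧ U x = some j ∧ DownPath U D x

/-- A specification of a recursive call of `next-child` for `x`. -/
def RecSpec (n : ℕ) (nextRec : ℕ → Prog ℕ) (x : ℕ) (ε : ℝ≥0∞) (T B S D : ℕ) : Prop :=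
  ∀ m : Mach, Consistent n m.gen → FrontClosed m.gen x → m.gen.front[x]? = none →
    (m.gen.u[x]?).isSome →
    Spec n (nextRec x) m ε (fun X g => genPot X g m.gen) (fun _ m' => Steady n m.gen m'.gen)
      (fun _ m' => Cost n m m' T B S ∨ DownPath (parentFn m'.gen) D x)

/-- The exception disappears once `x` has a front, or if `x` is the sentinel, for which front⁻¹ is
not stored. The exception 0 means that there is none, since front values are positive. -/
theorem FrontClosed.zero_of_isSome {n : ℕ} {s : GenState} {x : ℕ} (hI : Consistent n s)
    (h : FrontClosed s x) (hx : x ≤ n → (s.front[x]?).isSome) : FrontClosed s 0 := by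
  intro y hy
  rcases h y hy with h1 | rfl
  · exact Or.inl h1
  · obtain ⟨i, hi⟩ := Option.isSome_iff_exists.1 hy
    exact Or.inl (hx ((hI.inv_spec _ _).1 hi).2)

theorem FrontClosed.of_zero {n : ℕ} {s : GenState} (hI : Consistent n s) (h : FrontClosed s 0)
    (e : ℕ) : FrontClosed s e := by
  intro y hy
  rcases h y hy with h1 | rfl
  · exact Or.inl h1
  · obtain ⟨i, hi⟩ := Option.isSome_iff_exists.1 hy
    have := (hI.front_spec _ _ ((hI.inv_spec _ _).1 hi).1).1
    omega

/-- After the assignment, `x` is the only node that may violate `FrontClosed`. The recursive call is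
made exactly if it does, and thereby restores the invariant. The starting potential is taken with
the front of `j` already at `x`, where the trials have left it. -/
theorem commitChild_spec {n j x : ℕ} {nextRec : ℕ → Prog ℕ} {ε : ℝ≥0∞} {T B S D : ℕ}
    (hrec : x ≤ n → RecSpec n nextRec x ε T B S D) {m : Mach} (h : CanMove n j x m.gen)
    (hcl : FrontClosed m.gen j) :
    Spec n (commitChild n nextRec j x) m ε
      (fun X g => pot X g (parentFn m.gen) (update (frontVal m.gen) j x))
      (fun r m' => r = x ∧ Steady n m.gen m'.gen ∧ ∃ y, m'.gen.front[j]? = some y ∧ x ≤ y)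
      (fun _ m' => Cost n m m' (10 * opCost (n + 2) + T) B (4 + S) ∨
        (x ≤ n ∧ DownPath (parentFn m'.gen) D x)) := by
  obtain ⟨m1, hm1, hF, hc1⟩ := setFront_run h
  have hfr : frontVal m.gen j < x := by
    unfold frontVal
    rcases ho : m.gen.front[j]? with _ | o
    · have := h.lt
      simp only [Option.getD_none]; omega
    · exact h.front_lt o ho
  have hext := hF.ext hfr
  have hcl1 := hF.closed hcl
  have hpot : ∀ X g, genPot X g m1.gen = pot X g (parentFn m.gen) (update (frontVal m.gen) j x) :=
    hF.genPot_eq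
  have hfx : ∀ s, Extends m1.gen s → ∃ y, s.front[j]? = some y ∧ x ≤ y := by
    intro s hs
    exact hs.front j x (by rw [hF.front, getElem?_insert_nat, if_pos rfl])
  have hcf := hF.inv.cost_front
  have hcost : ∀ t, t ≤ opCost (n + 2) → ∀ T' B' S',
      Cost n m { m1 with time := m1.time + t } (10 * opCost (n + 2) + T') B' (4 + S') := by
    intro t ht T' B' S'
    obtain ⟨h1, h2, h3⟩ := hc1
    constructor
    · dsimp only; omega
    · dsimp only; omega
    · dsimp only; omega
  refine Spec.of_run (P' := do
      if x ≤ n then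
        if (← readArr GenState.front x).isNone then
          let _ ← nextRec x
      return x) (m' := m1) ?_ ?_
  · unfold commitChild
    rw [bind_run_of_run hm1]
  by_cases hxn : x ≤ n
  · simp only [if_pos hxn]
    by_cases hx : m1.gen.front[x]? = none
    · refine Spec.of_run (P' := nextRec x >>= fun _ => pure x)
        (m' := { m1 with time := m1.time + mapCost m1.gen.front }) ?_ ?_
      · rw [bind_run_of_run (readArr_run _ _ _), if_pos ((opt_isNone_iff _).2 hx)]
      · have := hrec hxn { m1 with time := m1.time + mapCost m1.gen.front } hF.inv hcl1 hx
          (by dsimp only; rw [hF.u, h.u_eq hxn]; rfl)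
        rw [← add_zero ε]
        refine (this.mono le_rfl (fun X g => (hpot X g).le) (fun _ _ => id) (fun _ _ _ => id)).bind
          (C2 := fun _ m' _ m'' => m'' = m') ?_ ?_
        · rintro a m' hs
          exact Spec.pure ⟨rfl, ⟨hs.inv, hext.trans hs.ext, hs.closed⟩, hfx _ hs.ext⟩ rfl
            (fun _ _ _ => le_rfl)
        · rintro a m' b _ hs hc1 - rfl
          refine hc1.imp (fun hc => ?_) fun hc => ⟨hxn, hc⟩
          have := (hcost _ hcf 0 0 0).trans hc
          exact this.mono (by omega) (by omega) (by omega)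
    · refine Spec.of_run (P' := pure x)
        (m' := { m1 with time := m1.time + mapCost m1.gen.front }) ?_ ?_
      · rw [bind_run_of_run (readArr_run _ _ _), if_neg (fun hc => hx ((opt_isNone_iff _).1 hc))]
      · refine Spec.pure ⟨rfl, ⟨hF.inv, hext, ?_⟩, hfx _ (Extends.refl _)⟩
          (Or.inl (hcost _ hcf _ _ _)) fun X g _ => (hpot X g).le
        exact FrontClosed.zero_of_isSome hF.inv hcl1 fun _ => Option.ne_none_iff_isSome.1 hx
  · simp only [if_neg hxn]
    refine Spec.of_run (P' := pure x) (m' := m1) rfl ?_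
    refine Spec.pure ⟨rfl, ⟨hF.inv, hext, ?_⟩, hfx _ (Extends.refl _)⟩
      (Or.inl (hcost 0 (by omega) T B S)) fun X g _ => (hpot X g).le
    exact FrontClosed.zero_of_isSome hF.inv hcl1 fun h => absurd h hxn

end

open scoped ENNReal
open Function (update)

noncomputable section

/-! ## The loop of `next-child` -/

/-- The resource bounds for `toss` that fail with probability at most `p`. -/
def TossBound (n c Tt Bt : ℕ) (p : ℝ≥0∞) : Prop :=
  ∀ (ξ t : ℕ) (m : Mach), 1 ≤ ξ → ξ ≤ n → 1 ≤ t → t ≤ n + 1 →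
    wp (toss n c ξ t) m (fun r => ind ¬(r.2.time ≤ m.time + Tt ∧ r.2.bits ≤ m.bits + Bt)) ≤ p

/-- The outcome `x` of a search for a child of `j` that is at least `a`. -/
structure ChildFound (n j a : ℕ) (s : GenState) (x : ℕ) (s' : GenState) : Prop where
  steady : Steady n s s'
  le : a ≤ x
  le_n : x ≤ n + 1
  u : x ≤ n → s'.u[x]? = some j
  front : ∃ y, s'.front[j]? = some y ∧ x ≤ y

theorem gapCount_lt {K : Finset ℕ} {x y : ℕ} (hx : 1 ≤ x) (hxy : x < y) (hxK : x ∉ K) :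
    gapCount K x < gapCount K y := by
  have h1 := gapCount_succ K hx
  rw [if_neg hxK] at h1
  have h2 := gapCount_mono K (show x + 1 ≤ y from hxy)
  omega

theorem gapCount_inj {K : Finset ℕ} {x y : ℕ} (hx : 1 ≤ x) (hy : 1 ≤ y) (hxK : x ∉ K)
    (hyK : y ∉ K) (h : gapCount K x = gapCount K y) : x = y := by
  rcases lt_trichotomy x y with h1 | h1 | h1
  · have := gapCount_lt hx h1 hxK; omega
  · exact h1
  · have := gapCount_lt hy h1 hyK; omega

theorem gapCount_le (K : Finset ℕ) (y : ℕ) : gapCount K y ≤ y - 1 := by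
  unfold gapCount
  refine (Finset.card_filter_le _ _).trans ?_
  rw [Nat.card_Ico]

theorem wp_const_mul {α : Type} (P : Prog α) (m : Mach) (k : ℝ≥0∞) (f : α × Mach → ℝ≥0∞) :
    wp P m (fun r => k * f r) = k * wp P m f := by
  unfold wp
  rw [← ENNReal.tsum_mul_left]
  simp only [mul_left_comm]

/-- The situation in which a round of the loop of `next-child` starts. -/
structure LoopPre (n j a b : ℕ) (s : GenState) : Prop where
  inv : Consistent n s
  closed : FrontClosed s j
  one_le : 1 ≤ j
  lt : j < a
  le : a ≤ b
  le_n : b ≤ n + 1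
  u_b : b ≤ n → s.u[b]? = some j
  u_j : (s.u[j]?).isSome
  front : frontVal s j < a

theorem LoopPre.front_lt {n j a b : ℕ} {s : GenState} (h : LoopPre n j a b s) (o : ℕ)
    (ho : s.front[j]? = some o) : o < a := by
  have := h.front
  unfold frontVal at this
  rwa [ho] at this

theorem LoopPre.one_le_card {n j a b : ℕ} {s : GenState} (h : LoopPre n j a b s) :
    1 ≤ (openNodes (frontVal s) a).card :=
  Finset.card_pos.2 ⟨j, mem_openNodes.2 ⟨⟨h.one_le, h.lt⟩, h.front⟩⟩

theorem LoopPre.card_le {n j a b : ℕ} {s : GenState} (h : LoopPre n j a b s) :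
    (openNodes (frontVal s) a).card ≤ n := by
  refine (Finset.card_filter_le _ _).trans ?_
  rw [Nat.card_Ico]
  have := h.le
  have := h.le_n
  omega

/-- The last part gives the number of open nodes at the start of the next round, to which the
halving argument applies. -/
theorem LoopPre.select_spec {n j a b : ℕ} {s : GenState} (h : LoopPre n j a b s) {k : ℕ}
    (hk : k < gapCount (setKeys s.K) b - gapCount (setKeys s.K) a) :
    a ≤ selectNode s a k ∧ selectNode s a k < b ∧
      (openNodes (frontVal s) (selectNode s a k + 1)).card =
        (openNodes (frontVal s) a).card + k + 1 := by
  obtain ⟨h1, h2, h3⟩ := h.inv.selectNode_spec a k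
  have h4 : a ≤ selectNode s a k := by
    by_contra hc
    have := gapCount_lt h1 (not_le.1 hc) h2
    omega
  have h5 : selectNode s a k < b := by
    by_contra hc
    have := gapCount_mono (setKeys s.K) (not_lt.1 hc)
    omega
  have := h.le_n
  refine ⟨h4, h5, ?_⟩
  rw [h.inv.card_openNodes_eq h.closed h.lt (y := selectNode s a k + 1) (by omega) (by omega),
    gapCount_succ _ h1, if_neg h2, h3]
  omega

/-- The continuation of a round of the loop of `next-child` after the call of `toss`. -/
def loopStep (n c : ℕ) (nextRec : ℕ → Prog ℕ) (j b fuel a s h : ℕ) : Prog ℕ := do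
  if h = s then
    commitChild n nextRec j b
  else
    let x ← selectCompl a h
    if (← readArr GenState.u x).isNone then
      let _ ← assign n x j
      commitChild n nextRec j x
    else
      nextChildLoop n c nextRec j b fuel (x + 1)

theorem nextChildLoop_succ (n c : ℕ) (nextRec : ℕ → Prog ℕ) (j b fuel a : ℕ) :
    nextChildLoop n c nextRec j b (fuel + 1) a = (do
      charge 1
      let s ← countCompl a b
      let ξ ← phi n a
      let h ← toss n c ξ (s + 1)
      loopStep n c nextRec j b fuel a s h) := by
  simp only [nextChildLoop, loopStep, assign, bind_assoc, pure_bind]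

/-- The probability that more than `R` rounds are needed, up to the number of potential parents. -/
def roundTail (n R fuel : ℕ) : ℝ≥0∞ := if R < fuel then ((n + 1 : ℕ) : ℝ≥0∞) * 2⁻¹ ^ R else 0

theorem roundTail_succ (n R fuel : ℕ) :
    roundTail n (R + 1) (fuel + 1) = roundTail n R fuel * 2⁻¹ := by
  unfold roundTail
  simp only [Nat.add_lt_add_iff_right]
  split_ifs
  · rw [pow_succ, mul_assoc]
  · simp

/-- The time of one round of the loop of `next-child`. -/
def roundTime (n Tt : ℕ) : ℕ := Tt + (opCost (n + 2) * opCost (n + 2) + 6 * opCost (n + 2) + 1)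

/-- What is shown about the loop of `next-child`. -/
def LoopSpec (n c : ℕ) (nextRec : ℕ → Prog ℕ) (j b fuel Tt Bt : ℕ) (p ε : ℝ≥0∞)
    (T B S D : ℕ) : Prop :=
  ∀ (R a : ℕ) (m : Mach), LoopPre n j a b m.gen → b + 1 ≤ a + fuel →
    Spec n (nextChildLoop n c nextRec j b fuel a) m
      (R * p + roundTail n R fuel * ((openNodes (frontVal m.gen) a).card : ℝ≥0∞)⁻¹ + ε)
      (fun X g => pot X g (parentFn m.gen) (update (frontVal m.gen) j (a - 1)))
      (fun x m' => ChildFound n j a m.gen x m'.gen)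
      (fun x m' => Cost n m m' (R * roundTime n Tt + 17 * opCost (n + 2) + T) (R * Bt + 1 + B)
        (10 + S) ∨ (x ≤ n ∧ DownPath (parentFn m'.gen) D x))

/-- The rank returned by the toss is fixed here. It ends the loop at `b`, or at a vertex whose
parent was unknown, or else leads to a new round beyond a vertex with known parent; only the last
case uses the remaining `R` rounds. The final 17 and 10 come from `assign` followed by
`commitChild`. -/
theorem loopStep_spec {n c : ℕ} {nextRec : ℕ → Prog ℕ} {j b fuel Tt Bt : ℕ} {p ε : ℝ≥0∞}
    {T B S D : ℕ} (ih : LoopSpec n c nextRec j b fuel Tt Bt p ε T B S D)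
    (hrec : ∀ x, j < x → x ≤ n → RecSpec n nextRec x ε T B S D) {a s : ℕ} {m : Mach}
    (h : LoopPre n j a b m.gen) (hf : b ≤ a + fuel)
    (hs : s = gapCount (setKeys m.gen.K) b - gapCount (setKeys m.gen.K) a) (R k : ℕ) (hk : k ≤ s) :
    Spec n (loopStep n c nextRec j b fuel a s k) m
      (R * p + roundTail n R fuel * (if k < s then
        (((openNodes (frontVal m.gen) a).card + k + 1 : ℕ) : ℝ≥0∞)⁻¹ else 0) + ε)
      (fun X g => if k < s then
          let x := selectNode m.gen a k
          pot X g (if parentFn m.gen x = none then update (parentFn m.gen) x (some j)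
            else parentFn m.gen) (update (frontVal m.gen) j x)
        else pot X g (parentFn m.gen) (update (frontVal m.gen) j b))
      (fun x m' => ChildFound n j a m.gen x m'.gen)
      (fun x m' => Cost n m m' (opCost (n + 2) * opCost (n + 2) + 2 * opCost (n + 2) +
          (R * roundTime n Tt + 17 * opCost (n + 2) + T)) (R * Bt + 1 + B)
        (10 + S) ∨ (x ≤ n ∧ DownPath (parentFn m'.gen) D x)) := by
  have hja := h.lt
  have hab := h.le
  have hbn := h.le_n
  unfold loopStep
  by_cases hks : k = s
  · subst hks
    simp only [lt_irrefl, if_false, if_true]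
    have hmove : CanMove n j b m.gen :=
      ⟨h.inv, by omega, hbn, fun o ho => (h.front_lt o ho).trans_le hab, h.u_j, h.u_b⟩
    refine (commitChild_spec (hrec b hmove.lt) hmove h.closed).mono le_add_self
      (fun _ _ => le_rfl) ?_ ?_
    · rintro x m' ⟨rfl, h1, h2⟩
      exact ⟨h1, hab, hbn, fun hb => (h1.ext.u _ _ (h.u_b hb)).1, h2⟩
    · rintro x m' ⟨rfl, h1, h2⟩ hc
      exact hc.imp (fun hc => hc.mono (by omega) (by omega) (by omega)) id
  · have hlt : k < s := by omega
    simp only [if_pos hlt, if_neg hks]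
    obtain ⟨h1, h2, h3⟩ := h.select_spec (hs ▸ hlt)
    set x := selectNode m.gen a k with hx
    obtain ⟨t, ht, htt⟩ := selectCompl_run (n := n) (a := a) (h := k) (m := m) h.inv
    have hcu := h.inv.cost_u
    by_cases hux : m.gen.u[x]? = none
    · refine Spec.of_run (P' := assign n x j >>= fun _ => commitChild n nextRec j x)
        (m' := { m with time := t + mapCost m.gen.u }) ?_ ?_
      · rw [bind_run_of_run ht, ← hx, bind_run_of_run (readArr_run _ _ _),
          if_pos ((opt_isNone_iff _).2 hux)]
      · refine Spec.bind_always (assign_always (by exact h.inv) hux (by omega) h.one_le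
          (by omega)) ?_
        rintro f m1 ⟨hA, hc1⟩
        have hext := hA.ext hux
        have hmove : CanMove n j x m1.gen := by
          refine ⟨hA.inv, by omega, by omega, ?_, ?_, ?_⟩
          · intro o ho
            rw [hA.front] at ho
            exact (h.front_lt o ho).trans_le h1
          · obtain ⟨q, hq⟩ := Option.isSome_iff_exists.1 h.u_j
            rw [(hext.u j q hq).1]; rfl
          · intro _
            rw [hA.u, getElem?_insert_nat, if_pos rfl]
        refine (commitChild_spec (hrec x hmove.lt) hmove
          (FrontClosed.congr h.closed hA.front hA.frontInv)).mono le_add_self ?_ ?_ ?_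
        · intro X g
          have e1 : parentFn m.gen x = none := hux
          have e2 : parentFn m1.gen = update (parentFn m.gen) x (some j) := by
            funext i
            unfold parentFn
            rw [hA.u, getElem?_insert_nat, Function.update_apply]
            simp only [eq_comm]
          have e3 : frontVal m1.gen = frontVal m.gen := by
            funext i
            unfold frontVal
            rw [hA.front]
          rw [if_pos e1, e2, e3]
        · rintro y m' ⟨rfl, h4, h5⟩
          exact ⟨⟨h4.inv, hext.trans h4.ext, h4.closed⟩, h1, by omega,
            fun hb => (h4.ext.u _ _ (hmove.u_eq hb)).1, h5⟩
        · rintro y m' ⟨rfl, h4, h5⟩ hc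
          refine hc.imp (fun hc => ?_) id
          obtain ⟨c1, c2, c3⟩ := hc1.trans hc
          dsimp only at c1 c2 c3
          constructor <;> omega
    · refine Spec.of_run (P' := nextChildLoop n c nextRec j b fuel (x + 1))
        (m' := { m with time := t + mapCost m.gen.u }) ?_ ?_
      · rw [bind_run_of_run ht, ← hx, bind_run_of_run (readArr_run _ _ _),
          if_neg (fun hc => hux ((opt_isNone_iff _).1 hc))]
      · refine (ih R (x + 1) { m with time := t + mapCost m.gen.u }
          ⟨h.inv, h.closed, h.one_le, by omega, by omega, hbn, h.u_b, h.u_j,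
            h.front.trans_le (by omega)⟩ (by omega)).mono ?_ ?_ ?_ ?_
        · dsimp only
          rw [h3]
        · intro X g
          have e1 : parentFn m.gen x ≠ none := hux
          rw [if_neg e1, Nat.add_sub_cancel]
        · rintro y m' h4
          exact ⟨h4.steady, by have := h4.le; omega, h4.le_n, h4.u, h4.front⟩
        · rintro y m' - hc
          refine hc.imp (fun hc => ?_) id
          obtain ⟨c1, c2, c3⟩ := hc
          dsimp only at c1 c2 c3
          constructor <;> omega

/-- The failure bound is inductive because it contains the inverse number of open nodes at `a`: each
round halves it in expectation, and the tail halves when the permitted number of rounds grows by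
one. If `R` is at least the fuel, the tail vanishes, since `a` moves up in every round. -/
theorem nextChildLoop_spec {n c : ℕ} {nextRec : ℕ → Prog ℕ} {j b Tt Bt : ℕ} {p ε : ℝ≥0∞}
    {T B S D : ℕ} (htoss : TossBound n c Tt Bt p)
    (hrec : ∀ x, j < x → x ≤ n → RecSpec n nextRec x ε T B S D) (fuel : ℕ) :
    LoopSpec n c nextRec j b fuel Tt Bt p ε T B S D := by
  induction fuel with
  | zero =>
    intro R a m h hf
    have := h.le
    omega
  | succ fuel ih =>
    intro R a m h hf
    have hab := h.le
    have hbn := h.le_n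
    have hn : 1 ≤ n := by
      have := h.one_le
      have := h.lt
      omega
    obtain ⟨t1, ht1, htt1⟩ := countCompl_run (m := { m with time := m.time + 1 })
      (n := n) (a := a) (b := b) h.inv (by have := h.lt; omega) hab
    obtain ⟨t2, ht2, htt2⟩ := phi_run (m := { m with time := t1 }) (n := n) (a := a) h.inv
    dsimp only at ht1 htt1 ht2 htt2
    obtain ⟨s, hs⟩ : ∃ s, s = gapCount (setKeys m.gen.K) b - gapCount (setKeys m.gen.K) a :=
      ⟨_, rfl⟩
    obtain ⟨ξ, hξ⟩ : ∃ ξ, ξ = (openNodes (frontVal m.gen) a).card := ⟨_, rfl⟩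
    have hξ1 : 1 ≤ ξ := hξ ▸ h.one_le_card
    have hξn : ξ ≤ n := hξ ▸ h.card_le
    have hsn : s ≤ n := by
      have := gapCount_le (setKeys m.gen.K) b
      omega
    rw [← hs] at ht1
    rw [← hξ] at ht2
    refine Spec.of_run (P' := toss n c ξ (s + 1) >>= loopStep n c nextRec j b fuel a s)
      (m' := { m with time := t2 }) ?_ ?_
    · rw [nextChildLoop_succ, bind_run_of_run (charge_run _ _), bind_run_of_run ht1,
        bind_run_of_run ht2]
    rw [← hξ]
    set m2 : Mach := { m with time := t2 } with hm2
    have htoss1 := toss_always n c ξ (s + 1) hn hξ1 (by omega) m2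
    have hstep : ∀ (R k : ℕ) (m' : Mach), k ≤ s → m'.gen = m.gen → _ := fun R k m' hk hm' =>
      loopStep_spec ih hrec (a := a) (s := s) (m := m') (hm' ▸ h) (by omega) (hm' ▸ hs) R k hk
    refine ⟨?_, ?_, ?_⟩
    · refine htoss1.bind ?_
      rintro k m' ⟨hk, hm', -⟩
      have := (hstep 0 k m' hk hm').supp
      rwa [hm'] at this
    · rcases R with _ | R
      -- With no round permitted the bound is at least 1, as there are at most `n` open nodes.
      · refine le_trans (wp_le_of_always fun _ _ _ => ind_le_one _) ?_
        refine le_trans ?_ le_self_add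
        refine le_trans ?_ le_add_self
        rw [roundTail, if_pos (by omega), pow_zero, mul_one, ← div_eq_mul_inv]
        rw [ENNReal.le_div_iff_mul_le (Or.inl (by exact_mod_cast (by omega : ξ ≠ 0)))
          (Or.inl (ENNReal.natCast_ne_top _)), one_mul]
        exact_mod_cast (by omega : ξ ≤ n + 1)
      · rw [wp_bind]
        -- Either the toss exceeds its own budget, which costs `p`, or the round continues within
        -- it. The inverse at the next start is averaged over the rank by `seqE_inv_le`.
        refine le_trans (wp_mono (g := fun r => ind (¬(r.2.time ≤ m2.time + Tt ∧
          r.2.bits ≤ m2.bits + Bt)) + ((R * p + ε) + roundTail n R fuel *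
            (if r.1 < s then ((ξ + r.1 + 1 : ℕ) : ℝ≥0∞)⁻¹ else 0))) ?_) ?_
        · intro k m' hp
          obtain ⟨hk, hm', -⟩ := htoss1 k m' hp
          dsimp only
          by_cases hc : m'.time ≤ m2.time + Tt ∧ m'.bits ≤ m2.bits + Bt
          · refine le_trans ?_ le_add_self
            have h1 := (hstep R k m' hk hm').cost
            rw [hm', ← hξ] at h1
            refine le_trans (wp_mono fun x m'' _ => ind_mono ?_) (h1.trans_eq (add_right_comm _ _ _))
            intro h2 h3
            refine h2 (h3.imp (fun h3 => ?_) id)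
            obtain ⟨c1, c2, c3⟩ := h3
            rw [hm'] at c3
            have e1 : (R + 1) * roundTime n Tt = R * roundTime n Tt + roundTime n Tt := by ring
            have e2 : (R + 1) * Bt = R * Bt + Bt := by ring
            have e3 : roundTime n Tt =
              Tt + (opCost (n + 2) * opCost (n + 2) + 6 * opCost (n + 2) + 1) := rfl
            dsimp only [m2] at hc
            constructor
            · omega
            · omega
            · exact c3
          · rw [ind_of_true hc]
            exact (wp_le_of_always fun _ _ _ => ind_le_one _).trans le_self_add
        · rw [wp_add, wp_add, wp_const, wp_const_mul]
          have h1 := htoss ξ (s + 1) m2 hξ1 hξn (by omega) (by omega)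
          have h2 := toss_wp_rank n c ξ (s + 1) hn hξ1 (by omega) m2
            (fun k => if k < s then ((ξ + k + 1 : ℕ) : ℝ≥0∞)⁻¹ else 0)
          rw [h2, Nat.add_sub_cancel]
          have h3 := seqE_inv_le (ξ := ξ) (s := s) hξ1 (r := s) (i := 0) rfl
          refine le_trans (add_le_add h1 (add_le_add le_rfl (mul_le_mul_right h3 _))) ?_
          rw [roundTail_succ, add_zero, mul_assoc]
          refine le_of_eq ?_
          push_cast
          ring
    · intro X g hX
      rw [wp_bind]
      obtain ⟨f, hf⟩ : ∃ f : ℕ → ℝ≥0∞, ∀ k, f k = if k < s then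
          let x := selectNode m.gen a k
          pot X g (if parentFn m.gen x = none then update (parentFn m.gen) x (some j)
            else parentFn m.gen) (update (frontVal m.gen) j x)
        else pot X g (parentFn m.gen) (update (frontVal m.gen) j b) := ⟨_, fun _ => rfl⟩
      refine le_trans (wp_mono (g := fun r => f r.1) ?_) ?_
      · intro k m' hp
        obtain ⟨hk, hm', -⟩ := htoss1 k m' hp
        have h1 := (hstep 0 k m' hk hm').mart X g hX
        dsimp only
        rw [hf]
        rwa [hm'] at h1
      · rw [toss_wp_rank n c ξ (s + 1) hn hξ1 (by omega) m2, Nat.add_sub_cancel, hs, hξ]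
        refine h.inv.seqE_le_pot h.one_le h.closed h.lt hab hbn h.u_b h.front hX g f ?_ ?_
        · intro x hax hxb hxK
          have h1 := gapCount_lt (by have := h.lt; omega) hxb hxK
          have h2 := gapCount_mono (setKeys m.gen.K) hax
          have h3 := h.inv.selectNode_spec a
            (gapCount (setKeys m.gen.K) x - gapCount (setKeys m.gen.K) a)
          have h4 : selectNode m.gen a
              (gapCount (setKeys m.gen.K) x - gapCount (setKeys m.gen.K) a) = x :=
            gapCount_inj h3.1 (by have := h.lt; omega) h3.2.1 hxK (by omega)
          rw [hf, if_pos (by omega), h4]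
        · rw [hf, if_neg (by omega)]

end

open scoped ENNReal
open Function (update)

noncomputable section

/-! ## The procedure `next-child` -/

/-- The outcome `x` of `next-child(j)`. -/
structure NextFound (n j : ℕ) (s : GenState) (x : ℕ) (s' : GenState) : Prop where
  steady : Steady n s s'
  lt : j < x
  front_lt : x ≤ n → (s.front[j]?).getD j < x
  le_n : x ≤ n + 1
  u : x ≤ n → s'.u[x]? = some j
  front : x ≤ n → ∃ y, s'.front[j]? = some y ∧ x ≤ y

/-- The failure probability of one level of the recursion of `next-child` with at most `R` rounds
of its loop. -/
def levelFail (n R : ℕ) (p : ℝ≥0∞) : ℝ≥0∞ := R * p + roundTail n R (n + 1)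

/-- The time of one level of the recursion of `next-child`. -/
def levelTime (n R Tt : ℕ) : ℕ := R * roundTime n Tt + 31 * opCost (n + 2)

/-- The random bits of one level of the recursion of `next-child`. -/
def levelBits (n R Bt : ℕ) : ℕ := R * Bt + 1 + opCost (n + 2)

/-- What is shown about `next-child(j)`, with a bound `D` on the depth of the recursion. -/
def NextSpec (n c R Tt Bt : ℕ) (p : ℝ≥0∞) (fuel D j : ℕ) : Prop :=
  ∀ m : Mach, Consistent n m.gen → FrontClosed m.gen j →
    Spec n (nextChild n c fuel j) m (D * levelFail n R p) (fun X g => genPot X g m.gen)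
      (fun x m' => NextFound n j m.gen x m'.gen)
      (fun _ m' => Cost n m m' (D * levelTime n R Tt) (D * levelBits n R Bt) (D * 18) ∨
        DownPath (parentFn m'.gen) D j)

/-- A front that is still nil may be placed at `j` itself: only nodes above `j` can see `j`. This
matches the initial value `k + 1` of the loop. -/
theorem pot_update_front (X : Finset ℕ) (g : ℕ → ℕ) (s : GenState) (j : ℕ) :
    pot X g (parentFn s) (update (frontVal s) j ((s.front[j]?).getD j)) = genPot X g s := by
  refine pot_congr (fun _ _ => rfl) fun x _ _ => ?_
  ext i
  rw [mem_openNodes, mem_openNodes]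
  by_cases hi : i = j
  · subst hi
    rw [Function.update_self]
    unfold frontVal
    rcases s.front[i]? with _ | f
    · simp only [Option.getD_none]; omega
    · rfl
  · rw [Function.update_of_ne hi]

/-- A level of the recursion adds one edge to the descending path: if the call for the child `x`
exceeds its bounds because of a path of length `D` from `x`, prepending the edge to `j` gives one of
length `D + 1`. -/
theorem nextChild_succ_spec {n c R Tt Bt : ℕ} {p : ℝ≥0∞} (htoss : TossBound n c Tt Bt p)
    {fuel D j : ℕ} (h1 : 1 ≤ j) (h2 : j ≤ n)
    (ih : ∀ x, j < x → x ≤ n → NextSpec n c R Tt Bt p fuel D x) :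
    NextSpec n c R Tt Bt p (fuel + 1) (D + 1) j := by
  intro m h hcl
  have hO := opCost_pos (n + 2)
  refine Spec.of_run (P' := do
      let _ ← parentQuery n j
      let fr ← readArr GenState.front j
      if n ≤ fr.getD 0 then
        return n + 1
      else
        let k := fr.getD j
        let b ← childSucc n j k
        nextChildLoop n c (nextChild n c fuel) j b (n + 1) (k + 1))
    (m' := { m with time := m.time + 1 }) ?_ ?_
  · rw [nextChild, bind_run_of_run (charge_run _ _)]
  have eT : (D + 1) * levelTime n R Tt = D * levelTime n R Tt + levelTime n R Tt := by ring
  have eB : (D + 1) * levelBits n R Bt = D * levelBits n R Bt + levelBits n R Bt := by ring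
  have eT' : levelTime n R Tt = R * roundTime n Tt + 31 * opCost (n + 2) := rfl
  have eB' : levelBits n R Bt = R * Bt + 1 + opCost (n + 2) := rfl
  have hε : (0 : ℝ≥0∞) + (((D + 1 : ℕ) : ℝ≥0∞) * levelFail n R p) =
      ((D + 1 : ℕ) : ℝ≥0∞) * levelFail n R p := zero_add _
  rw [← hε]
  refine (parentQuery_spec (m := { m with time := m.time + 1 }) h h1 h2).bind
    (C2 := fun _ m1 x m' => Cost n m1 m' (D * levelTime n R Tt + (R * roundTime n Tt +
      21 * opCost (n + 2))) (D * levelBits n R Bt + (R * Bt + 1)) (D * 18 + 12) ∨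
        DownPath (parentFn m'.gen) (D + 1) j) ?_ ?_
  · rintro r m1 hP
    have hcf := hP.inv.cost_front
    have hcl1 : FrontClosed m1.gen j := hcl.congr hP.front hP.frontInv
    have hfr : m1.gen.front[j]? = m.gen.front[j]? := by rw [hP.front]
    by_cases hk : n ≤ (m1.gen.front[j]?).getD 0
    · refine Spec.of_run (P' := pure (n + 1))
        (m' := { m1 with time := m1.time + mapCost m1.gen.front }) ?_ ?_
      · rw [bind_run_of_run (readArr_run _ _ _), if_pos hk]
      · refine Spec.pure ⟨⟨hP.inv, hP.ext, ?_⟩, by omega, fun h => by omega, le_rfl,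
          fun h => by omega, fun h => by omega⟩ (Or.inl ⟨?_, ?_, ?_⟩) (fun _ _ _ => le_rfl)
        · refine hcl1.zero_of_isSome hP.inv fun _ => ?_
          rcases hf : m1.gen.front[j]? with _ | f
          · rw [hf, Option.getD_none] at hk; omega
          · rfl
        · dsimp only; omega
        · dsimp only; omega
        · dsimp only; omega
    · set k := (m1.gen.front[j]?).getD j with hkdef
      have hkn : k ≤ n ∧ j ≤ k ∧ frontVal m1.gen j < k + 1 := by
        unfold frontVal
        rcases hf : m1.gen.front[j]? with _ | f
        · rw [hf, Option.getD_none] at hkdef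
          simp only [Option.getD_none]
          omega
        · rw [hf, Option.getD_some] at hkdef
          rw [hf, Option.getD_some] at hk
          simp only [Option.getD_some]
          have := (hP.inv.front_spec j f hf).1
          omega
      obtain ⟨b, t, ch, hr, hI, hkb, hbn, hub, ht, hsp⟩ := childSucc_run
        (m := { m1 with time := m1.time + mapCost m1.gen.front }) hP.inv h1 h2 hkn.1
      refine Spec.of_run (P' := nextChildLoop n c (nextChild n c fuel) j b (n + 1) (k + 1))
        (m' := { gen := { m1.gen with child := ch }, time := t, bits := m1.bits }) ?_ ?_
      · rw [bind_run_of_run (readArr_run _ _ _), if_neg hk]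
        dsimp only
        rw [bind_run_of_run hr]
      · refine (nextChildLoop_spec htoss (T := D * levelTime n R Tt) (B := D * levelBits n R Bt)
          (S := D * 18) (D := D) (ε := D * levelFail n R p) ?_ (n + 1) R (k + 1)
          { gen := { m1.gen with child := ch }, time := t, bits := m1.bits }
          ⟨hI, hcl1, h1, by omega, hkb, hbn, hub, ?_, hkn.2.2⟩ (by omega)).mono ?_ ?_ ?_ ?_
        · intro x hjx hxn m' hI' hcl' _ _
          exact (ih x hjx hxn m' hI' hcl').mono le_rfl (fun _ _ => le_rfl) (fun _ _ h => h.steady)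
            (fun _ _ _ h => h)
        · dsimp only
          rw [hP.u]; rfl
        -- The inverse number of open nodes in the tail is bounded by 1, because `j` itself is open
        -- at `k + 1`.
        · refine le_trans (add_le_add (b := levelFail n R p) ?_ le_rfl) (le_of_eq ?_)
          rotate_left
          · push_cast; ring
          unfold levelFail
          refine add_le_add le_rfl ?_
          calc _ ≤ roundTail n R (n + 1) * 1 := by
                refine mul_le_mul_right ?_ _
                rw [ENNReal.inv_le_one]
                exact_mod_cast Finset.card_pos.2 ⟨j, mem_openNodes.2 ⟨⟨h1, by omega⟩, hkn.2.2⟩⟩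
            _ = _ := mul_one _
        · intro X g
          exact (pot_update_front X g m1.gen j).le
        · rintro x m' hx
          have hle := hx.le
          refine ⟨⟨hx.steady.inv, hP.ext.trans ⟨hx.steady.ext.u, hx.steady.ext.front,
            hx.steady.ext.heap, hx.steady.ext.queried⟩, hx.steady.closed⟩, by omega, fun _ => ?_,
            hx.le_n, hx.u, fun _ => hx.front⟩
          rw [← hfr, ← hkdef]
          omega
        · rintro x m' hx hc
          refine hc.imp (fun hc => ?_) fun hc => ?_
          · obtain ⟨c1, c2, c3⟩ := hc
            dsimp only at c1 c2 c3 ht hsp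
            constructor <;> omega
          · exact ⟨x, by have := hx.le; omega, hx.u hc.1, hc.2⟩
  · rintro r m1 x m' hP - - hc
    refine hc.imp (fun hc => ?_) id
    obtain ⟨c1, c2, c3⟩ := hP.cost
    obtain ⟨c4, c5, c6⟩ := hc
    dsimp only at c1 c2 c3
    constructor <;> omega

/-- The fuel suffices because the recursion goes to larger nodes. The bound `D` is independent of
the fuel; for `D = 0` the cost claim is void, since a path of length 0 always exists. -/
theorem nextChild_spec {n c R Tt Bt : ℕ} {p : ℝ≥0∞} (htoss : TossBound n c Tt Bt p) (fuel : ℕ) :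
    ∀ D j, 1 ≤ j → j ≤ n → n < j + fuel → NextSpec n c R Tt Bt p fuel D j := by
  induction fuel with
  | zero => intro D j h1 h2 h3; omega
  | succ fuel ih =>
    have hstep : ∀ D j, 1 ≤ j → j ≤ n → n < j + (fuel + 1) →
        NextSpec n c R Tt Bt p (fuel + 1) (D + 1) j := fun D j h1 h2 h3 =>
      nextChild_succ_spec htoss h1 h2 fun x hx hxn => ih D x (by omega) hxn (by omega)
    rintro (_ | D) j h1 h2 h3
    · intro m h hcl
      have := hstep 0 j h1 h2 h3 m h hcl
      refine ⟨this.supp, ?_, this.mart⟩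
      exact wp_le_of_always fun _ _ _ => by
        refine (ind_of_false fun hn => hn (Or.inr ?_)).trans_le zero_le
        trivial
    · exact hstep D j h1 h2 h3

/-! ## The procedures `next-child-from` and `next-child-tp` -/

/-- The outcome `x` of a search for a child of `j` that is larger than `k`. -/
structure ChildAfter (n j k : ℕ) (s : GenState) (x : ℕ) (s' : GenState) : Prop where
  steady : Steady n s s'
  lt : k < x
  le_n : x ≤ n + 1
  u : x ≤ n → s'.u[x]? = some j
  front : x ≤ n → ∃ y, s'.front[j]? = some y ∧ x ≤ y

/-- The condition that `k` is `j` or at most the front of `j` ensures that the child produced by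
`next-child`, which lies beyond the front, also lies beyond `k`. -/
theorem nextChildFrom_spec {n c R Tt Bt : ℕ} {p : ℝ≥0∞} (htoss : TossBound n c Tt Bt p) (D : ℕ)
    {j k : ℕ} (h1 : 1 ≤ j) (h2 : j ≤ n) {m : Mach} (h : Consistent n m.gen)
    (hcl : FrontClosed m.gen 0) (hkn : k ≤ n) (hk : k = j ∨ k ≤ frontVal m.gen j) :
    Spec n (nextChildFrom n c j k) m (D * levelFail n R p) (fun X g => genPot X g m.gen)
      (fun x m' => ChildAfter n j k m.gen x m'.gen)
      (fun _ m' => Cost n m m' (D * levelTime n R Tt + 5 * opCost (n + 2)) (D * levelBits n R Bt)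
        (D * 18 + 2) ∨ DownPath (parentFn m'.gen) D j) := by
  have hO := opCost_pos (n + 2)
  by_cases hkn' : n ≤ k
  · refine Spec.of_run (P' := pure (n + 1)) (m' := { m with time := m.time + 1 }) ?_ ?_
    · unfold nextChildFrom
      rw [bind_run_of_run (charge_run _ _), if_pos hkn']
    · refine Spec.pure ⟨⟨h, Extends.refl _, hcl⟩, by omega, by omega, fun _ => by omega,
        fun _ => by omega⟩ (Or.inl ⟨?_, ?_, ?_⟩) fun _ _ _ => le_rfl
      · dsimp only; omega
      · dsimp only; omega
      · dsimp only; omega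
  obtain ⟨q, t, ch, hr, hI, hkq, hqn, huq, ht, hsp⟩ := childSucc_run
    (m := { m with time := m.time + 1 }) h h1 h2 hkn
  dsimp only at hr hI huq ht hsp
  have hcf := h.cost_front
  set m1 : Mach := { gen := { m.gen with child := ch }, time := t + mapCost m.gen.front,
                     bits := m.bits } with hm1
  have hrun : nextChildFrom n c j k m = (match m.gen.front[j]? with
      | some f => if q ≤ f then pure q else nextChild n c (n + 1) j
      | none => nextChild n c (n + 1) j : Prog ℕ) m1 := by
    unfold nextChildFrom
    rw [bind_run_of_run (charge_run _ _), if_neg hkn', bind_run_of_run hr,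
      bind_run_of_run (readArr_run _ _ _)]
  by_cases hq : ∃ f, m.gen.front[j]? = some f ∧ q ≤ f
  · obtain ⟨f, hf, hqf⟩ := hq
    refine Spec.of_run (P' := pure q) (m' := m1) ?_ ?_
    · rw [hrun, hf]
      dsimp only
      rw [if_pos hqf]
    · refine Spec.pure ⟨⟨hI, ⟨fun _ _ h => ⟨h, rfl⟩, fun _ x h => ⟨x, h, le_rfl⟩, rfl, rfl⟩, hcl⟩,
        hkq, hqn, huq, fun _ => ⟨f, hf, hqf⟩⟩ (Or.inl ⟨?_, ?_, ?_⟩) fun _ _ _ => le_rfl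
      · dsimp only [m1]; omega
      · dsimp only [m1]; omega
      · dsimp only [m1]; omega
  · refine Spec.of_run (P' := nextChild n c (n + 1) j) (m' := m1) ?_ ?_
    · rw [hrun]
      rcases hf : m.gen.front[j]? with _ | f
      · rfl
      · dsimp only
        rw [if_neg fun hqf => hq ⟨f, hf, hqf⟩]
    · refine (nextChild_spec htoss (n + 1) D j h1 h2 (by omega) m1 hI
        (FrontClosed.of_zero h hcl j)).mono le_rfl (fun _ _ => le_rfl) ?_ ?_
      · rintro x m' hx
        refine ⟨⟨hx.steady.inv, ⟨hx.steady.ext.u, hx.steady.ext.front, hx.steady.ext.heap,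
          hx.steady.ext.queried⟩, hx.steady.closed⟩, ?_, hx.le_n, hx.u, hx.front⟩
        by_cases hxn : x ≤ n
        · refine lt_of_le_of_lt ?_ (hx.front_lt hxn)
          dsimp only [m1]
          unfold frontVal at hk
          rcases hf : m.gen.front[j]? with _ | f
          · rw [hf] at hk
            simp only [Option.getD_none] at hk ⊢
            omega
          · rw [hf] at hk
            have := (h.front_spec j f hf).1
            simp only [Option.getD_some] at hk ⊢
            omega
        · omega
      · rintro x m' hx hc
        refine hc.imp (fun hc => ?_) id
        obtain ⟨c1, c2, c3⟩ := hc
        dsimp only [m1] at c1 c2 c3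
        constructor <;> omega

end

/-! ### Stars and ascending paths in the tree of parents -/

open scoped ENNReal

noncomputable section

/-- `j` has at least `I` children larger than `k`. -/
def ManyChildren (U : ℕ → Option ℕ) (I j k : ℕ) : Prop :=
  ∃ A : Finset ℕ, A.card = I ∧ ∀ x ∈ A, k < x ∧ U x = some j

/-- There is a path of length `I` that starts in `j` and ascends in the tree of parents. -/
def UpPath (U : ℕ → Option ℕ) : ℕ → ℕ → Prop
  | 0, _ => True
  | I + 1, j => 2 ≤ j ∧ ∃ p, U j = some p ∧ UpPath U I p

theorem DownPath.mono {U U' : ℕ → Option ℕ} (hU : ∀ x p, U x = some p → U' x = some p) {D j : ℕ}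
    (h : DownPath U D j) : DownPath U' D j := by
  induction D generalizing j with
  | zero => trivial
  | succ D ih =>
    obtain ⟨x, h1, h2, h3⟩ := h
    exact ⟨x, h1, hU _ _ h2, ih h3⟩

theorem ManyChildren.mono {U U' : ℕ → Option ℕ} (hU : ∀ x p, U x = some p → U' x = some p)
    {I j k : ℕ} (h : ManyChildren U I j k) : ManyChildren U' I j k := by
  obtain ⟨A, h1, h2⟩ := h
  exact ⟨A, h1, fun x hx => ⟨(h2 x hx).1, hU _ _ (h2 x hx).2⟩⟩

theorem UpPath.mono {U U' : ℕ → Option ℕ} (hU : ∀ x p, U x = some p → U' x = some p) {I j : ℕ}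
    (h : UpPath U I j) : UpPath U' I j := by
  induction I generalizing j with
  | zero => trivial
  | succ I ih =>
    obtain ⟨h1, p, h2, h3⟩ := h
    exact ⟨h1, p, hU _ _ h2, ih h3⟩

theorem Extends.parentFn {s s' : GenState} (h : Extends s s') (x p : ℕ)
    (hx : parentFn s x = some p) : parentFn s' x = some p := (h.u x p hx).1

theorem Steady.trans {n : ℕ} {s s' s'' : GenState} (h : Steady n s s') (h' : Steady n s' s'') :
    Steady n s s'' := ⟨h'.inv, h.ext.trans h'.ext, h'.closed⟩

/-- The outcome `x` of a search for a child of `j` with flag `ty` that is larger than `k`. -/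
structure TypedChildAfter (n j k : ℕ) (ty : PtrFlag) (s : GenState) (x : ℕ) (s' : GenState) :
    Prop extends ChildAfter n j k s x s' where
  type : x ≤ n → s'.type[x]? = some ty

theorem Spec.of_trivial_cost {n : ℕ} {α : Type} {P : Prog α} {m : Mach} {ε ε' : ℝ≥0∞}
    {V : Finset ℕ → (ℕ → ℕ) → ℝ≥0∞} {Q C C' : α → Mach → Prop} (h : Spec n P m ε V Q C)
    (hC : ∀ a m', C' a m') : Spec n P m ε' V Q C' where
  supp := h.supp
  cost := wp_le_of_always fun a m' _ => (ind_of_false fun hn => hn (hC a m')).trans_le zero_le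
  mart := h.mart

/-- The time of one step of `next-child-tp`, with a bound `D` on the depth of the recursion. -/
def stepTime (n R Tt D : ℕ) : ℕ := D * levelTime n R Tt + 6 * opCost (n + 2)

/-- Every step that does not end the search has found one more child of `j`, so more than `I` steps
exhibit `I` children. No use is made of the flags being random. -/
theorem nextChildTp_spec {n c R Tt Bt : ℕ} {p : ℝ≥0∞} (htoss : TossBound n c Tt Bt p) (D : ℕ)
    {j : ℕ} (h1 : 1 ≤ j) (h2 : j ≤ n) (ty : PtrFlag) (fuel : ℕ) :
    ∀ (I k : ℕ) (m : Mach), Consistent n m.gen → FrontClosed m.gen 0 → k ≤ n →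
      (k = j ∨ k ≤ frontVal m.gen j) → n < k + fuel →
    Spec n (nextChildTp n c j ty fuel k) m (I * (D * levelFail n R p))
      (fun X g => genPot X g m.gen)
      (fun x m' => TypedChildAfter n j k ty m.gen x m'.gen)
      (fun _ m' => Cost n m m' (I * stepTime n R Tt D) (I * (D * levelBits n R Bt))
        (I * (D * 18 + 2)) ∨ DownPath (parentFn m'.gen) D j ∨
          ManyChildren (parentFn m'.gen) I j k) := by
  induction fuel with
  | zero => intro I k m _ _ _ _ _; omega
  | succ fuel ih =>
    intro I
    have hstep : ∀ (I k : ℕ) (m : Mach), Consistent n m.gen → FrontClosed m.gen 0 → k ≤ n →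
      (k = j ∨ k ≤ frontVal m.gen j) → n < k + (fuel + 1) →
      Spec n (nextChildTp n c j ty (fuel + 1) k) m ((I + 1 : ℕ) * (D * levelFail n R p))
      (fun X g => genPot X g m.gen)
      (fun x m' => TypedChildAfter n j k ty m.gen x m'.gen)
      (fun _ m' => Cost n m m' ((I + 1) * stepTime n R Tt D) ((I + 1) * (D * levelBits n R Bt))
        ((I + 1) * (D * 18 + 2)) ∨ DownPath (parentFn m'.gen) D j ∨
          ManyChildren (parentFn m'.gen) (I + 1) j k) := by
      intro I k m h hcl hkn hk hf
      have eT : stepTime n R Tt D = D * levelTime n R Tt + 6 * opCost (n + 2) := rfl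
      rw [Nat.cast_add, Nat.cast_one, add_mul, one_mul, add_comm (_ * _), add_mul, add_mul,
        add_mul, one_mul, one_mul, one_mul, nextChildTp]
      refine (nextChildFrom_spec htoss D h1 h2 h hcl hkn hk).bind
        (C2 := fun x m1 y m' => Extends m1.gen m'.gen ∧
          (Cost n m1 m' (opCost (n + 2) + I * stepTime n R Tt D)
          (I * (D * levelBits n R Bt)) (I * (D * 18 + 2)) ∨ DownPath (parentFn m'.gen) D j ∨
          ManyChildren (parentFn m'.gen) (I + 1) j k)) ?_ ?_
      · rintro x m1 hx
        have hct := hx.steady.inv.cost_type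
        by_cases hxn : x = n + 1
        · rw [if_pos hxn]
          refine Spec.pure ⟨hx, fun _ => by omega⟩ ⟨Extends.refl _, Or.inl ⟨?_, ?_, ?_⟩⟩ fun _ _ _ => le_rfl
          · omega
          · omega
          · omega
        rw [if_neg hxn]
        have hxn' : x ≤ n := by have := hx.le_n; omega
        by_cases hty : m1.gen.type[x]? = some ty
        · refine Spec.of_run (P' := pure x)
            (m' := { m1 with time := m1.time + mapCost m1.gen.type }) ?_ ?_
          · rw [bind_run_of_run (readArr_run _ _ _), if_pos hty]
          · refine Spec.pure ⟨hx, fun _ => hty⟩ ⟨Extends.refl _, Or.inl ⟨?_, ?_, ?_⟩⟩ fun _ _ _ => le_rfl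
            · dsimp only; omega
            · dsimp only; omega
            · dsimp only; omega
        · refine Spec.of_run (P' := nextChildTp n c j ty fuel x)
            (m' := { m1 with time := m1.time + mapCost m1.gen.type }) ?_ ?_
          · rw [bind_run_of_run (readArr_run _ _ _), if_neg hty]
          · obtain ⟨y, hy, hxy⟩ := hx.front hxn'
            have hlt := hx.lt
            refine (ih I x { m1 with time := m1.time + mapCost m1.gen.type } hx.steady.inv
              hx.steady.closed hxn' (Or.inr ?_) (by omega)).mono le_rfl (fun _ _ => le_rfl) ?_ ?_
            · unfold frontVal
              rw [hy]
              exact hxy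
            · intro z m' hz
              exact ⟨⟨hx.steady.trans hz.steady, hlt.trans hz.lt, hz.le_n, hz.u, hz.front⟩,
                hz.type⟩
            · rintro z m' hz hc
              refine ⟨hz.steady.ext, ?_⟩
              rcases hc with hc | hc | ⟨A, hA, hA'⟩
              · left
                obtain ⟨c1, c2, c3⟩ := hc
                dsimp only at c1 c2 c3
                constructor <;> omega
              · exact Or.inr (Or.inl hc)
              -- All children in `A` are larger than `x`, so `x` is new.
              · refine Or.inr (Or.inr ⟨insert x A, ?_, ?_⟩)
                · rw [Finset.card_insert_of_notMem, hA]
                  intro hxA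
                  exact lt_irrefl _ (hA' x hxA).1
                · intro w hw
                  rw [Finset.mem_insert] at hw
                  rcases hw with rfl | hw
                  · exact ⟨hlt, hz.steady.ext.parentFn _ _ (hx.u hxn')⟩
                  · exact ⟨hlt.trans (hA' w hw).1, (hA' w hw).2⟩
      · rintro x m1 y m' hx hc hy ⟨hext, hc'⟩
        rcases hc with hc | hc
        · refine hc'.imp (fun hc' => ?_) id
          obtain ⟨c1, c2, c3⟩ := hc
          obtain ⟨c4, c5, c6⟩ := hc'
          constructor <;> omega
        · exact Or.inr (Or.inl (hc.mono hext.parentFn))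
    rcases I with _ | I
    · intro k m h hcl hkn hk hf
      exact (hstep 0 k m h hcl hkn hk hf).of_trivial_cost fun _ m' =>
        Or.inr (Or.inr ⟨∅, rfl, by simp⟩)
    · exact hstep I

/-- Each continuation follows a recursive pointer, which starts at a node at least 2, so the steps
form a proper ascending path. -/
theorem baParent_spec {n : ℕ} (fuel : ℕ) : ∀ (I j : ℕ) (m : Mach), Consistent n m.gen →
    FrontClosed m.gen 0 → 1 ≤ j → j ≤ n →
    Spec n (baParent n fuel j) m 0 (fun X g => genPot X g m.gen)
      (fun _ m' => Steady n m.gen m'.gen)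
      (fun _ m' => Cost n m m' (I * (10 * opCost (n + 2))) (I * opCost (n + 2)) (I * 6) ∨
        UpPath (parentFn m'.gen) I j) := by
  induction fuel with
  | zero =>
    intro I j m h hcl h1 h2
    exact Spec.pure ⟨h, Extends.refl _, hcl⟩ (Or.inl ((Cost.refl n m).mono zero_le zero_le zero_le))
      fun _ _ _ => le_rfl
  | succ fuel ih =>
    have hO := opCost_pos (n + 2)
    have hstep : ∀ (I j : ℕ) (m : Mach), Consistent n m.gen →
        FrontClosed m.gen 0 → 1 ≤ j → j ≤ n →
        Spec n (baParent n (fuel + 1) j) m 0 (fun X g => genPot X g m.gen)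
          (fun _ m' => Steady n m.gen m'.gen)
          (fun _ m' => Cost n m m' ((I + 1) * (10 * opCost (n + 2))) ((I + 1) * opCost (n + 2))
            ((I + 1) * 6) ∨ UpPath (parentFn m'.gen) (I + 1) j) := by
      intro I j m h hcl h1 h2
      refine Spec.of_run (P' := parentQuery n j >>= fun p => match p.2 with
        | PtrFlag.dir => pure p.1
        | PtrFlag.recur => baParent n fuel p.1) (m' := { m with time := m.time + 1 }) ?_ ?_
      · rw [baParent, bind_run_of_run (charge_run _ _)]
      rw [← add_zero (0 : ℝ≥0∞), add_mul, add_mul, add_mul, one_mul, one_mul, one_mul]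
      refine (parentQuery_spec (m := { m with time := m.time + 1 }) h h1 h2).bind
        (C2 := fun _ m1 _ m' => Cost n m1 m' (I * (10 * opCost (n + 2))) (I * opCost (n + 2))
            (I * 6) ∨ UpPath (parentFn m'.gen) (I + 1) j) ?_ ?_
      · rintro ⟨q, f⟩ m1 hP
        have hcl1 : FrontClosed m1.gen 0 := hcl.congr hP.front hP.frontInv
        rcases f with _ | _
        · exact Spec.pure ⟨hP.inv, hP.ext, hcl1⟩
            (Or.inl ((Cost.refl n m1).mono zero_le zero_le zero_le)) fun _ _ _ => le_rfl
        · have h2j := hP.two_le rfl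
          have hu := hP.u
          have hq := hP.inv.u_range _ _ hu
          dsimp only at hu hq ⊢
          refine (ih I q m1 hP.inv hcl1 (by omega) (by omega)).mono le_rfl (fun _ _ => le_rfl)
            ?_ ?_
          · intro a m' hs
            exact ⟨hs.inv, hP.ext.trans hs.ext, hs.closed⟩
          · intro a m' hs hc
            exact hc.imp id fun hc => ⟨h2j, q, hs.ext.parentFn _ _ hu, hc⟩
      · rintro r m1 a m' hP - - hc
        refine hc.imp (fun hc => ?_) id
        obtain ⟨c1, c2, c3⟩ := hP.cost
        obtain ⟨c4, c5, c6⟩ := hc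
        dsimp only at c1 c2 c3
        constructor <;> omega
    intro I
    rcases I with _ | I
    · intro j m h hcl h1 h2
      exact (hstep 0 j m h hcl h1 h2).of_trivial_cost fun _ m' => Or.inr trivial
    · exact hstep I

end

open scoped ENNReal

noncomputable section

/-! ## The contents of the heaps -/

/-- The multiset of the items of `heap_i`. -/
def heapItems (s : GenState) (i : ℕ) : Multiset ℕ := (s.heap[i]?).elim 0 LHeap.items

/-- The stream of children to which `x` belongs: its parent and its flag. -/
def streamOf (s : GenState) (x : ℕ) : Option ℕ × Option PtrFlag := (s.u[x]?, s.type[x]?)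

/-- `x` is a possible item of `heap_j`, in a stream whose node is `j` or smaller than `q`. -/
structure ItemOK (n j m q : ℕ) (s : GenState) (x : ℕ) : Prop where
  lt : m < x
  le : x ≤ n + 1
  stream : x ≤ n → ∃ (p : ℕ) (f : PtrFlag), s.u[x]? = some p ∧ s.type[x]? = some f ∧
    (f = PtrFlag.dir → p = j) ∧ (f = PtrFlag.recur → p < q) ∧ x ≤ frontVal s p

/-- The contents `M` of `heap_j`: at most `b` items larger than `m`, in different streams. -/
structure ItemsOK (n j m q b : ℕ) (s : GenState) (M : Multiset ℕ) : Prop where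
  card : M.card ≤ b
  item : ∀ x ∈ M, ItemOK n j m q s x
  nodup : ((M.filter (· ≤ n)).map (streamOf s)).Nodup

theorem Extends.frontVal {s s' : GenState} (h : Extends s s') (i : ℕ) :
    frontVal s i ≤ frontVal s' i := by
  unfold _root_.frontVal
  rcases hi : s.front[i]? with _ | x
  · exact zero_le
  · obtain ⟨x', h1, h2⟩ := h.front i x hi
    rw [h1]
    exact h2

theorem ItemOK.extends {n j m q : ℕ} {s s' : GenState} {x : ℕ} (h : ItemOK n j m q s x)
    (hs : Extends s s') : ItemOK n j m q s' x where
  lt := h.lt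
  le := h.le
  stream hx := by
    obtain ⟨p, f, h1, h2, h3, h4, h5⟩ := h.stream hx
    obtain ⟨h6, h7⟩ := hs.u x p h1
    exact ⟨p, f, h6, h7.trans h2, h3, h4, h5.trans (hs.frontVal p)⟩

theorem ItemOK.streamOf_eq {n j m q : ℕ} {s s' : GenState} {x : ℕ} (h : ItemOK n j m q s x)
    (hs : Extends s s') (hx : x ≤ n) : streamOf s' x = streamOf s x := by
  obtain ⟨p, f, h1, -⟩ := h.stream hx
  obtain ⟨h6, h7⟩ := hs.u x p h1
  unfold streamOf
  rw [h6, h7, h1]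

theorem ItemsOK.extends {n j m q b : ℕ} {s s' : GenState} {M : Multiset ℕ}
    (h : ItemsOK n j m q b s M) (hs : Extends s s') : ItemsOK n j m q b s' M where
  card := h.card
  item x hx := (h.item x hx).extends hs
  nodup := by
    rw [Multiset.map_congr rfl fun x hx => ?_]
    · exact h.nodup
    · rw [Multiset.mem_filter] at hx
      exact (h.item x hx.1).streamOf_eq hs hx.2

theorem ItemsOK.zero (n j m q b : ℕ) (s : GenState) : ItemsOK n j m q b s 0 :=
  ⟨by simp, by simp, by simp⟩

theorem ItemsOK.mono {n j m q b q' b' : ℕ} {s : GenState} {M : Multiset ℕ}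
    (h : ItemsOK n j m q b s M) (hq : q ≤ q') (hb : b ≤ b') : ItemsOK n j m q' b' s M where
  card := h.card.trans hb
  item x hx := ⟨(h.item x hx).lt, (h.item x hx).le, fun hn => by
    obtain ⟨p, f, h1, h2, h3, h4, h5⟩ := (h.item x hx).stream hn
    exact ⟨p, f, h1, h2, h3, fun hf => (h4 hf).trans_le hq, h5⟩⟩
  nodup := h.nodup

theorem ItemsOK.cons {n j m q b : ℕ} {s : GenState} {M : Multiset ℕ} {x : ℕ}
    (h : ItemsOK n j m q b s M) (hx : ItemOK n j m q s x)
    (hfree : x ≤ n → ∀ y ∈ M, y ≤ n → streamOf s y ≠ streamOf s x) :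
    ItemsOK n j m q (b + 1) s (x ::ₘ M) where
  card := by
    rw [Multiset.card_cons]
    exact Nat.add_le_add_right h.card 1
  item y hy := by
    rw [Multiset.mem_cons] at hy
    rcases hy with rfl | hy
    · exact hx
    · exact h.item y hy
  nodup := by
    by_cases hxn : x ≤ n
    · rw [Multiset.filter_cons_of_pos (p := (· ≤ n)) _ hxn, Multiset.map_cons, Multiset.nodup_cons]
      refine ⟨fun hc => ?_, h.nodup⟩
      rw [Multiset.mem_map] at hc
      obtain ⟨y, hy, he⟩ := hc
      rw [Multiset.mem_filter] at hy
      exact hfree hxn y hy.1 hy.2 he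
    · rw [Multiset.filter_cons_of_neg (p := (· ≤ n)) _ hxn]
      exact h.nodup

/-- Extraction of the sentinel `n + 1`. -/
theorem ItemsOK.tail {n j m q b : ℕ} {s : GenState} {M : Multiset ℕ} {x : ℕ}
    (h : ItemsOK n j m q (b + 1) s (x ::ₘ M)) : ItemsOK n j m q b s M where
  card := by
    have := h.card
    rw [Multiset.card_cons] at this
    omega
  item y hy := h.item y (Multiset.mem_cons_of_mem hy)
  nodup := Multiset.nodup_of_le (Multiset.map_le_map (Multiset.filter_le_filter _
    (Multiset.le_cons_self M x))) h.nodup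

/-- Extraction of a minimum `r`. -/
theorem ItemsOK.extract {n j m q b : ℕ} {s : GenState} {M : Multiset ℕ} {r : ℕ}
    (h : ItemsOK n j m q (b + 1) s (r ::ₘ M)) (hmin : ∀ y ∈ M, r ≤ y) (hr : r ≤ n) :
    ItemsOK n j r q b s M ∧ ∀ y ∈ M, y ≤ n → streamOf s y ≠ streamOf s r := by
  have h1 := h.nodup
  rw [Multiset.filter_cons_of_pos (p := (· ≤ n)) _ hr, Multiset.map_cons, Multiset.nodup_cons] at h1
  have h2 : ∀ y ∈ M, y ≤ n → streamOf s y ≠ streamOf s r := fun y hy hyn he =>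
    h1.1 (Multiset.mem_map.2 ⟨y, Multiset.mem_filter.2 ⟨hy, hyn⟩, he⟩)
  refine ⟨⟨h.tail.card, fun y hy => ⟨?_, (h.tail.item y hy).le, (h.tail.item y hy).stream⟩,
    h1.2⟩, h2⟩
  -- A second copy of `r` would belong to the same stream. Thus every remaining item is strictly
  -- larger than `r`.
  by_cases hyn : y ≤ n
  · refine lt_of_le_of_ne (hmin y hy) ?_
    rintro rfl
    exact h2 _ hy hyn rfl
  · omega

/-- The invariant of the heaps while the query for `j` is processed. -/
structure HeapAt (n j m q b : ℕ) (s : GenState) : Prop where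
  one_le : 1 ≤ j
  le : j ≤ n
  mem : j ∈ s.queried
  keys : ∀ (i : ℕ) (h : LHeap), s.heap[i]? = some h → 1 ≤ i ∧ i ≤ n ∧ h.WF
  range : ∀ i ∈ s.queried, 1 ≤ i ∧ i ≤ n
  unqueried : ∀ i, i ∉ s.queried → s.heap[i]? = none
  others : ∀ i, i ≠ j → ∃ m, m ≤ n ∧ ItemsOK n i m (m + 1) (m + 2) s (heapItems s i)
  own : ItemsOK n j m q b s (heapItems s j)

/-- The invariant of the heaps between two queries. -/
structure HeapInv (n : ℕ) (s : GenState) : Prop where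
  keys : ∀ (i : ℕ) (h : LHeap), s.heap[i]? = some h → 1 ≤ i ∧ i ≤ n ∧ h.WF
  range : ∀ i ∈ s.queried, 1 ≤ i ∧ i ≤ n
  unqueried : ∀ i, i ∉ s.queried → s.heap[i]? = none
  items : ∀ i, ∃ m, m ≤ n ∧ ItemsOK n i m (m + 1) (m + 2) s (heapItems s i)

theorem HeapAt.extends {n j m q b : ℕ} {s s' : GenState} (h : HeapAt n j m q b s)
    (hs : Extends s s') : HeapAt n j m q b s' := by
  have hi : ∀ i, heapItems s' i = heapItems s i := fun i => by unfold heapItems; rw [hs.heap]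
  refine ⟨h.one_le, h.le, ?_, ?_, ?_, ?_, ?_, ?_⟩
  · rw [hs.queried]; exact h.mem
  · rw [hs.heap]; exact h.keys
  · rw [hs.queried]; exact h.range
  · rw [hs.queried, hs.heap]; exact h.unqueried
  · intro i hij
    obtain ⟨m, h1, h2⟩ := h.others i hij
    exact ⟨m, h1, by rw [hi]; exact h2.extends hs⟩
  · rw [hi]
    exact h.own.extends hs

theorem HeapAt.inv {n j m : ℕ} {s : GenState} (h : HeapAt n j m (m + 1) (m + 2) s)
    (hm : m ≤ n) : HeapInv n s where
  keys := h.keys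
  range := h.range
  unqueried := h.unqueried
  items i := by
    by_cases hi : i = j
    · subst hi; exact ⟨m, hm, h.own⟩
    · exact h.others i hi

theorem heap_cost {n : ℕ} {t : Std.TreeMap ℕ LHeap}
    (h : ∀ (i : ℕ) (h : LHeap), t[i]? = some h → 1 ≤ i ∧ i ≤ n ∧ h.WF) :
    mapCost t ≤ opCost (n + 2) :=
  mapCost_le (by omega) fun k hk => by
    obtain ⟨p, hp⟩ := Option.isSome_iff_exists.1 hk
    exact Consistent.lt_sq ((h k p hp).2.1.trans (by omega))

theorem queried_cost {n : ℕ} {t : Std.TreeSet ℕ} (h : ∀ i ∈ t, 1 ≤ i ∧ i ≤ n) :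
    setCost t ≤ opCost (n + 2) :=
  setCost_le (by omega) fun k hk =>
    Consistent.lt_sq ((h k hk).2.trans (by omega))

/-- This is the only use of heap sizes for the running time. It needs them to be at most n+2, which
the invariant with bound m+2 supplies, m ≤ n being a lower bound for the items that rises with each
extraction of a node. -/
theorem merge_cost_le_opCost {n : ℕ} {a b : LHeap} (ha : a.WF) (hb : b.WF)
    (has : a.size ≤ n + 2) (hbs : b.size ≤ n + 2) : (LHeap.merge a b).2 ≤ opCost (n + 2) := by
  have h1 := LHeap.merge_cost_le a b ha hb
  have h2 := LHeap.rank_le_of_size ha has (by omega)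
  have h3 := LHeap.rank_le_of_size hb hbs (by omega)
  unfold opCost
  omega

/-- The items of all heaps after a change of `heap_j`. -/
theorem heapItems_insert (s : GenState) (j : ℕ) (h : LHeap) (i : ℕ) :
    heapItems { s with heap := s.heap.insert j h } i =
      if i = j then h.items else heapItems s i := by
  unfold heapItems
  dsimp only
  rw [getElem?_insert_nat]
  by_cases hi : i = j
  · rw [if_pos hi, if_pos hi.symm]; rfl
  · rw [if_neg hi, if_neg (Ne.symm hi)]

theorem HeapAt.write {n j m q b m' q' b' : ℕ} {s : GenState} (h : HeapAt n j m q b s) {hp : LHeap}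
    (hw : hp.WF) (hi : ItemsOK n j m' q' b' s hp.items) :
    HeapAt n j m' q' b' { s with heap := s.heap.insert j hp } where
  one_le := h.one_le
  le := h.le
  mem := h.mem
  keys i hh hih := by
    dsimp only at hih
    rw [getElem?_insert_nat] at hih
    split at hih
    · cases hih
      subst_vars
      exact ⟨h.one_le, h.le, hw⟩
    · exact h.keys i hh hih
  range := h.range
  unqueried i hi := by
    dsimp only at hi ⊢
    rw [getElem?_insert_nat, if_neg]
    · exact h.unqueried i hi
    · rintro rfl; exact hi h.mem
  others i hij := by
    obtain ⟨m, h1, h2⟩ := h.others i hij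
    refine ⟨m, h1, ?_⟩
    rw [heapItems_insert, if_neg hij]
    exact ⟨h2.card, fun x hx => ⟨(h2.item x hx).lt, (h2.item x hx).le, (h2.item x hx).stream⟩,
      h2.nodup⟩
  own := by
    rw [heapItems_insert, if_pos rfl]
    exact ⟨hi.card, fun x hx => ⟨(hi.item x hx).lt, (hi.item x hx).le, (hi.item x hx).stream⟩,
      hi.nodup⟩

theorem heapInsert_run {n j m q b x : ℕ} {μ : Mach} (h : HeapAt n j m q b μ.gen) (hb : b ≤ n + 2)
    (hx : ItemOK n j m q μ.gen x)
    (hfree : x ≤ n → ∀ y ∈ heapItems μ.gen j, y ≤ n → streamOf μ.gen y ≠ streamOf μ.gen x) :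
    ∃ T hp, heapInsert j x μ =
        PMF.pure ((), { gen := { μ.gen with heap := hp }, time := T, bits := μ.bits }) ∧
      HeapAt n j m q (b + 1) { μ.gen with heap := hp } ∧
      heapItems { μ.gen with heap := hp } j = x ::ₘ heapItems μ.gen j ∧
      T ≤ μ.time + 3 * opCost (n + 2) ∧
      GenState.space n { μ.gen with heap := hp } ≤ μ.gen.space n + 2 := by
  have hc := heap_cost h.keys
  unfold heapInsert
  rw [bind_run_of_run (readArr_run _ _ _)]
  set h0 := (μ.gen.heap[j]?).getD LHeap.nil with hh0
  have hw0 : h0.WF := by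
    rw [hh0]
    rcases hj : μ.gen.heap[j]? with _ | hj'
    · exact trivial
    · exact (h.keys j _ hj).2.2
  have hit : heapItems μ.gen j = h0.items := by
    unfold heapItems
    rw [hh0]
    rcases μ.gen.heap[j]? with _ | hj' <;> rfl
  have hsz : h0.size ≤ n + 2 := by
    rw [LHeap.size_eq_card, ← hit]
    exact h.own.card.trans hb
  have hw1 : (LHeap.node 1 x LHeap.nil LHeap.nil).WF :=
    ⟨rfl, le_rfl, trivial, trivial, by simp [LHeap.items]⟩
  have hmc := merge_cost_le_opCost (n := n) hw1 hw0 (by simp [LHeap.size]) hsz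
  have hitems : (LHeap.merge (LHeap.node 1 x LHeap.nil LHeap.nil) h0).1.items =
      x ::ₘ heapItems μ.gen j := by
    rw [LHeap.items_merge, hit]
    simp [LHeap.items]
  dsimp only
  rw [bind_run_of_run (charge_run _ _), writeHeap_run]
  dsimp only
  refine ⟨_, _, rfl, h.write (LHeap.wf_merge _ _ hw1 hw0) ?_, ?_, ?_, ?_⟩
  · rw [hitems]
    exact h.own.cons hx hfree
  · rw [heapItems_insert, if_pos rfl, hitems]
  · omega
  · refine space_heap_insert _ h.one_le h.le _ ?_
    have e1 : (μ.gen.heap[j]?.elim 0 fun t => t.size) = h0.size := by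
      rw [hh0]
      rcases μ.gen.heap[j]? with _ | hj' <;> rfl
    rw [e1, LHeap.size_eq_card, LHeap.size_eq_card, hitems, hit, Multiset.card_cons]

/-- The outcome of `heapExtractMin n j`. -/
structure Extracted (n j m r : ℕ) (s s' : GenState) : Prop where
  le : r ≤ n + 1
  last : r = n + 1 → HeapAt n j m (m + 1) (m + 1) s'
  lt : r ≤ n → m < r
  item : r ≤ n → ItemOK n j m (m + 1) s r
  heap : r ≤ n → HeapAt n j r r r s' ∧ ∀ y ∈ heapItems s' j, y ≤ n → streamOf s y ≠ streamOf s r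

theorem heapExtractMin_run {n j m : ℕ} {μ : Mach} (h : HeapAt n j m (m + 1) (m + 2) μ.gen)
    (hm : m ≤ n) :
    ∃ r T hp, heapExtractMin n j μ =
        PMF.pure (r, { gen := { μ.gen with heap := hp }, time := T, bits := μ.bits }) ∧
      Extracted n j m r μ.gen { μ.gen with heap := hp } ∧
      T ≤ μ.time + 3 * opCost (n + 2) ∧
      GenState.space n { μ.gen with heap := hp } ≤ μ.gen.space n + 2 := by
  have hc := heap_cost h.keys
  unfold heapExtractMin
  rw [bind_run_of_run (readArr_run _ _ _)]
  have hempty : heapItems μ.gen j = 0 → Extracted n j m (n + 1) μ.gen μ.gen := by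
    intro h0
    refine ⟨le_rfl, fun _ => ?_, fun h => by omega, fun h => by omega, fun h => by omega⟩
    refine ⟨h.one_le, h.le, h.mem, h.keys, h.range, h.unqueried, h.others, ?_⟩
    rw [h0]
    exact ItemsOK.zero ..
  rcases hj : μ.gen.heap[j]? with _ | (_ | ⟨rk, x, l, r⟩)
  · exact ⟨_, _, μ.gen.heap, rfl, hempty (by unfold heapItems; rw [hj]; rfl), by omega,
      Nat.le_add_right _ _⟩
  · exact ⟨_, _, μ.gen.heap, rfl, hempty (by unfold heapItems; rw [hj]; rfl), by omega,
      Nat.le_add_right _ _⟩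
  · have hw := (h.keys j _ hj).2.2
    obtain ⟨-, -, hl, hr, hmin⟩ := hw
    have hit : heapItems μ.gen j = x ::ₘ (l.items + r.items) := by unfold heapItems; rw [hj]; rfl
    have hown := h.own
    rw [hit] at hown
    have hcard := hown.card
    rw [Multiset.card_cons, Multiset.card_add, ← LHeap.size_eq_card, ← LHeap.size_eq_card] at hcard
    have hmc := merge_cost_le_opCost (n := n) hl hr (by omega) (by omega)
    have hx := hown.item x (Multiset.mem_cons_self _ _)
    have hitems := LHeap.items_merge l r
    have hwf := LHeap.wf_merge l r hl hr
    dsimp only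
    rw [bind_run_of_run (charge_run _ _), bind_run_of_run (writeHeap_run _ _ _), pure_run]
    dsimp only
    refine ⟨_, _, _, rfl, ⟨hx.le, fun _ => ?_, fun _ => hx.lt, fun _ => hx, fun hxn => ?_⟩, ?_, ?_⟩
    · refine h.write hwf ?_
      rw [hitems]
      exact hown.tail
    · obtain ⟨h1, h2⟩ := hown.extract hmin hxn
      have := hx.lt
      constructor
      · refine h.write hwf ?_
        rw [hitems]
        exact h1.mono (by omega) (by omega)
      · rw [heapItems_insert, if_pos rfl, hitems]
        exact h2
    · omega
    · refine space_heap_insert _ h.one_le h.le _ ?_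
      rw [hj, LHeap.size_eq_card, hitems, Multiset.card_add, ← LHeap.size_eq_card,
        ← LHeap.size_eq_card]
      simp only [Option.elim_some, LHeap.size]
      omega

end

open scoped ENNReal

noncomputable section

/-! ## The procedure `BA-next-neighbor` -/

/-- The tree of parents has a long path or a node with many children. -/
def HasLong (U : ℕ → Option ℕ) (L : ℕ) : Prop :=
  ∃ j, DownPath U L j ∨ UpPath U L j ∨ ∃ k, 1 ≤ k ∧ ManyChildren U L j k

theorem HasLong.mono {U U' : ℕ → Option ℕ} (hU : ∀ x p, U x = some p → U' x = some p) {L : ℕ}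
    (h : HasLong U L) : HasLong U' L := by
  obtain ⟨j, h | h | ⟨k, hk, h⟩⟩ := h
  · exact ⟨j, Or.inl (h.mono hU)⟩
  · exact ⟨j, Or.inr (Or.inl (h.mono hU))⟩
  · exact ⟨j, Or.inr (Or.inr ⟨k, hk, h.mono hU⟩)⟩

/-- Known parents remain known. -/
def Grows (s s' : GenState) : Prop := ∀ x p, parentFn s x = some p → parentFn s' x = some p

theorem Grows.trans {s s' s'' : GenState} (h : Grows s s') (h' : Grows s' s'') : Grows s s'' :=
  fun x p hx => h' x p (h x p hx)

/-- Sequential composition; the costs add up unless the tree of parents has a long path or a node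
with many children. -/
theorem Spec.seq {n L : ℕ} {α β : Type} {P : Prog α} {R : α → Prog β} {m : Mach} {ε ε' : ℝ≥0∞}
    {V : Finset ℕ → (ℕ → ℕ) → ℝ≥0∞} {Q1 : α → Mach → Prop} {Q : β → Mach → Prop}
    {T B S T' B' S' : ℕ}
    (h1 : Spec n P m ε V Q1 fun _ m' => Cost n m m' T B S ∨ HasLong (parentFn m'.gen) L)
    (h2 : ∀ a m', Q1 a m' → Spec n (R a) m' ε' (fun X g => genPot X g m'.gen)
      (fun b m'' => Q b m'' ∧ Grows m'.gen m''.gen)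
      (fun _ m'' => Cost n m' m'' T' B' S' ∨ HasLong (parentFn m''.gen) L)) :
    Spec n (P >>= R) m (ε + ε') V Q
      (fun _ m' => Cost n m m' (T + T') (B + B') (S + S') ∨ HasLong (parentFn m'.gen) L) := by
  refine h1.bind (C2 := fun _ m' _ m'' => Grows m'.gen m''.gen ∧
    (Cost n m' m'' T' B' S' ∨ HasLong (parentFn m''.gen) L)) ?_ ?_
  · intro a m' hq
    exact (h2 a m' hq).mono le_rfl (fun _ _ => le_rfl) (fun _ _ h => h.1) (fun _ _ h hc => ⟨h.2, hc⟩)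
  · rintro a m' b m'' - hc - ⟨hg, hc'⟩
    rcases hc with hc | hc
    · rcases hc' with hc' | hc'
      · exact Or.inl (hc.trans hc')
      · exact Or.inr hc'
    · exact Or.inr (hc.mono hg)

/-- The invariant while the query for `j` is processed. -/
structure MidInv (n j m q b : ℕ) (s : GenState) : Prop where
  inv : Consistent n s
  closed : FrontClosed s 0
  heap : HeapAt n j m q b s

/-- The invariant between two queries. -/
structure GenInv (n : ℕ) (s : GenState) : Prop where
  inv : Consistent n s
  closed : FrontClosed s 0
  heap : HeapInv n s

theorem Consistent.congr_heap {n : ℕ} {s : GenState} (h : Consistent n s)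
    (hp : Std.TreeMap ℕ LHeap) (qu : Std.TreeSet ℕ) :
    Consistent n { s with heap := hp, queried := qu } :=
  ⟨h.u_one, h.u_range, h.type_one, h.type_range, h.front_spec, h.inv_spec, h.child_some,
    h.child_none, h.right_spec, h.K_spec⟩

/-- Insert the next child of a stream into `heap_j`. -/
theorem heapInsert_nextChildTp_spec {n c R Tt Bt L : ℕ} {p₀ : ℝ≥0∞}
    (htoss : TossBound n c Tt Bt p₀) {j m q q' b p k : ℕ} {ty : PtrFlag} {μ : Mach}
    (h : MidInv n j m q b μ.gen) (hb : b ≤ n + 2) (hqq : q ≤ q') (h1 : 1 ≤ p) (h2 : p ≤ n)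
    (h1k : 1 ≤ k) (hkn : k ≤ n) (hmk : m ≤ k) (hk : k = p ∨ k ≤ frontVal μ.gen p)
    (hdir : ty = PtrFlag.dir → p = j) (hrec : ty = PtrFlag.recur → p < q')
    (hfree : ∀ y ∈ heapItems μ.gen j, y ≤ n → streamOf μ.gen y ≠ (some p, some ty)) :
    Spec n (nextChildTp n c p ty (n + 1) k >>= heapInsert j) μ
      (L * (L * levelFail n R p₀)) (fun X g => genPot X g μ.gen)
      (fun _ μ' => MidInv n j m q' (b + 1) μ'.gen ∧ Grows μ.gen μ'.gen)
      (fun _ μ' => Cost n μ μ' (L * stepTime n R Tt L + 3 * opCost (n + 2))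
        (L * (L * levelBits n R Bt)) (L * (L * 18 + 2) + 2) ∨
          HasLong (parentFn μ'.gen) L) := by
  rw [← add_zero (L * (L * levelFail n R p₀)), ← add_zero (L * (L * levelBits n R Bt))]
  refine Spec.seq ((nextChildTp_spec htoss L h1 h2 ty (n + 1) L k μ h.inv h.closed hkn hk
    (by omega)).mono le_rfl (fun _ _ => le_rfl) (fun _ _ => id) ?_) ?_
  · rintro x μ' - (hc | hc | hc)
    · exact Or.inl hc
    · exact Or.inr ⟨p, Or.inl hc⟩
    · exact Or.inr ⟨p, Or.inr (Or.inr ⟨k, h1k, hc⟩)⟩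
  · rintro x μ' hx
    have hext := hx.steady.ext
    have hH := h.heap.extends hext
    have hi : heapItems μ'.gen j = heapItems μ.gen j := by unfold heapItems; rw [hext.heap]
    have hstream : x ≤ n → streamOf μ'.gen x = (some p, some ty) := by
      intro hxn
      unfold streamOf
      rw [hx.u hxn, hx.type hxn]
    have hH' : HeapAt n j m q' b μ'.gen := ⟨hH.one_le, hH.le, hH.mem, hH.keys, hH.range,
      hH.unqueried, hH.others, hH.own.mono hqq le_rfl⟩
    obtain ⟨t, hp, hr, hA, -, ht, hs⟩ := heapInsert_run (x := x) hH' hb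
      ⟨hmk.trans_lt hx.lt, hx.le_n, fun hxn => ⟨p, ty, hx.u hxn, hx.type hxn, hdir, hrec, by
        obtain ⟨y, hy, hxy⟩ := hx.front hxn
        unfold frontVal
        rw [hy]
        exact hxy⟩⟩ (by
        intro hxn y hy hyn
        rw [hi] at hy
        rw [hstream hxn, (h.heap.own.item y hy).streamOf_eq hext hyn]
        exact hfree y hy hyn)
    refine Spec.of_run (P' := pure ()) hr (Spec.pure ⟨⟨⟨hx.steady.inv.congr_heap hp _,
      hx.steady.closed, hA⟩, hext.parentFn⟩, fun _ _ h => h⟩ (Or.inl ⟨ht, le_rfl, hs⟩)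
      fun _ _ _ => le_rfl)

theorem Spec.of_cost {n L : ℕ} {α : Type} {P : Prog α} {m : Mach} {ε : ℝ≥0∞}
    {V : Finset ℕ → (ℕ → ℕ) → ℝ≥0∞} {Q C : α → Mach → Prop} {T B S : ℕ} (h : Spec n P m ε V Q C)
    (hC : ∀ a m', Q a m' → Cost n m m' T B S) :
    Spec n P m ε V Q (fun _ m' => Cost n m m' T B S ∨ HasLong (parentFn m'.gen) L) :=
  h.mono le_rfl (fun _ _ => le_rfl) (fun _ _ => id) fun a m' hq _ => Or.inl (hC a m' hq)

/-- A deterministic start of a program. -/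
theorem Spec.after {n L : ℕ} {α : Type} {P P' : Prog α} {m m' : Mach} {ε : ℝ≥0∞}
    {V : Finset ℕ → (ℕ → ℕ) → ℝ≥0∞} {Q : α → Mach → Prop} {T B S T' B' S' : ℕ}
    (hr : P m = P' m') (hc : Cost n m m' T B S)
    (h : Spec n P' m' ε V Q
      (fun _ m'' => Cost n m' m'' T' B' S' ∨ HasLong (parentFn m''.gen) L)) :
    Spec n P m ε V Q
      (fun _ m'' => Cost n m m'' (T + T') (B + B') (S + S') ∨ HasLong (parentFn m''.gen) L) :=
  Spec.of_run hr (h.mono le_rfl (fun _ _ => le_rfl) (fun _ _ => id) fun _ _ _ h =>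
    h.imp hc.trans id)

theorem Spec.weaken_cost {n L : ℕ} {α : Type} {P : Prog α} {m : Mach} {ε ε' : ℝ≥0∞}
    {V : Finset ℕ → (ℕ → ℕ) → ℝ≥0∞} {Q : α → Mach → Prop} {T B S T' B' S' : ℕ}
    (h : Spec n P m ε V Q (fun _ m' => Cost n m m' T B S ∨ HasLong (parentFn m'.gen) L))
    (hε : ε ≤ ε') (hT : T ≤ T') (hB : B ≤ B') (hS : S ≤ S') :
    Spec n P m ε' V Q (fun _ m' => Cost n m m' T' B' S' ∨ HasLong (parentFn m'.gen) L) :=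
  h.mono hε (fun _ _ => le_rfl) (fun _ _ => id) fun _ _ _ h =>
    h.imp (fun h => h.mono hT hB hS) id

/-- The time of a call of `BA-next-neighbor`. -/
def callTime (n R Tt L : ℕ) : ℕ :=
  2 * (L * stepTime n R Tt L) + L * (10 * opCost (n + 2)) + 30 * opCost (n + 2)

/-- The random bits of a call of `BA-next-neighbor`. -/
def callBits (n R Bt L : ℕ) : ℕ :=
  2 * (L * (L * levelBits n R Bt)) + L * opCost (n + 2) + opCost (n + 2)

/-- The space of a call of `BA-next-neighbor`. -/
def callSpace (L : ℕ) : ℕ := 2 * (L * (L * 18 + 2)) + L * 6 + 20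

/-- The probability that a call of `BA-next-neighbor` exceeds its bounds although the tree of
parents has no long path and no node with many children. -/
def callFail (n R L : ℕ) (p : ℝ≥0∞) : ℝ≥0∞ := 2 * (L * (L * levelFail n R p))

theorem baNextNeighbor_first_spec {n c R Tt Bt L : ℕ} {p₀ : ℝ≥0∞}
    (htoss : TossBound n c Tt Bt p₀) {j : ℕ} (h1 : 1 ≤ j) (h2 : j ≤ n) {m : Mach}
    (h : GenInv n m.gen) (hj : j ∉ m.gen.queried) :
    Spec n (baNextNeighbor n c j) m (callFail n R L p₀) (fun X g => genPot X g m.gen)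
      (fun _ m' => GenInv n m'.gen)
      (fun _ m' => Cost n m m' (callTime n R Tt L) (callBits n R Bt L) (callSpace L) ∨
        HasLong (parentFn m'.gen) L) := by
  have hO := opCost_pos (n + 2)
  have hq := queried_cost h.heap.range
  set m1 : Mach := ⟨{ m.gen with queried := m.gen.queried.insert j },
    m.time + 1 + setCost m.gen.queried + setCost m.gen.queried, m.bits⟩ with hm1
  have hsz := Std.TreeSet.size_insert_le (t := m.gen.queried) (k := j)
  have hI1 : Consistent n m1.gen := h.inv.congr_heap _ _
  have hit0 : heapItems m1.gen j = 0 := by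
    unfold heapItems
    dsimp only [m1]
    rw [h.heap.unqueried j hj]
    rfl
  -- The first query starts from an empty heap. After the insertion of `n + 1` and of one direct
  -- child it holds at most two items, within the bound j+2.
  have hA : HeapAt n j j 0 0 m1.gen := by
    refine ⟨h1, h2, ?_, h.heap.keys, ?_, ?_, ?_, ?_⟩
    · dsimp only [m1]
      rw [mem_insert_nat]; exact Or.inl rfl
    · intro i hi
      dsimp only [m1] at hi
      rw [mem_insert_nat] at hi
      rcases hi with rfl | hi
      · exact ⟨h1, h2⟩
      · exact h.heap.range i hi
    · intro i hi
      dsimp only [m1] at hi ⊢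
      rw [mem_insert_nat, not_or] at hi
      exact h.heap.unqueried i hi.2
    · intro i _
      obtain ⟨k, h3, h4⟩ := h.heap.items i
      exact ⟨k, h3, h4.card, fun x hx => ⟨(h4.item x hx).lt, (h4.item x hx).le,
        (h4.item x hx).stream⟩, h4.nodup⟩
    · rw [hit0]
      exact ItemsOK.zero ..
  obtain ⟨t, hp, hr, hA2, hit, ht, hs⟩ := heapInsert_run (x := n + 1) hA (by omega)
    ⟨by omega, le_rfl, fun _ => by omega⟩ (fun _ => by omega)
  rw [hit0] at hit
  set m2 : Mach := { gen := { m1.gen with heap := hp }, time := t, bits := m1.bits } with hm2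
  have hM : MidInv n j j 0 1 m2.gen := ⟨hI1.congr_heap _ _, h.closed, hA2⟩
  have hrun : baNextNeighbor n c j m =
      ((nextChildTp n c j PtrFlag.dir (n + 1) j >>= heapInsert j) >>= fun _ =>
        baParent n (n + 1) j) m2 := by
    unfold baNextNeighbor
    rw [bind_run_of_run (charge_run _ _), bind_run_of_run (readSet_run _ _ _), if_pos,
      bind_run_of_run (markQueried_run _ _), bind_run_of_run hr, bind_assoc]
    by_contra hc
    rw [Bool.not_eq_false, Std.TreeSet.contains_iff_mem] at hc
    exact hj hc
  have hcost : Cost n m m2 (1 + 5 * opCost (n + 2)) 0 3 := by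
    dsimp only [m1] at ht hs
    refine ⟨?_, le_rfl, ?_⟩
    · dsimp only [m2]; omega
    · have : m1.gen.space n ≤ m.gen.space n + 1 := by
        unfold GenState.space
        dsimp only [m1]
        omega
      dsimp only [m2]
      dsimp only [m1] at this ⊢
      omega
  refine (Spec.after (L := L) hrun hcost (Spec.seq (L := L) (Q := fun _ m' => GenInv n m'.gen)
    (T' := L * (10 * opCost (n + 2))) (B' := L * opCost (n + 2)) (S' := L * 6)
    (heapInsert_nextChildTp_spec (L := L) (R := R) htoss hM (q' := 1) (by omega) (by omega) h1 h2 h1 h2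
      le_rfl (Or.inl rfl) (fun _ => rfl) (fun h => by cases h) ?_) fun _ m3 hm3 =>
      ((baParent_spec (n + 1) L j m3 hm3.1.inv hm3.1.closed h1 h2).mono le_rfl
        (fun _ _ => le_rfl) ?_ ?_))).weaken_cost ?_ ?_ ?_ ?_
  · intro y hy hyn
    rw [hit, Multiset.mem_cons] at hy
    rcases hy with rfl | hy
    · omega
    · simp at hy
  · intro _ m' hs
    refine ⟨⟨hs.inv, hs.closed, ?_⟩, hs.ext.parentFn⟩
    have h5 := hm3.1.heap.extends hs.ext
    refine HeapAt.inv (j := j) (m := j) ⟨h5.one_le, h5.le, h5.mem, h5.keys, h5.range, h5.unqueried,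
      h5.others, h5.own.mono (by omega) (by omega)⟩ h2
  · rintro _ m' - (hc | hc)
    · exact Or.inl hc
    · exact Or.inr ⟨j, Or.inr (Or.inl hc)⟩
  · rw [add_zero, callFail, two_mul]
    exact le_self_add
  · unfold callTime; omega
  · unfold callBits; omega
  · unfold callSpace; omega

/-- The two insertions after the extraction of `r` from `heap_j`. -/
theorem two_insertions_spec {n c R Tt Bt L : ℕ} {p₀ : ℝ≥0∞} (htoss : TossBound n c Tt Bt p₀)
    {j p r : ℕ} {ty : PtrFlag} {μ : Mach} (h : MidInv n j r r r μ.gen) (hr1 : 1 ≤ r)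
    (hrn : r ≤ n) (h1 : 1 ≤ p) (h2 : p ≤ n) (hk : r ≤ frontVal μ.gen p)
    (hdir : ty = PtrFlag.dir → p = j) (hrec : ty = PtrFlag.recur → p < r)
    (hfree : ∀ y ∈ heapItems μ.gen j, y ≤ n → streamOf μ.gen y ≠ (some p, some ty)) :
    Spec n ((nextChildTp n c p ty (n + 1) r >>= heapInsert j) >>= fun _ =>
        (nextChildTp n c r PtrFlag.recur (n + 1) r >>= heapInsert j) >>= fun _ => pure r) μ
      (callFail n R L p₀) (fun X g => genPot X g μ.gen) (fun _ μ' => GenInv n μ'.gen ∧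
        Grows μ.gen μ'.gen)
      (fun _ μ' => Cost n μ μ' (2 * (L * stepTime n R Tt L) + 6 * opCost (n + 2))
        (2 * (L * (L * levelBits n R Bt))) (2 * (L * (L * 18 + 2)) + 4) ∨
          HasLong (parentFn μ'.gen) L) := by
  refine (Spec.seq (L := L) (Q := fun _ μ' => GenInv n μ'.gen ∧ Grows μ.gen μ'.gen)
    (heapInsert_nextChildTp_spec (L := L) (R := R) htoss h (q' := r) (by omega) le_rfl h1 h2 hr1 hrn
      le_rfl (Or.inr hk) hdir hrec hfree) (fun _ m1 hm1 =>
    (Spec.seq (L := L) (Q := fun _ μ' => (GenInv n μ'.gen ∧ Grows μ.gen μ'.gen) ∧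
      Grows m1.gen μ'.gen) (T' := 0) (B' := 0) (S' := 0) (ε' := 0)
      (heapInsert_nextChildTp_spec (L := L) (R := R) htoss hm1.1 (q' := r + 1) (by omega)
        (by omega) hr1 hrn hr1 hrn le_rfl (Or.inl rfl) (fun h => by cases h) (fun _ => by omega) ?_)
      fun _ m2 hm2 => Spec.pure ⟨⟨⟨?_, hm1.2.trans hm2.2⟩, hm2.2⟩, fun _ _ h => h⟩
        (Or.inl (Cost.refl n m2)) fun _ _ _ => le_rfl))).weaken_cost ?_ ?_ ?_ ?_
  -- The stream of recursive children of `r` is new, because all recursive streams present belong to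
  -- nodes below `r`.
  · intro y hy hyn he
    obtain ⟨q, f, h3, h4, -, h5, -⟩ := (hm1.1.heap.own.item y hy).stream hyn
    unfold streamOf at he
    rw [h3, h4] at he
    cases he
    exact lt_irrefl _ (h5 rfl)
  · exact ⟨hm2.1.inv, hm2.1.closed, hm2.1.heap.inv hrn⟩
  · rw [add_zero, callFail, two_mul]
  · omega
  · omega
  · omega

theorem baNextNeighbor_later_spec {n c R Tt Bt L : ℕ} {p₀ : ℝ≥0∞}
    (htoss : TossBound n c Tt Bt p₀) {j : ℕ} {m : Mach}
    (h : GenInv n m.gen) (hj : j ∈ m.gen.queried) :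
    Spec n (baNextNeighbor n c j) m (callFail n R L p₀) (fun X g => genPot X g m.gen)
      (fun _ m' => GenInv n m'.gen)
      (fun _ m' => Cost n m m' (callTime n R Tt L) (callBits n R Bt L) (callSpace L) ∨
        HasLong (parentFn m'.gen) L) := by
  have hO := opCost_pos (n + 2)
  have hq := queried_cost h.heap.range
  have hct := h.inv.cost_type
  obtain ⟨k, hkn, hk⟩ := h.heap.items j
  have hA : HeapAt n j k (k + 1) (k + 2) m.gen :=
    ⟨(h.heap.range j hj).1, (h.heap.range j hj).2, hj, h.heap.keys, h.heap.range,
      h.heap.unqueried, fun i _ => h.heap.items i, hk⟩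
  obtain ⟨r, t, hp, hr, hE, ht, hs⟩ := heapExtractMin_run
    (μ := ⟨m.gen, m.time + 1 + setCost m.gen.queried, m.bits⟩) hA hkn
  dsimp only at hr hE ht hs
  have hrun : baNextNeighbor n c j m = (if r = n + 1 then do
        heapInsert j (n + 1)
        return n + 1
      else do
        if (← readArr GenState.type r) = some PtrFlag.dir then
          heapInsert j (← nextChildTp n c j PtrFlag.dir (n + 1) r)
          heapInsert j (← nextChildTp n c r PtrFlag.recur (n + 1) r)
        else
          let p ← parentQuery n r
          heapInsert j (← nextChildTp n c p.1 PtrFlag.recur (n + 1) r)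
          heapInsert j (← nextChildTp n c r PtrFlag.recur (n + 1) r)
        return r : Prog ℕ) ⟨{ m.gen with heap := hp }, t, m.bits⟩ := by
    unfold baNextNeighbor
    rw [bind_run_of_run (charge_run _ _), bind_run_of_run (readSet_run _ _ _), if_neg,
      bind_run_of_run hr]
    rw [Bool.not_eq_false, Std.TreeSet.contains_iff_mem]
    exact hj
  set m1 : Mach := ⟨{ m.gen with heap := hp }, t, m.bits⟩ with hm1
  have hI1 : Consistent n m1.gen := h.inv.congr_heap _ _
  by_cases hrn : r = n + 1
  · have hL := hE.last hrn
    obtain ⟨t2, hp2, hr2, hA2, -, ht2, hs2⟩ := heapInsert_run (μ := m1) (x := n + 1) hL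
      (by omega) ⟨by omega, le_rfl, fun _ => by omega⟩ (fun _ => by omega)
    refine Spec.of_run (P' := pure (n + 1)) (m' := ⟨{ m1.gen with heap := hp2 }, t2, m1.bits⟩)
      ?_ ?_
    · rw [hrun, if_pos hrn, bind_run_of_run hr2]
    · refine Spec.pure ⟨hI1.congr_heap _ _, h.closed, hA2.inv hkn⟩ (Or.inl ⟨?_, ?_, ?_⟩)
        fun _ _ _ => le_rfl
      · unfold callTime
        dsimp only [m1] at ht2 ⊢
        omega
      · exact Nat.le_add_right _ _
      · unfold callSpace
        dsimp only [m1] at hs2 ⊢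
        omega
  have hrn' : r ≤ n := by have := hE.le; omega
  have hkr := hE.lt hrn'
  obtain ⟨hA1, hfree⟩ := hE.heap hrn'
  obtain ⟨p, f, hu, hty, hdir, hrec, hfr⟩ := (hE.item hrn').stream hrn'
  have hpr := h.inv.u_range r p hu
  have hfree' : ∀ y ∈ heapItems m1.gen j, y ≤ n → streamOf m1.gen y ≠ (some p, some f) := by
    intro y hy hyn
    have := hfree y hy hyn
    unfold streamOf at this ⊢
    rwa [hu, hty] at this
  have hcost1 : ∀ t', t' ≤ opCost (n + 2) →
      Cost n m { m1 with time := m1.time + t' } (1 + 5 * opCost (n + 2)) 0 2 := by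
    intro t' ht'
    refine ⟨?_, le_rfl, hs⟩
    dsimp only [m1]
    omega
  by_cases hfd : f = PtrFlag.dir
  · subst hfd
    have hpj := hdir rfl
    subst hpj
    refine (Spec.after (L := L) (m' := { m1 with time := m1.time + mapCost m1.gen.type })
      (P' := (nextChildTp n c p PtrFlag.dir (n + 1) r >>= heapInsert p) >>= fun _ =>
        (nextChildTp n c r PtrFlag.recur (n + 1) r >>= heapInsert p) >>= fun _ => pure r)
      ?_ (hcost1 _ hct) ((two_insertions_spec (R := R) (L := L) htoss
        (μ := { m1 with time := m1.time + mapCost m1.gen.type }) ⟨hI1, h.closed, hA1⟩ (by omega) hrn' hA1.one_le hA1.le hfr (fun _ => rfl)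
        (fun h => by cases h) hfree').mono le_rfl (fun _ _ => le_rfl) (fun _ _ h => h.1)
          (fun _ _ _ => id))).weaken_cost le_rfl ?_ ?_ ?_
    · rw [hrun, if_neg hrn, bind_run_of_run (readArr_run _ _ _), if_pos hty]
      simp only [bind_assoc]
    · unfold callTime; omega
    · unfold callBits; omega
    · unfold callSpace; omega
  · have hfr' : f = PtrFlag.recur := by
      rcases f with _ | _
      · exact absurd rfl hfd
      · rfl
    subst hfr'
    have hpk := hrec rfl
    rw [← zero_add (callFail n R L p₀)]
    refine (Spec.after (L := L) (m' := { m1 with time := m1.time + mapCost m1.gen.type })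
      (P' := parentQuery n r >>= fun q =>
        (nextChildTp n c q.1 PtrFlag.recur (n + 1) r >>= heapInsert j) >>= fun _ =>
        (nextChildTp n c r PtrFlag.recur (n + 1) r >>= heapInsert j) >>= fun _ => pure r)
      ?_ (hcost1 _ hct) (Spec.seq (L := L) (Q := fun _ m' => GenInv n m'.gen)
        (T' := 2 * (L * stepTime n R Tt L) + 6 * opCost (n + 2))
        (B' := 2 * (L * (L * levelBits n R Bt))) (S' := 2 * (L * (L * 18 + 2)) + 4)
        ((parentQuery_spec (m := { m1 with time := m1.time + mapCost m1.gen.type }) hI1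
          (by omega) hrn').of_cost
          (T := 9 * opCost (n + 2)) (B := opCost (n + 2)) (S := 6) fun _ _ h => h.cost)
        (fun q m2 hP => ?_))).weaken_cost le_rfl ?_ ?_ ?_
    · rw [hrun, if_neg hrn, bind_run_of_run (readArr_run _ _ _), if_neg]
      · simp only [bind_assoc]
      · intro hc
        have := hty.symm.trans hc
        cases this
    · have hqp : q.1 = p := by
        have h3 := (hP.ext.u r p hu).1
        rw [hP.u] at h3
        cases h3
        rfl
      have hi : heapItems m2.gen j = heapItems m1.gen j := by
        unfold heapItems; rw [hP.ext.heap]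
      rw [hqp]
      refine two_insertions_spec (R := R) (L := L) htoss
        ⟨hP.inv, h.closed.congr hP.front hP.frontInv, hA1.extends hP.ext⟩ (by omega) hrn'
        (by omega) (by omega) (hfr.trans (hP.ext.frontVal p)) (fun h => by cases h)
        (fun _ => by omega) ?_
      intro y hy hyn
      rw [hi] at hy
      rw [(hA1.own.item y hy).streamOf_eq hP.ext hyn]
      exact hfree' y hy hyn
    · unfold callTime; omega
    · unfold callBits; omega
    · unfold callSpace; omega

theorem baNextNeighbor_spec {n c R Tt Bt L : ℕ} {p₀ : ℝ≥0∞} (htoss : TossBound n c Tt Bt p₀)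
    {j : ℕ} (h1 : 1 ≤ j) (h2 : j ≤ n) {m : Mach} (h : GenInv n m.gen) :
    Spec n (baNextNeighbor n c j) m (callFail n R L p₀) (fun X g => genPot X g m.gen)
      (fun _ m' => GenInv n m'.gen)
      (fun _ m' => Cost n m m' (callTime n R Tt L) (callBits n R Bt L) (callSpace L) ∨
        HasLong (parentFn m'.gen) L) := by
  by_cases hj : j ∈ m.gen.queried
  · exact baNextNeighbor_later_spec htoss h hj
  · exact baNextNeighbor_first_spec htoss h1 h2 h hj

end

open scoped ENNReal

noncomputable section

/-! ## Long paths and large degrees are unlikely -/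

/-- The largest element of `X` below `x`, or `i` if there is none. -/
def prevIn (X : Finset ℕ) (i x : ℕ) : ℕ :=
  if (X.filter (· < x)).sup id = 0 then i else (X.filter (· < x)).sup id

/-- Parents are smaller than children, so a descending path is determined by `j` and its set of
further nodes: the parent of each is its predecessor in the set. Paths can thus be counted by sets
rather than by sequences. -/
theorem exists_chain_of_downPath {n : ℕ} {s : GenState} (h : Consistent n s) {D j : ℕ}
    (hd : DownPath (parentFn s) D j) :
    ∃ X : Finset ℕ, X ⊆ Finset.Icc 2 n ∧ X.card = D ∧ (∀ x ∈ X, j < x) ∧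
      ∀ x ∈ X, parentFn s x = some (prevIn X j x) := by
  induction D generalizing j with
  | zero => exact ⟨∅, by simp, rfl, by simp, by simp⟩
  | succ D ih =>
    obtain ⟨x, hx2, hx, hd⟩ := hd
    have hr := h.u_range x j hx
    obtain ⟨X, h1, h2, h3, h4⟩ := ih hd
    have hxX : x ∉ X := fun hc => lt_irrefl _ (h3 x hc)
    refine ⟨insert x X, ?_, ?_, ?_, ?_⟩
    · intro y hy
      rw [Finset.mem_insert] at hy
      rcases hy with rfl | hy
      · exact Finset.mem_Icc.2 ⟨hx2, hr.2.1⟩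
      · exact h1 hy
    · rw [Finset.card_insert_of_notMem hxX, h2]
    · intro y hy
      rw [Finset.mem_insert] at hy
      rcases hy with rfl | hy
      · omega
      · have := h3 y hy
        omega
    · intro y hy
      rw [Finset.mem_insert] at hy
      unfold prevIn
      rcases hy with rfl | hy
      · have : (insert y X).filter (· < y) = ∅ := by
          rw [Finset.filter_eq_empty_iff]
          intro z hz
          rw [Finset.mem_insert] at hz
          rcases hz with rfl | hz
          · omega
          · have := h3 z hz
            omega
        rw [this, hx]
        simp
      · have hxy := h3 y hy
        have h5 := h4 y hy
        unfold prevIn at h5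
        rw [h5, Finset.filter_insert, if_pos hxy, Finset.sup_insert]
        set t := (X.filter (· < y)).sup id with ht
        -- The supremum 0 signals that nothing of `X` lies below `y`; then the new node `x` is the
        -- predecessor. Otherwise the predecessor is above `x` and remains unchanged.
        have h6 : t = 0 ∨ x < t := by
          by_cases he : (X.filter (· < y)).Nonempty
          · right
            obtain ⟨z, hz⟩ := he
            exact (h3 z (Finset.mem_filter.1 hz).1).trans_le (Finset.le_sup (f := id) hz)
          · left
            rw [Finset.not_nonempty_iff_eq_empty] at he
            rw [ht, he]; rfl
        simp only [id]
        rcases h6 with h6 | h6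
        · rw [h6, if_pos rfl]
          simp [show x ≠ 0 by omega]
        · rw [if_neg (by omega), sup_eq_right.2 h6.le, if_neg (by omega)]

/-- An ascending path read from its upper end is a descending one, so it needs no pattern of its
own. -/
theorem exists_downPath_of_upPath {U : ℕ → Option ℕ} {I K j : ℕ} (hu : UpPath U I j)
    (hd : DownPath U K j) : ∃ i, DownPath U (I + K) i := by
  induction I generalizing K j with
  | zero => exact ⟨j, by rwa [Nat.zero_add]⟩
  | succ I ih =>
    obtain ⟨h1, p, h2, h3⟩ := hu
    obtain ⟨i, hi⟩ := ih h3 (K := K + 1) ⟨j, h1, h2, hd⟩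
    exact ⟨i, by rwa [show I + 1 + K = I + (K + 1) by omega]⟩

/-- The patterns of edges whose potentials bound the probability of `HasLong`. -/
def longPatterns (n L : ℕ) : Finset (Finset ℕ × ℕ × Bool) :=
  Finset.powersetCard L (Finset.Icc 2 n) ×ˢ Finset.Icc 1 n ×ˢ Finset.univ

/-- The parent function of a pattern. -/
def patternFn (k : Finset ℕ × ℕ × Bool) : ℕ → ℕ :=
  if k.2.2 then prevIn k.1 k.2.1 else fun _ => k.2.1

/-- The sum of the potentials of all patterns. -/
def longPot (n L : ℕ) (s : GenState) : ℝ≥0∞ :=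
  ∑ k ∈ longPatterns n L, genPot k.1 (patternFn k) s

theorem HasLong.exists_pattern {n L : ℕ} {s : GenState} (h : Consistent n s) (hL : 1 ≤ L)
    (hl : HasLong (parentFn s) L) :
    ∃ k ∈ longPatterns n L, ∀ x ∈ k.1, parentFn s x = some (patternFn k x) := by
  have hdown : ∀ j, DownPath (parentFn s) L j →
      ∃ k ∈ longPatterns n L, ∀ x ∈ k.1, parentFn s x = some (patternFn k x) := by
    intro j hj
    obtain ⟨X, h1, h2, -, h4⟩ := exists_chain_of_downPath h hj
    obtain ⟨L, rfl⟩ : ∃ l, L = l + 1 := ⟨L - 1, by omega⟩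
    obtain ⟨x, hx2, hx, -⟩ := hj
    have hr := h.u_range x j hx
    refine ⟨(X, j, true), ?_, h4⟩
    simp only [longPatterns, Finset.mem_product, Finset.mem_powersetCard, Finset.mem_univ,
      and_true, Finset.mem_Icc]
    exact ⟨⟨h1, h2⟩, by omega, by omega⟩
  obtain ⟨j, hj | hj | ⟨k, hk, A, hA, hA'⟩⟩ := hl
  · exact hdown j hj
  · obtain ⟨i, hi⟩ := exists_downPath_of_upPath hj (K := 0) trivial
    exact hdown i hi
  · obtain ⟨x, hx⟩ : A.Nonempty := Finset.card_pos.1 (by omega)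
    have hr := h.u_range x j (hA' x hx).2
    refine ⟨(A, j, false), ?_, fun y hy => (hA' y hy).2⟩
    simp only [longPatterns, Finset.mem_product, Finset.mem_powersetCard, Finset.mem_univ,
      and_true, Finset.mem_Icc]
    refine ⟨⟨fun y hy => Finset.mem_Icc.2 ⟨?_, (h.u_range y j (hA' y hy).2).2.1⟩, hA⟩, hr.1, ?_⟩
    · have := (hA' y hy).1
      omega
    · omega

/-- A pattern that is present has all its weights equal to 1, hence potential 1. -/
theorem ind_hasLong_le {n L : ℕ} {s : GenState} (h : Consistent n s) (hL : 1 ≤ L) :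
    ind (HasLong (parentFn s) L) ≤ longPot n L s := by
  by_cases hl : HasLong (parentFn s) L
  · obtain ⟨k, hk, hu⟩ := hl.exists_pattern h hL
    rw [ind_of_true hl]
    refine le_trans (le_of_eq ?_) (Finset.single_le_sum (fun _ _ => zero_le) hk)
    unfold genPot pot
    rw [Finset.prod_eq_one]
    intro x hx
    rw [edgeWeight_some (hu x hx), if_pos rfl]
  · rw [ind_of_false hl]
    exact zero_le

theorem longPatterns_le {n L : ℕ} {k : Finset ℕ × ℕ × Bool} (hk : k ∈ longPatterns n L) :
    k.1 ⊆ Finset.Icc 2 n ∧ k.1.card = L := by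
  simp only [longPatterns, Finset.mem_product, Finset.mem_powersetCard] at hk
  exact hk.1

/-- The total potential is a finite sum of supermartingales. -/
theorem Spec.longPot_le {n L : ℕ} {α : Type} {P : Prog α} {m : Mach} {ε : ℝ≥0∞}
    {Q C : α → Mach → Prop} (h : Spec n P m ε (fun X g => genPot X g m.gen) Q C) :
    wp P m (fun r => longPot n L r.2.gen) ≤ longPot n L m.gen := by
  unfold longPot wp
  simp only [Finset.mul_sum]
  rw [Summable.tsum_finsetSum fun _ _ => ENNReal.summable]
  exact Finset.sum_le_sum fun k hk => h.mart k.1 _ fun x hx =>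
    (Finset.mem_Icc.1 ((longPatterns_le hk).1 hx)).2

/-! ## Sequences of queries -/

theorem GenInv.init {n : ℕ} (hn : 1 ≤ n) : GenInv n GenState.init := by
  have hu : ∀ j p : ℕ, GenState.init.u[j]? = some p ↔ j = 1 ∧ p = 1 := by
    intro j p
    unfold GenState.init
    dsimp only
    rw [getElem?_insert_nat]
    split
    · subst_vars; simp [eq_comm]
    · simp; omega
  have ht : ∀ (j : ℕ) (f : PtrFlag), GenState.init.type[j]? = some f ↔ j = 1 ∧ f = PtrFlag.dir := by
    intro j p
    unfold GenState.init
    dsimp only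
    rw [getElem?_insert_nat]
    split
    · subst_vars; simp [eq_comm]
    · simp; omega
  have hf : ∀ j : ℕ, GenState.init.front[j]? = none := by simp [GenState.init]
  have hi : ∀ j : ℕ, GenState.init.frontInv[j]? = none := by simp [GenState.init]
  have hc : ∀ j : ℕ, GenState.init.child[j]? = none := by simp [GenState.init]
  have hh : ∀ j : ℕ, GenState.init.heap[j]? = none := by simp [GenState.init]
  refine ⟨⟨(hu 1 1).2 ⟨rfl, rfl⟩, ?_, (ht 1 _).2 ⟨rfl, rfl⟩, ?_, ?_, ?_, ?_, ?_, ?_, ?_⟩, ?_,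
    ⟨?_, ?_, ?_, ?_⟩⟩
  · intro j p hj
    rw [hu] at hj
    omega
  · intro j f hj
    rw [ht] at hj
    rw [(hu j 1).2 ⟨hj.1, rfl⟩]; rfl
  · intro j x hj
    rw [hf] at hj; cases hj
  · intro x j
    rw [hf, hi]; simp
  · intro j t hj
    rw [hc] at hj; cases hj
  · intro j _ x hx hux
    rw [hu] at hux
    omega
  · intro k
    simp only [hf]
    simp [GenState.init]
  · intro k
    simp only [hf]
    simp [GenState.init]
  · intro x hx
    rw [hi] at hx; cases hx
  · intro i h hj
    rw [hh] at hj; cases hj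
  · intro i hi
    simp [GenState.init] at hi
  · intro i _
    exact hh i
  · intro i
    refine ⟨0, zero_le, ?_⟩
    have : heapItems GenState.init i = 0 := by
      unfold heapItems; rw [hh]; rfl
    rw [this]
    exact ItemsOK.zero ..

theorem pmf_map_expect {α β : Type} (p : PMF α) (k : α → β) (f : β → ℝ≥0∞) :
    ∑' b, (p.map k) b * f b = ∑' a, p a * f (k a) := by
  rw [← PMF.bind_pure_comp, pmf_bind_expect]
  simp only [Function.comp, pmf_pure_expect]

section queries

variable {n c R Tt Bt L : ℕ} {p₀ : ℝ≥0∞} {q : List ℕ → ℕ}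

theorem runQueries_support (htoss : TossBound n c Tt Bt p₀) (hn : 1 ≤ n)
    (hq : ∀ ans : List ℕ, q ans ∈ Finset.Icc 1 n) (t : ℕ) :
    ∀ r, runQueries n c q t r ≠ 0 → GenInv n r.2 := by
  induction t with
  | zero =>
    intro r hr
    rw [runQueries, ← PMF.mem_support_iff, PMF.mem_support_pure_iff] at hr
    subst hr
    exact GenInv.init hn
  | succ t ih =>
    intro r hr
    rw [runQueries, ← PMF.mem_support_iff, PMF.mem_support_bind_iff] at hr
    obtain ⟨p, hp, hr⟩ := hr
    rw [PMF.mem_support_map_iff] at hr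
    obtain ⟨⟨a, m'⟩, ha, rfl⟩ := hr
    have hqp := Finset.mem_Icc.1 (hq p.1)
    exact (baNextNeighbor_spec (R := 0) (L := 0) htoss hqp.1 hqp.2 (m := ⟨p.2, 0, 0⟩)
      (ih p hp)).supp a m' ha

/-- The potential does not increase from any state and for any queried node, so an adaptive choice
of the queries makes no difference. The choice R = L = 0 is immaterial, because only the cost part
of `Spec` depends on it. -/
theorem runQueries_longPot_le (htoss : TossBound n c Tt Bt p₀) (hn : 1 ≤ n)
    (hq : ∀ ans : List ℕ, q ans ∈ Finset.Icc 1 n) (t : ℕ) :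
    ∑' r, runQueries n c q t r * longPot n L r.2 ≤ longPot n L GenState.init := by
  induction t with
  | zero =>
    rw [runQueries, pmf_pure_expect]
  | succ t ih =>
    rw [runQueries, pmf_bind_expect]
    refine le_trans (ENNReal.tsum_le_tsum fun p => ?_) ih
    by_cases hp : runQueries n c q t p = 0
    · simp [hp]
    refine mul_le_mul_right ?_ _
    rw [pmf_map_expect]
    have hqp := Finset.mem_Icc.1 (hq p.1)
    exact (baNextNeighbor_spec (R := 0) (L := 0) htoss hqp.1 hqp.2 (m := ⟨p.2, 0, 0⟩)
      (runQueries_support htoss hn hq t p hp)).longPot_le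

/-- A call that exceeds its bounds either does so without a long path or large degree, which has
probability at most `callFail`, or ends in a state with `HasLong`, which is bounded by the expected
total potential. -/
theorem callCost_expect_le (htoss : TossBound n c Tt Bt p₀) (hn : 1 ≤ n) (hL : 1 ≤ L)
    (hq : ∀ ans : List ℕ, q ans ∈ Finset.Icc 1 n) (t : ℕ) :
    ∑' x, callCost n c q t x * ind (¬(x.spaceIncrease ≤ callSpace L ∧
        x.randomBits ≤ callBits n R Bt L ∧ x.time ≤ callTime n R Tt L)) ≤
      callFail n R L p₀ + longPot n L GenState.init := by
  rw [callCost, pmf_bind_expect]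
  calc _ ≤ ∑' p, runQueries n c q t p * (callFail n R L p₀ + longPot n L p.2) := by
        refine ENNReal.tsum_le_tsum fun p => ?_
        by_cases hp : runQueries n c q t p = 0
        · simp [hp]
        refine mul_le_mul_right ?_ _
        rw [pmf_map_expect]
        have hqp := Finset.mem_Icc.1 (hq p.1)
        have hspec := baNextNeighbor_spec (R := R) (L := L) htoss hqp.1 hqp.2 (m := ⟨p.2, 0, 0⟩)
          (runQueries_support htoss hn hq t p hp)
        refine le_trans ?_ (add_le_add hspec.cost hspec.longPot_le)
        rw [← wp_add]
        refine wp_mono fun a m' ha => ?_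
        refine le_trans (ind_or_le (r := HasLong (parentFn m'.gen) L) fun hbad => ?_)
          (add_le_add le_rfl (ind_hasLong_le (hspec.supp a m' ha).inv hL))
        by_contra hc
        rw [not_or, not_not] at hc
        rcases hc.1 with h1 | h1
        · refine hbad ⟨?_, ?_, ?_⟩
          · have := h1.space
            dsimp only at this ⊢
            omega
          · simpa using h1.bits
          · simpa using h1.time
        · exact hc.2 h1
    _ ≤ _ := by
        simp only [mul_add]
        rw [ENNReal.tsum_add, ENNReal.tsum_mul_right, PMF.tsum_coe, one_mul]
        exact add_le_add le_rfl (runQueries_longPot_le htoss hn hq t)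

end queries

end

open scoped ENNReal

noncomputable section

/-! ## The initial potential -/

theorem edgeWeight_init_le {x : ℕ} (hx : 2 ≤ x) (i : ℕ) :
    edgeWeight (parentFn GenState.init) (frontVal GenState.init) x i ≤
      2 * ((x - 1 : ℕ) : ℝ≥0∞)⁻¹ := by
  have hu : parentFn GenState.init x = none := by
    unfold parentFn GenState.init
    dsimp only
    rw [getElem?_insert_nat, if_neg (by omega)]
    simp
  have ho : (openNodes (frontVal GenState.init) x).card = x - 1 := by
    have : openNodes (frontVal GenState.init) x = Finset.Ico 1 x := by
      unfold openNodes
      rw [Finset.filter_true_of_mem]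
      intro i _
      simp [frontVal, GenState.init]
      omega
    rw [this, Nat.card_Ico]
  rw [edgeWeight_none hu, ho, two_mul]
  refine add_le_add ?_ le_rfl
  split_ifs
  · exact le_rfl
  · exact zero_le

/-- Since 1 + 4/a ≤ (1 + 1/a)⁴ and 1 + 1/a = (a+1)/a, the product telescopes. -/
theorem prod_one_add_four_le (n : ℕ) :
    ∏ x ∈ Finset.Icc 2 (n + 1), (1 + 4 * ((x - 1 : ℕ) : ℝ≥0∞)⁻¹) ≤ ((n + 1 : ℕ) : ℝ≥0∞) ^ 4 := by
  induction n with
  | zero => simp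
  | succ n ih =>
    rw [Finset.prod_Icc_succ_top (by omega), Nat.add_sub_cancel]
    have h0 : ((n + 1 : ℕ) : ℝ≥0∞) ≠ 0 := by exact_mod_cast (by omega : n + 1 ≠ 0)
    set a : ℝ≥0∞ := ((n + 1 : ℕ) : ℝ≥0∞) with ha
    have h1 : 1 + 4 * a⁻¹ ≤ (1 + a⁻¹) ^ 4 := by
      calc 1 + 4 * a⁻¹ ≤ 1 + 4 * a⁻¹ + (6 * a⁻¹ ^ 2 + 4 * a⁻¹ ^ 3 + a⁻¹ ^ 4) := le_self_add
        _ = _ := by ring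
    calc _ ≤ a ^ 4 * (1 + a⁻¹) ^ 4 := mul_le_mul' ih h1
      _ = (a * (1 + a⁻¹)) ^ 4 := (mul_pow _ _ _).symm
      _ = _ := by
          rw [mul_add, ENNReal.mul_inv_cancel h0 (ENNReal.natCast_ne_top _), ha]
          push_cast
          ring

/-- Writing 2/(x-1) as 4/(x-1) · 1/2 splits off the factor 2^{-L}. The remaining sum over `L`-sets
is an elementary symmetric polynomial, bounded by the product of all 1 + 4/(x-1), hence by n⁴. The
factor 2n counts the node and the kind of a pattern. -/
theorem longPot_init_le {n : ℕ} (hn : 1 ≤ n) (L : ℕ) :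
    longPot n L GenState.init ≤ 2 * n * ((n : ℝ≥0∞) ^ 4 * 2⁻¹ ^ L) := by
  obtain ⟨n, rfl⟩ : ∃ k, n = k + 1 := ⟨n - 1, by omega⟩
  have h1 : ∀ k ∈ longPatterns (n + 1) L, genPot k.1 (patternFn k) GenState.init ≤
      (∏ x ∈ k.1, 4 * ((x - 1 : ℕ) : ℝ≥0∞)⁻¹) * 2⁻¹ ^ L := by
    intro k hk
    obtain ⟨h2, h3⟩ := longPatterns_le hk
    rw [← h3, ← Finset.prod_const, ← Finset.prod_mul_distrib]
    refine Finset.prod_le_prod' fun x hx => (edgeWeight_init_le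
      (Finset.mem_Icc.1 (h2 hx)).1 _).trans_eq ?_
    rw [mul_right_comm]
    congr 1
    rw [show (4 : ℝ≥0∞) = 2 * 2 by norm_num, mul_assoc, ENNReal.mul_inv_cancel (by norm_num)
      (by norm_num), mul_one]
  calc longPot (n + 1) L GenState.init
      ≤ ∑ k ∈ longPatterns (n + 1) L, (∏ x ∈ k.1, 4 * ((x - 1 : ℕ) : ℝ≥0∞)⁻¹) * 2⁻¹ ^ L :=
        Finset.sum_le_sum h1
    _ = 2 * ((n + 1 : ℕ) : ℝ≥0∞) * ((∑ X ∈ Finset.powersetCard L (Finset.Icc 2 (n + 1)),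
          ∏ x ∈ X, 4 * ((x - 1 : ℕ) : ℝ≥0∞)⁻¹) * 2⁻¹ ^ L) := by
        rw [longPatterns, Finset.sum_product, Finset.sum_mul, Finset.mul_sum]
        refine Finset.sum_congr rfl fun X _ => ?_
        dsimp only
        rw [Finset.sum_const, Finset.card_product, Nat.card_Icc, Finset.card_univ,
          Fintype.card_bool, nsmul_eq_mul]
        push_cast
        ring
    _ ≤ _ := by
        refine mul_le_mul_right (mul_le_mul_left ?_ _) _
        refine le_trans ?_ (prod_one_add_four_le n)
        rw [Finset.prod_one_add]
        exact Finset.sum_le_sum_of_subset (fun X hX =>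
          Finset.mem_powerset.2 (Finset.mem_powersetCard.1 hX).1)

/-- Only n-1 nodes have a parent different from themselves, so there is no pattern with `n` edges.
-/
theorem longPot_self (n : ℕ) (hn : 1 ≤ n) (s : GenState) : longPot n n s = 0 := by
  unfold longPot longPatterns
  rw [Finset.powersetCard_eq_empty.2 (by rw [Nat.card_Icc]; omega)]
  simp

/-! ## The resources of `toss` -/

theorem tossBound_fast {n : ℕ} (hn : 1 ≤ n) (c : ℕ) :
    TossBound n c (Nat.log 2 (n + 1) + 3) (Nat.clog 2 (n ^ c)) (n * ((n ^ c : ℕ) : ℝ≥0∞)⁻¹) := by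
  intro ξ t m h1 _ h2 h3
  refine le_trans (wp_mono fun a m' _ => ind_mono ?_) ((toss_fallback_le n c ξ t hn h1 h2 m).trans
    (mul_le_mul_left (by exact_mod_cast (by omega : t - 1 ≤ n)) _))
  intro h4 h5
  have : Nat.log 2 t ≤ Nat.log 2 (n + 1) := Nat.log_mono_right h3
  exact h4 ⟨by omega, h5.2⟩

/-- For fixed `n` only finitely many parameters of a toss occur; summing their worst cases gives a
bound that never fails. -/
theorem exists_tossBound_zero {n : ℕ} (hn : 1 ≤ n) (c : ℕ) : ∃ Tt Bt, TossBound n c Tt Bt 0 := by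
  refine ⟨2 * Nat.log 2 (n + 1) + 6 + (n + 1), Nat.clog 2 (n ^ c) +
    ∑ ξ ∈ Finset.range (n + 1), ∑ t ∈ Finset.range (n + 2), Nat.clog 2 (tossGrid ξ t), ?_⟩
  intro ξ t m h1 h2 h3 h4
  refine wp_le_of_always fun a m' hp => (ind_of_false ?_).le
  obtain ⟨-, -, h5, h6⟩ := toss_always n c ξ t hn h1 h3 m a m' hp
  have h7 : Nat.log 2 t ≤ Nat.log 2 (n + 1) := Nat.log_mono_right h4
  have h8 : Nat.clog 2 (tossGrid ξ t) ≤
      ∑ ξ ∈ Finset.range (n + 1), ∑ t ∈ Finset.range (n + 2), Nat.clog 2 (tossGrid ξ t) :=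
    le_trans (Finset.single_le_sum (f := fun t => Nat.clog 2 (tossGrid ξ t))
      (fun _ _ => Nat.zero_le _) (Finset.mem_range.2 (by omega)))
      (Finset.single_le_sum
        (f := fun ξ => ∑ t ∈ Finset.range (n + 2), Nat.clog 2 (tossGrid ξ t))
        (fun _ _ => Nat.zero_le _) (Finset.mem_range.2 (by omega)))
  rw [not_not]
  constructor
  · dsimp only; omega
  · dsimp only; omega

/-! ## The main theorem -/

theorem ofReal_one_sub_le_toOuterMeasure {α : Type} (p : PMF α) (S : Set α) {δ : ℝ} (hδ : 0 ≤ δ)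
    (h : ∑' x, p x * ind (x ∉ S) ≤ ENNReal.ofReal δ) :
    ENNReal.ofReal (1 - δ) ≤ p.toOuterMeasure S := by
  rw [ENNReal.ofReal_sub _ hδ, ENNReal.ofReal_one, tsub_le_iff_right]
  refine le_trans ?_ (add_le_add le_rfl h)
  rw [PMF.toOuterMeasure_apply, ← ENNReal.tsum_add, ← p.tsum_coe]
  refine ENNReal.tsum_le_tsum fun x => ?_
  by_cases hx : x ∈ S
  · rw [Set.indicator_of_mem hx]
    exact le_self_add
  · rw [ind_of_true hx, mul_one]
    exact le_add_self

/-- The claim of the main theorem for a fixed number of nodes. -/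
def CallBound (n c : ℕ) (d C : ℝ) : Prop :=
  ∀ q : List ℕ → ℕ, (∀ ans : List ℕ, q ans ∈ Finset.Icc 1 n) → ∀ t : ℕ,
    ENNReal.ofReal (1 - 1 / (n : ℝ) ^ d) ≤
      (callCost n c q t).toOuterMeasure
        {x : CallCost |
          (x.spaceIncrease : ℝ) ≤ C * Real.log n ^ 2 ∧
          (x.randomBits : ℝ) ≤ C * Real.log n ^ 4 ∧
          (x.time : ℝ) ≤ C * Real.log n ^ 5}

theorem CallBound.mono {n c : ℕ} {d C C' : ℝ} (h : CallBound n c d C) (hC : C ≤ C')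
    (hn : 1 ≤ n) : CallBound n c d C' := by
  intro q hq t
  have hl : 0 ≤ Real.log n := Real.log_nonneg (by exact_mod_cast hn)
  refine (h q hq t).trans (MeasureTheory.measure_mono ?_)
  rintro x ⟨h1, h2, h3⟩
  exact ⟨h1.trans (by gcongr), h2.trans (by gcongr), h3.trans (by gcongr)⟩

theorem CallBound.of_tossBound {n c R Tt Bt L : ℕ} {p₀ : ℝ≥0∞} {d C : ℝ}
    (htoss : TossBound n c Tt Bt p₀) (hn : 1 ≤ n) (hL : 1 ≤ L)
    (hfail : callFail n R L p₀ + longPot n L GenState.init ≤ ENNReal.ofReal (1 / (n : ℝ) ^ d))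
    (hS : (callSpace L : ℝ) ≤ C * Real.log n ^ 2)
    (hB : (callBits n R Bt L : ℝ) ≤ C * Real.log n ^ 4)
    (hT : (callTime n R Tt L : ℝ) ≤ C * Real.log n ^ 5) : CallBound n c d C := by
  intro q hq t
  refine ofReal_one_sub_le_toOuterMeasure _ _ (by positivity) ?_
  refine le_trans (ENNReal.tsum_le_tsum fun x => mul_le_mul_right (ind_mono ?_) _)
    ((callCost_expect_le (R := R) (L := L) htoss hn hL hq t).trans hfail)
  intro hx hc
  refine hx ⟨le_trans ?_ hS, le_trans ?_ hB, le_trans ?_ hT⟩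
  · exact_mod_cast hc.1
  · exact_mod_cast hc.2.1
  · exact_mod_cast hc.2.2

/-- For every single `n` the resources are bounded with certainty. -/
theorem exists_callBound {n : ℕ} (hn : 2 ≤ n) (c : ℕ) (d : ℝ) :
    ∃ C : ℝ, 0 ≤ C ∧ CallBound n c d C := by
  obtain ⟨Tt, Bt, htoss⟩ := exists_tossBound_zero (n := n) (by omega) c
  have hl : 0 < Real.log n := Real.log_pos (by exact_mod_cast (by omega : 1 < n))
  refine ⟨callSpace n / Real.log n ^ 2 + callBits n (n + 1) Bt n / Real.log n ^ 4 +
    callTime n (n + 1) Tt n / Real.log n ^ 5, by positivity,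
    CallBound.of_tossBound (R := n + 1) (L := n) htoss (by omega) (by omega) ?_ ?_ ?_ ?_⟩
  -- With R = n+1, L = n and p = 0 every failure term vanishes: the loop has no more than n+1
  -- rounds, and no pattern has n edges.
  · rw [longPot_self n (by omega), callFail, levelFail, roundTail, if_neg (lt_irrefl _)]
    simp
  · rw [← div_le_iff₀ (by positivity)]
    have h1 : (0 : ℝ) ≤ callBits n (n + 1) Bt n / Real.log n ^ 4 := by positivity
    have h2 : (0 : ℝ) ≤ callTime n (n + 1) Tt n / Real.log n ^ 5 := by positivity
    linarith
  · rw [← div_le_iff₀ (by positivity)]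
    have h1 : (0 : ℝ) ≤ callSpace n / Real.log n ^ 2 := by positivity
    have h2 : (0 : ℝ) ≤ callTime n (n + 1) Tt n / Real.log n ^ 5 := by positivity
    linarith
  · rw [← div_le_iff₀ (by positivity)]
    have h1 : (0 : ℝ) ≤ callSpace n / Real.log n ^ 2 := by positivity
    have h2 : (0 : ℝ) ≤ callBits n (n + 1) Bt n / Real.log n ^ 4 := by positivity
    linarith

end

/-! ### Asymptotics of the resource and failure bounds -/

open scoped ENNReal

noncomputable section

section resources

variable {n c κ ℓ : ℕ}

theorem pow_mul_pow_le_pow_mul_pow {a b i j i' j' : ℕ} (ha : 1 ≤ a) (hb : 1 ≤ b) (hi : i ≤ i')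
    (hj : j ≤ j') : a ^ i * b ^ j ≤ a ^ i' * b ^ j' :=
  Nat.mul_le_mul (Nat.pow_le_pow_right ha hi) (Nat.pow_le_pow_right hb hj)

theorem log_add_two_le (hn : 2 ≤ n) : Nat.log 2 (n + 2) ≤ Nat.log 2 n + 1 := by
  rw [← Nat.log_mul_base (by norm_num) (by omega)]
  exact Nat.log_mono_right (by omega)

theorem opCost_le (hn : 2 ≤ n) (hℓ : ℓ = Nat.log 2 n + 1) : opCost (n + 2) ≤ 16 * ℓ := by
  have := log_add_two_le hn
  unfold opCost
  omega

theorem roundTime_le (hn : 2 ≤ n) (hℓ : ℓ = Nat.log 2 n + 1) :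
    roundTime n (Nat.log 2 (n + 1) + 3) ≤ 357 * ℓ ^ 2 := by
  have h1 := opCost_le hn hℓ
  have h2 := log_add_two_le hn
  have h3 : Nat.log 2 (n + 1) ≤ Nat.log 2 (n + 2) := Nat.log_mono_right (by omega)
  have h4 := Nat.mul_le_mul h1 h1
  have h5 : 1 ≤ ℓ := by omega
  have h6 : ℓ ≤ ℓ ^ 2 := Nat.le_self_pow (by norm_num) ℓ
  unfold roundTime
  have h7 : 16 * ℓ * (16 * ℓ) = 256 * ℓ ^ 2 := by ring
  omega

/-- A round costs O(ℓ²). The factors for the rounds, the depth of the recursion and the steps of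
`next-child-tp` contribute κℓ each; lower powers are absorbed using κ, ℓ ≥ 1. -/
theorem callTime_le (hn : 2 ≤ n) (hℓ : ℓ = Nat.log 2 n + 1) (hκ : 1 ≤ κ) :
    callTime n (κ * ℓ) (Nat.log 2 (n + 1) + 3) (κ * ℓ) ≤ 2538 * κ ^ 3 * ℓ ^ 5 := by
  have hO := opCost_le hn hℓ
  have hr := roundTime_le hn hℓ
  have h1 : 1 ≤ ℓ := by omega
  have m1 := fun i j hi hj => pow_mul_pow_le_pow_mul_pow (i := i) (j := j) (i' := 1) (j' := 3)
    hκ h1 hi hj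
  have m2 := fun i j hi hj => pow_mul_pow_le_pow_mul_pow (i := i) (j := j) (i' := 2) (j' := 4)
    hκ h1 hi hj
  have m3 := fun i j hi hj => pow_mul_pow_le_pow_mul_pow (i := i) (j := j) (i' := 3) (j' := 5)
    hκ h1 hi hj
  have hl : levelTime n (κ * ℓ) (Nat.log 2 (n + 1) + 3) ≤ 853 * (κ ^ 1 * ℓ ^ 3) := by
    have := Nat.mul_le_mul_left (κ * ℓ) hr
    have e := m1 0 1 (by omega) (by omega)
    unfold levelTime
    linarith
  have hs : stepTime n (κ * ℓ) (Nat.log 2 (n + 1) + 3) (κ * ℓ) ≤ 949 * (κ ^ 2 * ℓ ^ 4) := by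
    have := Nat.mul_le_mul_left (κ * ℓ) hl
    have e := m2 0 1 (by omega) (by omega)
    unfold stepTime
    linarith
  have h2 := Nat.mul_le_mul_left (κ * ℓ) hs
  have h3 := Nat.mul_le_mul_left (κ * ℓ) hO
  have e1 := m3 0 1 (by omega) (by omega)
  have e2 := m3 1 2 (by omega) (by omega)
  unfold callTime
  linarith

theorem callBits_le (hn : 2 ≤ n) (hℓ : ℓ = Nat.log 2 n + 1) (hκ : 1 ≤ κ) (hc : c ≤ κ) :
    callBits n (κ * ℓ) (Nat.clog 2 (n ^ c)) (κ * ℓ) ≤ 68 * κ ^ 4 * ℓ ^ 4 := by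
  have hO := opCost_le hn hℓ
  have h1 : 1 ≤ ℓ := by omega
  have hb : Nat.clog 2 (n ^ c) ≤ κ * ℓ := by
    refine Nat.clog_le_of_le_pow ?_
    calc n ^ c ≤ (2 ^ ℓ) ^ c := by
          refine Nat.pow_le_pow_left ?_ c
          rw [hℓ]
          exact (Nat.lt_pow_succ_log_self (by norm_num) n).le
      _ = 2 ^ (c * ℓ) := by rw [← pow_mul, mul_comm]
      _ ≤ 2 ^ (κ * ℓ) := Nat.pow_le_pow_right (by norm_num) (Nat.mul_le_mul_right _ hc)
  have m1 := fun i j hi hj => pow_mul_pow_le_pow_mul_pow (i := i) (j := j) (i' := 2) (j' := 2)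
    hκ h1 hi hj
  have m2 := fun i j hi hj => pow_mul_pow_le_pow_mul_pow (i := i) (j := j) (i' := 4) (j' := 4)
    hκ h1 hi hj
  have hl : levelBits n (κ * ℓ) (Nat.clog 2 (n ^ c)) ≤ 18 * (κ ^ 2 * ℓ ^ 2) := by
    have := Nat.mul_le_mul_left (κ * ℓ) hb
    have e := m1 0 1 (by omega) (by omega)
    have e' := m1 0 0 (by omega) (by omega)
    unfold levelBits
    linarith
  have h2 := Nat.mul_le_mul_left (κ * ℓ) (Nat.mul_le_mul_left (κ * ℓ) hl)
  have h3 := Nat.mul_le_mul_left (κ * ℓ) hO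
  have e1 := m2 0 1 (by omega) (by omega)
  have e2 := m2 1 2 (by omega) (by omega)
  unfold callBits
  linarith

theorem callSpace_le (h1 : 1 ≤ ℓ) (hκ : 1 ≤ κ) : callSpace (κ * ℓ) ≤ 66 * κ ^ 2 * ℓ ^ 2 := by
  have m1 := fun i j hi hj => pow_mul_pow_le_pow_mul_pow (i := i) (j := j) (i' := 2) (j' := 2)
    hκ h1 hi hj
  have e1 := m1 1 1 (by omega) (by omega)
  have e2 := m1 0 0 (by omega) (by omega)
  unfold callSpace
  linarith

/-- With L = R = (c+10)ℓ one has 2^{-L} ≤ n^{-(c+10)}, which absorbs the polynomial factors of the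
round tail and of the pattern sum. What is left is dominated by the second stages of the tosses. -/
theorem fail_le (hn : 2 ≤ n) (hc : 1 ≤ c) (hℓ : n ≤ 2 ^ ℓ) :
    callFail n ((c + 10) * ℓ) ((c + 10) * ℓ) (n * ((n ^ c : ℕ) : ℝ≥0∞)⁻¹) +
        longPot n ((c + 10) * ℓ) GenState.init ≤
      ((2 * ((c + 10) * ℓ) ^ 2 * ((c + 10) * ℓ + 1) + 1 : ℕ) : ℝ≥0∞) * (n : ℝ≥0∞)⁻¹ ^ (c - 1) := by
  obtain ⟨c, rfl⟩ : ∃ k, c = k + 1 := ⟨c - 1, by omega⟩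
  rw [Nat.add_sub_cancel]
  set N : ℝ≥0∞ := (n : ℝ≥0∞) with hN
  set L := (c + 1 + 10) * ℓ with hL
  have h0 : N ≠ 0 := by rw [hN]; exact_mod_cast (by omega : n ≠ 0)
  have hNw : N * N⁻¹ = 1 := ENNReal.mul_inv_cancel h0 (ENNReal.natCast_ne_top _)
  have hw1 : N⁻¹ ≤ 1 := by
    rw [ENNReal.inv_le_one, hN]
    exact_mod_cast (by omega : 1 ≤ n)
  have hcancel : ∀ a b : ℕ, N ^ a * N⁻¹ ^ (a + b) = N⁻¹ ^ b := by
    intro a b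
    rw [pow_add, ← mul_assoc, ← mul_pow, hNw, one_pow, one_mul]
  have hpow : (2 : ℝ≥0∞)⁻¹ ^ L ≤ N⁻¹ ^ (c + 11) := by
    rw [hL, mul_comm, pow_mul]
    refine pow_le_pow_left' ?_ _
    rw [← ENNReal.inv_pow, ENNReal.inv_le_inv, hN]
    exact_mod_cast hℓ
  have hanti : ∀ {a b : ℕ}, a ≤ b → N⁻¹ ^ b ≤ N⁻¹ ^ a := fun h => pow_le_pow_right_of_le_one' hw1 h
  have hp : N * ((n ^ (c + 1) : ℕ) : ℝ≥0∞)⁻¹ = N⁻¹ ^ c := by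
    rw [Nat.cast_pow, ← hN, ENNReal.inv_pow, add_comm c 1]
    simpa using hcancel 1 c
  have htail : roundTail n L (n + 1) ≤ N⁻¹ ^ c := by
    unfold roundTail
    split_ifs
    · calc ((n + 1 : ℕ) : ℝ≥0∞) * 2⁻¹ ^ L ≤ N ^ 2 * N⁻¹ ^ (2 + (c + 9)) := by
            rw [show 2 + (c + 9) = c + 11 by omega]
            refine mul_le_mul' ?_ hpow
            rw [hN]
            exact_mod_cast (by nlinarith : n + 1 ≤ n ^ 2)
        _ = N⁻¹ ^ (c + 9) := hcancel _ _
        _ ≤ _ := hanti (by omega)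
    · exact zero_le
  have hlong : longPot n L GenState.init ≤ N⁻¹ ^ c := by
    refine (longPot_init_le (by omega) L).trans ?_
    calc 2 * N * (N ^ 4 * 2⁻¹ ^ L) ≤ N * N * (N ^ 4 * N⁻¹ ^ (6 + (c + 5))) := by
          rw [show 6 + (c + 5) = c + 11 by omega]
          refine mul_le_mul' (mul_le_mul_left ?_ _) (mul_le_mul_right hpow _)
          rw [hN]
          exact_mod_cast hn
      _ = N ^ 6 * N⁻¹ ^ (6 + (c + 5)) := by ring
      _ = N⁻¹ ^ (c + 5) := hcancel _ _
      _ ≤ _ := hanti (by omega)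
  rw [callFail, levelFail, hp]
  calc _ ≤ 2 * (L * (L * (L * N⁻¹ ^ c + N⁻¹ ^ c))) + N⁻¹ ^ c := by gcongr
    _ = _ := by push_cast; ring

theorem nat_log_succ_le (hn : 2 ≤ n) : ((Nat.log 2 n + 1 : ℕ) : ℝ) ≤ 3 * Real.log n := by
  have h1 : (Nat.log 2 n : ℝ) ≤ Real.logb 2 n := by
    simpa using Real.natLog_le_logb n 2
  have h2 := Real.log_two_gt_d9
  have h3 : Real.log 2 ≤ Real.log n :=
    Real.log_le_log (by norm_num) (by exact_mod_cast hn)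
  rw [← Real.log_div_log, le_div_iff₀ (by linarith)] at h1
  push_cast
  have h4 : (Nat.log 2 n : ℝ) ≤ Real.log n / Real.log 2 := by
    rwa [le_div_iff₀ (by linarith)]
  have h5 : Real.log n / Real.log 2 + 1 ≤ 3 * Real.log n := by
    rw [div_add_one (by linarith), div_le_iff₀ (by linarith)]
    nlinarith
  linarith

end resources

-- Here d < c-1 is used strictly: the positive power n^{c-1-d} outgrows log³ n.
open Filter in
theorem eventually_fail_le {c : ℕ} (hc : 1 ≤ c) {d : ℝ} (hdc : d < (c : ℝ) - 1) (K : ℝ) :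
    ∀ᶠ n : ℕ in atTop, K * Real.log n ^ 3 * (n : ℝ)⁻¹ ^ (c - 1) ≤ 1 / (n : ℝ) ^ d := by
  have hδ : 0 < (c : ℝ) - 1 - d := by linarith
  have h1 := (isLittleO_log_rpow_rpow_atTop 3 hδ).bound
    (show 0 < (|K| + 1)⁻¹ by positivity)
  have h2 := tendsto_natCast_atTop_atTop (R := ℝ) |>.eventually h1
  filter_upwards [h2, eventually_ge_atTop 2] with n hn hn2
  have hn0 : (0 : ℝ) < n := by exact_mod_cast (by omega : 0 < n)
  have hl : 0 ≤ Real.log n := Real.log_nonneg (by exact_mod_cast (by omega : 1 ≤ n))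
  rw [Real.norm_of_nonneg (Real.rpow_nonneg hl _), Real.norm_of_nonneg (by positivity),
    show (3 : ℝ) = ((3 : ℕ) : ℝ) by norm_num, Real.rpow_natCast] at hn
  have h3 : K * Real.log n ^ 3 ≤ (n : ℝ) ^ ((c : ℝ) - 1 - d) := by
    calc K * Real.log n ^ 3 ≤ (|K| + 1) * Real.log n ^ 3 := by
          gcongr
          linarith [le_abs_self K]
      _ ≤ (|K| + 1) * ((|K| + 1)⁻¹ * (n : ℝ) ^ ((c : ℝ) - 1 - d)) := by gcongr
      _ = _ := by field_simp
  have h4 : (n : ℝ) ^ ((c : ℝ) - 1 - d) * (n : ℝ)⁻¹ ^ (c - 1) = 1 / (n : ℝ) ^ d := by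
    rw [inv_pow, Real.rpow_sub hn0, ← Real.rpow_natCast, Nat.cast_sub hc, Nat.cast_one]
    have : (0 : ℝ) < (n : ℝ) ^ ((c : ℝ) - 1) := by positivity
    field_simp
  rw [← h4]
  gcongr

open Filter in
theorem eventually_callBound {c : ℕ} (hc : 1 ≤ c) {d : ℝ} (hdc : d < (c : ℝ) - 1) :
    ∃ C : ℝ, 0 ≤ C ∧ ∀ᶠ n : ℕ in atTop, CallBound n c d C := by
  set κ := c + 10 with hκ
  refine ⟨2538 * κ ^ 3 * 3 ^ 5 + 68 * κ ^ 4 * 3 ^ 4 + 66 * κ ^ 2 * 3 ^ 2, by positivity, ?_⟩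
  filter_upwards [eventually_fail_le hc hdc ((2 * κ ^ 2 * (κ + 1) + 1 : ℕ) * 3 ^ 3),
    eventually_ge_atTop 2] with n hn hn2
  obtain ⟨ℓ, hℓ⟩ : ∃ ℓ, ℓ = Nat.log 2 n + 1 := ⟨_, rfl⟩
  have hl := nat_log_succ_le hn2
  rw [← hℓ] at hl
  have h1 : 1 ≤ ℓ := by omega
  have hl0 : 0 ≤ Real.log n := Real.log_nonneg (by exact_mod_cast (by omega : 1 ≤ n))
  have hpow : ∀ k : ℕ, (ℓ : ℝ) ^ k ≤ 3 ^ k * Real.log n ^ k := by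
    intro k
    rw [← mul_pow]
    exact pow_le_pow_left₀ (by positivity) hl k
  have hnℓ : n ≤ 2 ^ ℓ := by
    rw [hℓ]
    exact (Nat.lt_pow_succ_log_self (by norm_num) n).le
  refine CallBound.of_tossBound (R := κ * ℓ) (L := κ * ℓ) (tossBound_fast (by omega) c) (by omega)
    (Nat.mul_pos (by omega) h1) ?_ ?_ ?_ ?_
  · refine (fail_le hn2 hc hnℓ).trans ?_
    rw [← hκ]
    have hn0 : (0 : ℝ) < n := by exact_mod_cast (by omega : 0 < n)
    have e : ((2 * (κ * ℓ) ^ 2 * (κ * ℓ + 1) + 1 : ℕ) : ℝ≥0∞) * (n : ℝ≥0∞)⁻¹ ^ (c - 1) =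
        ENNReal.ofReal (((2 * (κ * ℓ) ^ 2 * (κ * ℓ + 1) + 1 : ℕ) : ℝ) * (n : ℝ)⁻¹ ^ (c - 1)) := by
      rw [ENNReal.ofReal_mul (by positivity), ENNReal.ofReal_pow (by positivity),
        ENNReal.ofReal_inv_of_pos hn0, ENNReal.ofReal_natCast, ENNReal.ofReal_natCast]
    rw [e]
    refine ENNReal.ofReal_le_ofReal (le_trans (mul_le_mul_of_nonneg_right ?_ (by positivity)) hn)
    have h2 : 2 * (κ * ℓ) ^ 2 * (κ * ℓ + 1) + 1 ≤ (2 * κ ^ 2 * (κ + 1) + 1) * ℓ ^ 3 := by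
      have h3 : ℓ ^ 2 ≤ ℓ ^ 3 := Nat.pow_le_pow_right h1 (by norm_num)
      have h4 : 1 ≤ ℓ ^ 3 := Nat.one_le_pow _ _ h1
      have h5 := Nat.mul_le_mul_left (2 * κ ^ 2) h3
      linarith
    calc ((2 * (κ * ℓ) ^ 2 * (κ * ℓ + 1) + 1 : ℕ) : ℝ)
        ≤ ((2 * κ ^ 2 * (κ + 1) + 1 : ℕ) : ℝ) * (ℓ : ℝ) ^ 3 := by exact_mod_cast h2
      _ ≤ ((2 * κ ^ 2 * (κ + 1) + 1 : ℕ) : ℝ) * (3 ^ 3 * Real.log n ^ 3) := by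
          gcongr
          exact hpow 3
      _ = _ := by ring
  · calc (callSpace (κ * ℓ) : ℝ) ≤ 66 * κ ^ 2 * (ℓ : ℝ) ^ 2 := by
          exact_mod_cast callSpace_le h1 (by omega)
      _ ≤ 66 * κ ^ 2 * (3 ^ 2 * Real.log n ^ 2) := by
          gcongr
          exact hpow 2
      _ = (0 + 66 * κ ^ 2 * 3 ^ 2) * Real.log n ^ 2 := by ring
      _ ≤ _ := by
          gcongr
          positivity
  · calc (callBits n (κ * ℓ) (Nat.clog 2 (n ^ c)) (κ * ℓ) : ℝ) ≤ 68 * κ ^ 4 * (ℓ : ℝ) ^ 4 := by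
          exact_mod_cast callBits_le hn2 hℓ (by omega) (by omega)
      _ ≤ 68 * κ ^ 4 * (3 ^ 4 * Real.log n ^ 4) := by
          gcongr
          exact hpow 4
      _ = (0 + 68 * κ ^ 4 * 3 ^ 4 + 0) * Real.log n ^ 4 := by ring
      _ ≤ _ := by
          gcongr
          · positivity
          · positivity
  · calc (callTime n (κ * ℓ) (Nat.log 2 (n + 1) + 3) (κ * ℓ) : ℝ)
        ≤ 2538 * κ ^ 3 * (ℓ : ℝ) ^ 5 := by
          exact_mod_cast callTime_le hn2 hℓ (by omega)
      _ ≤ 2538 * κ ^ 3 * (3 ^ 5 * Real.log n ^ 5) := by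
          gcongr
          exact hpow 5
      _ = (2538 * κ ^ 3 * 3 ^ 5 + 0 + 0) * Real.log n ^ 5 := by ring
      _ ≤ _ := by
          gcongr
          · positivity
          · positivity

end

theorem mainTheorem3 (c : ℕ) (hc : 2 ≤ c) (d : ℝ) (hd : 0 < d) (hdc : d < (c : ℝ) - 1) :
    ∃ C : ℝ, 0 < C ∧ ∀ n : ℕ, 2 ≤ n →
      ∀ q : List ℕ → ℕ, (∀ ans : List ℕ, q ans ∈ Finset.Icc 1 n) → ∀ t : ℕ,
        ENNReal.ofReal (1 - 1 / (n : ℝ) ^ d) ≤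
          (callCost n c q t).toOuterMeasure
            {x : CallCost |
              (x.spaceIncrease : ℝ) ≤ C * Real.log n ^ 2 ∧
              (x.randomBits : ℝ) ≤ C * Real.log n ^ 4 ∧
              (x.time : ℝ) ≤ C * Real.log n ^ 5} := by
  obtain ⟨C₁, hC₁, hlarge⟩ := eventually_callBound (c := c) (by omega) hdc
  obtain ⟨n₀, hn₀⟩ := Filter.eventually_atTop.1 hlarge
  have hsmall : ∀ n : ℕ, ∃ C : ℝ, 0 ≤ C ∧ (2 ≤ n → CallBound n c d C) := by
    intro n
    by_cases hn : 2 ≤ n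
    · obtain ⟨C, h1, h2⟩ := exists_callBound hn c d
      exact ⟨C, h1, fun _ => h2⟩
    · exact ⟨0, le_rfl, fun h => absurd h hn⟩
  choose C₂ hC₂ hb using hsmall
  -- One constant serves all `n`: the asymptotic one plus the sum of the individual constants below
  -- the threshold.
  have hsum : 0 ≤ ∑ n ∈ Finset.range n₀, C₂ n := Finset.sum_nonneg fun n _ => hC₂ n
  refine ⟨C₁ + ∑ n ∈ Finset.range n₀, C₂ n + 1, by linarith, fun n hn => ?_⟩
  by_cases hnn : n₀ ≤ n
  · exact (hn₀ n hnn).mono (by linarith) (by omega)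
  · have h1 := Finset.single_le_sum (f := C₂) (s := Finset.range n₀) (fun n _ => hC₂ n)
      (Finset.mem_range.2 (not_le.1 hnn))
    exact (hb n hn).mono (by linarith) (by omega)
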